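/- Let $\lambda,\mu_d,t>0$, $u\ge 0$, and consider the surplus process $$R_s=u-\sum_{k=1}^{M_s}W_k+\sum_{k=1}^{N_s}B_{r,k},\qquad s\ge 0,$$ where $(N_s)$ and $(M_s)$ are homogeneous Poisson processes with intensities $\lambda$ and $\mu_d$, the $W_k$ are i.i.d., the $B_{r,k}$ are i.i.d., and $N,M,(W_k),(B_{r,k})$ are independent. Let $\tau=\inf\{s\ge 0: R_s<0\}$, let $T$ be exponentially distributed with mean $t$ and independent of everything else, and put $$\hat V(u,t)=\mathbb{E}\big(R_T\,\mathbb{I}_{\tau>T}\big).$$ Assume that $W_k$ and $B_{r,k}$ are combinations of exponentials with densities $$f_W(w)=\sum_{i=1}^n A_i\alpha_i e^{-\alpha_i w}\quad(w>0),\qquad f_{B_r}(b)=\sum_{i=1}^n A_i\beta_i e^{-\beta_i b}\quad(b>0),$$ where $0<\alpha_1<\dots<\alpha_n$, the $A_i$ are nonzero (not necessarily positive) with $A_1+\dots+A_n=1$, and $\beta_i=\alpha_i/a$ for a constant $a>0$, so that $B_r$ has the law of $aW$. Then: 1. The generalized Lundberg equation $$\lambda\sum_{i=1}^nA_i\frac{\beta_i}{\beta_i+r}+\mu_d\sum_{i=1}^nA_i\frac{\alpha_i}{\alpha_i-r}-\Big(\lambda+\mu_d+\frac1t\Big)=0$$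 has, counted with multiplicity, exactly $n$ solutions $r\in\mathbb{C}$ with positive real part. 2. The random variable $R_T\,\mathbb{I}_{\tau>T}$ is integrable, and if these solutions $r_1,\dots,r_n$ are pairwise distinct, then $$\hat V(u,t)=\sum_{k=1}^nC_ke^{-r_ku}+u+t\sum_{i=1}^nA_i\Big(\frac{\lambda}{\beta_i}-\frac{\mu_d}{\alpha_i}\Big),$$ where, for $k=1,\dots,n$, $$C_k=\frac{\displaystyle\sum_{j=1}^nB_j\prod_{h=1}^n(\alpha_j-r_h)\prod_{i\ne j}\frac{r_k-\alpha_i}{\alpha_j-\alpha_i}}{\displaystyle\prod_{h\ne k}(r_k-r_h)},\qquad B_j=\frac1{\alpha_j^2}-\frac t{\alpha_j}\sum_{i=1}^nA_i\Big(\frac{\lambda}{\beta_i}-\frac{\mu_d}{\alpha_i}\Big).$$ -/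

import Mathlib

open MeasureTheory ProbabilityTheory Filter Topology
open scoped NNReal ENNReal

noncomputable section

namespace MiningPool

/-- The function `w ↦ ∑ i, A i * α i * exp (-α i * w)` for `w > 0`, extended by `0` to `w ≤ 0`:
the (candidate) density of a combination of exponentials. -/
def combExpDensity {n : ℕ} (A α : Fin n → ℝ) : ℝ → ℝ :=
  Set.indicator (Set.Ioi 0) fun w => ∑ i, A i * α i * Real.exp (-α i * w)

/-- `A` (weights, nonzero, of any sign, summing to one) and `α` (rates, positive and strictly
increasing) are the parameters of a combination of exponentials, i.e. `combExpDensity A α` is a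
probability density. -/
structure IsCombExp {n : ℕ} (A α : Fin n → ℝ) : Prop where
  rate_pos : ∀ i, 0 < α i
  rate_strictMono : StrictMono α
  weight_ne_zero : ∀ i, A i ≠ 0
  weight_sum : ∑ i, A i = 1
  density_nonneg : ∀ w, 0 ≤ combExpDensity A α w

/-- The probability law on `ℝ` with Lebesgue density `combExpDensity A α`. -/
def combExpMeasure {n : ℕ} (A α : Fin n → ℝ) : Measure ℝ :=
  volume.withDensity fun w => ENNReal.ofReal (combExpDensity A α w)

/-- `N` is a homogeneous Poisson process with intensity `rate`: it almost surely starts at `0` and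
has nondecreasing right-continuous `ℕ`-valued paths, it has independent increments, and
`N t - N s` is Poisson distributed with parameter `rate * (t - s)`. -/
structure IsPoissonProcess {Ω : Type*} [MeasurableSpace Ω] (P : Measure Ω) (rate : ℝ)
    (N : ℝ≥0 → Ω → ℕ) : Prop where
  measurable : ∀ t, Measurable (N t)
  start_zero : ∀ᵐ ω ∂P, N 0 ω = 0
  monotone_paths : ∀ᵐ ω ∂P, Monotone fun t => N t ω
  rightContinuous_paths : ∀ᵐ ω ∂P, ∀ t, ContinuousWithinAt (fun s => N s ω) (Set.Ici t) t
  indep_increments : HasIndepIncrements N P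
  law_increments : ∀ s t, s ≤ t →
    HasLaw (fun ω => N t ω - N s ω) (poissonMeasure (rate.toNNReal * (t - s))) P

/-- The surplus `R t = u - ∑_{k ≤ M t} W_k + ∑_{k ≤ N t} B_k` of the pool manager with initial
capital `u` (the jump sizes are numbered from `0`). -/
def surplus {Ω : Type*} (N M : ℝ≥0 → Ω → ℕ) (W B : ℕ → Ω → ℝ) (u : ℝ) (s : ℝ≥0) (ω : Ω) : ℝ :=
  u - ∑ k ∈ Finset.range (M s ω), W k ω + ∑ k ∈ Finset.range (N s ω), B k ω

/-- The ruin time `τ = inf {s ≥ 0 : R s < 0}` of a process `R`; it is `∞` if there is no ruin. -/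
def ruinTime {Ω : Type*} (R : ℝ≥0 → Ω → ℝ) (ω : Ω) : ℝ≥0∞ :=
  ⨅ (s : ℝ≥0) (_ : R s ω < 0), (s : ℝ≥0∞)

/-- The random variable `R_T` on the event `{τ > T}`, and `0` off that event, for the surplus
process with initial capital `u`. -/
def survivingSurplus {Ω : Type*} (N M : ℝ≥0 → Ω → ℕ) (W B : ℕ → Ω → ℝ) (T : Ω → ℝ≥0) (u : ℝ) :
    Ω → ℝ :=
  Set.indicator {ω | (T ω : ℝ≥0∞) < ruinTime (surplus N M W B u) ω}
    fun ω => surplus N M W B u (T ω) ω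

/-- `V̂(u,t) = E[R_T ; τ > T]`, where `T` is the random time horizon. -/
def Vhat {Ω : Type*} [MeasurableSpace Ω] (P : Measure Ω) (N M : ℝ≥0 → Ω → ℕ) (W B : ℕ → Ω → ℝ)
    (T : Ω → ℝ≥0) (u : ℝ) : ℝ :=
  ∫ ω, survivingSurplus N M W B T u ω ∂P

/-- The stochastic ingredients of the pool: block rewards `B k` (i.i.d. with law `lawB`) arriving
along a Poisson process `N` with intensity `lam`, payments `W k` (i.i.d. with law `lawW`) due along a
Poisson process `M` with intensity `mud`, and an exponential time horizon `T` with mean `t`, all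
independent of each other. -/
structure IsPoolModel {Ω : Type*} [MeasurableSpace Ω] (P : Measure Ω) (lam mud t : ℝ)
    (lawW lawB : Measure ℝ) (N M : ℝ≥0 → Ω → ℕ) (W B : ℕ → Ω → ℝ) (T : Ω → ℝ≥0) : Prop where
  poisson_N : IsPoissonProcess P lam N
  poisson_M : IsPoissonProcess P mud M
  measurable_W : ∀ k, Measurable (W k)
  measurable_B : ∀ k, Measurable (B k)
  measurable_T : Measurable T
  law_W : ∀ k, HasLaw (W k) lawW P
  law_B : ∀ k, HasLaw (B k) lawB P
  law_T : HasLaw (fun ω => (T ω : ℝ)) (expMeasure (1 / t)) P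
  iIndep_W : iIndepFun W P
  iIndep_B : iIndepFun B P
  /-- the two counting processes, the two sequences of jump sizes and `T` are independent -/
  iIndep_all : iIndep
    ![⨆ s, MeasurableSpace.comap (N s) inferInstance,
      ⨆ s, MeasurableSpace.comap (M s) inferInstance,
      ⨆ k, MeasurableSpace.comap (W k) inferInstance,
      ⨆ k, MeasurableSpace.comap (B k) inferInstance,
      MeasurableSpace.comap T inferInstance] P

/-- Left-hand side of the generalized Lundberg equation, as a rational function of `r ∈ ℂ`. -/
def lundberg {n : ℕ} (lam mud t : ℝ) (A α β : Fin n → ℝ) (r : ℂ) : ℂ :=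
  lam * ∑ i, (A i : ℂ) * (β i / (β i + r)) + mud * ∑ i, (A i : ℂ) * (α i / (α i - r))
    - (lam + mud + 1 / t)

/-- The solutions with positive real part of the generalized Lundberg equation. The poles
`r = α i`, where the equation is meaningless, are excluded; the other poles `r = -β i` do not have
a positive real part. -/
def lundbergRoots {n : ℕ} (lam mud t : ℝ) (A α β : Fin n → ℝ) : Set ℂ :=
  {r | 0 < r.re ∧ (∀ i, r ≠ α i) ∧ lundberg lam mud t A α β r = 0}

/-- `∑ i, A i * (lam / β i - mud / α i)`. -/
def drift {n : ℕ} (lam mud : ℝ) (A α β : Fin n → ℝ) : ℝ :=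
  ∑ i, A i * (lam / β i - mud / α i)

/-- The constants `B_j = 1 / α_j ^ 2 - (t / α_j) * ∑ i, A i * (lam / β i - mud / α i)`. -/
def coeffB {n : ℕ} (lam mud t : ℝ) (A α β : Fin n → ℝ) (j : Fin n) : ℝ :=
  1 / α j ^ 2 - t / α j * drift lam mud A α β

/-- The constants `C_k`, given the list `r` of roots. -/
def coeffC {n : ℕ} (lam mud t : ℝ) (A α β : Fin n → ℝ) (r : Fin n → ℂ) (k : Fin n) : ℂ :=
  (∑ j, (coeffB lam mud t A α β j : ℂ) * (∏ h, ((α j : ℂ) - r h)) *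
      ∏ i ∈ Finset.univ.erase j, (r k - α i) / ((α j : ℂ) - α i)) /
    ∏ h ∈ Finset.univ.erase k, (r k - r h)

end MiningPool

end

/-! Counting the roots. Put c = λ + μ_d + 1/t. Over the common denominator q = ∏ (r + β_i) ∏ (r -
α_i), the Lundberg function is -c p/q with p of degree 2n. On the imaginary axis the two sums in the
Lundberg equation are characteristic functions, of modulus at most 1, so |1 - p/q| ≤ (λ + μ_d)/c <
1. Hence p/q stays in the right half-plane along the axis, and it tends to 1 at both ends, so its
argument has no net variation. The variation of the argument of a polynomial along the axis records
the number of its zeros on the right minus the number on the left (`exists_log_prod`). This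
difference is therefore the same for p and q (`halfPlaneBalance_roots_eq`); for q it is 0, so p has
n zeros on each side. No residue vanishes, so none of these zeros is a pole.

The expectation. Let L = `stepOp` be the jump part of the generator, killed below 0. Splitting by
the number m of jumps, one shows E[f(R_s); no ruin, m jumps by time s] = e^{-(λ+μ_d)s} s^m/m! · (L^m
f)(u) (`IsPoolModel.expSurvival_eq`). The proof compares times s < s': up to an event of probability
O((s' - s)^2) there is at most one jump, and after multiplication by e^{(λ+μ_d)s} the left side
becomes a primitive of the same expression for m - 1 and L f. Integrating over the exponential
horizon gives (1/t) c^{-(m+1)} (L^m f)(u) for f = id.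

Verification. If V has linear growth and c V = x/t + L V on [0,∞), applying L^m and telescoping
shows that the sum of the terms with m < k is V(u) - (L^k V)(u)/c^k. The remainder tends to 0,
because in a weighted sup norm with weight x + a₀ the operator L has norm at most λ + μ_d + δ with δ
< 1/t. So V(u) is the expectation (`IsPoolModel.Vhat_eq`); the same estimate applied to |x| gives
integrability.

The candidate. The claimed formula solves c V = x/t + L V (`explicitValue_step`): the Lundberg
equation matches the terms e^{-r_k u}, the drift matches the constants, and the terms e^{-α_i u}
caused by killing at 0 cancel because the C_k solve the Cauchy system ∑ C_k/(α_j - r_k) = B_j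
(`sum_coeffC_div`). -/

namespace MiningPool

/-! ### Counting zeros in a half-plane by the variation of the argument. -/

section ArgumentCount

open Complex

/-- The number of elements of `S` in the open right half-plane minus the number of the others. -/
noncomputable def halfPlaneBalance (S : Multiset ℂ) : ℝ :=
  (S.map fun z => if 0 < z.re then (1 : ℝ) else -1).sum

/-- The argument is unchanged under division by y > 0, and w/y + i tends to i, where the argument is
continuous. -/
lemma tendsto_arg_add_mul_I_atTop (w : ℂ) :
    Tendsto (fun y : ℝ => arg (w + y * I)) atTop (𝓝 (Real.pi / 2)) := by
  have h1 : Tendsto (fun y : ℝ => ((y⁻¹ : ℝ) : ℂ) * w + I) atTop (𝓝 I) := by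
    have : Tendsto (fun y : ℝ => ((y⁻¹ : ℝ) : ℂ)) atTop (𝓝 ((0 : ℝ) : ℂ)) :=
      (continuous_ofReal.tendsto 0).comp tendsto_inv_atTop_zero
    simpa using (this.mul_const w).add_const I
  have h2 : ContinuousAt arg I := continuousAt_arg (by simp [slitPlane])
  have h3 := h2.tendsto.comp h1
  rw [arg_I] at h3
  refine h3.congr' ?_
  filter_upwards [eventually_gt_atTop 0] with y hy
  have : (y : ℂ) ≠ 0 := by exact_mod_cast hy.ne'
  rw [Function.comp, ← arg_real_mul _ hy]
  congr 1
  push_cast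
  field_simp

lemma tendsto_arg_sub_mul_I_atTop (w : ℂ) :
    Tendsto (fun y : ℝ => arg (w - y * I)) atTop (𝓝 (-(Real.pi / 2))) := by
  have h1 : Tendsto (fun y : ℝ => ((y⁻¹ : ℝ) : ℂ) * w - I) atTop (𝓝 (-I)) := by
    have : Tendsto (fun y : ℝ => ((y⁻¹ : ℝ) : ℂ)) atTop (𝓝 ((0 : ℝ) : ℂ)) :=
      (continuous_ofReal.tendsto 0).comp tendsto_inv_atTop_zero
    simpa using (this.mul_const w).sub_const I
  have h2 : ContinuousAt arg (-I) := continuousAt_arg (by simp [slitPlane])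
  have h3 := h2.tendsto.comp h1
  rw [arg_neg_I] at h3
  refine h3.congr' ?_
  filter_upwards [eventually_gt_atTop 0] with y hy
  have : (y : ℂ) ≠ 0 := by exact_mod_cast hy.ne'
  rw [Function.comp, ← arg_real_mul _ hy]
  congr 1
  push_cast
  field_simp

lemma tendsto_arg_add_mul_I_atBot (w : ℂ) :
    Tendsto (fun y : ℝ => arg (w + y * I)) atBot (𝓝 (-(Real.pi / 2))) := by
  have := (tendsto_arg_sub_mul_I_atTop w).comp tendsto_neg_atBot_atTop
  refine this.congr fun y => ?_
  simp

lemma tendsto_arg_sub_mul_I_atBot (w : ℂ) :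
    Tendsto (fun y : ℝ => arg (w - y * I)) atBot (𝓝 (Real.pi / 2)) := by
  have := (tendsto_arg_add_mul_I_atTop w).comp tendsto_neg_atBot_atTop
  refine this.congr fun y => ?_
  simp [sub_eq_add_neg]

/-- A differentiable logarithm, up to a constant factor, of `∏ (i y - z)` along the imaginary axis,
with the limits of its imaginary part at both ends. -/
lemma exists_log_prod (S : Multiset ℂ) (hS : ∀ z ∈ S, z.re ≠ 0) :
    ∃ F : ℝ → ℂ, Differentiable ℝ F ∧
      (∃ c : ℂ, c ≠ 0 ∧ ∀ y, exp (F y) = c * (S.map fun z => (y * I - z)).prod) ∧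
      Tendsto (fun y => (F y).im) atTop (𝓝 (-halfPlaneBalance S * (Real.pi / 2))) ∧
      Tendsto (fun y => (F y).im) atBot (𝓝 (halfPlaneBalance S * (Real.pi / 2))) := by
  induction S using Multiset.induction_on with
  | empty =>
    refine ⟨fun _ => 0, by fun_prop, ⟨1, by simp, by simp⟩, ?_, ?_⟩ <;>
      simp [halfPlaneBalance]
  | cons z S ih =>
    obtain ⟨F, hF, ⟨c, hc, hexp⟩, htop, hbot⟩ := ih fun w hw => hS w (by simp [hw])
    have hz := hS z (by simp)
    have hd : Differentiable ℝ fun y : ℝ => (y : ℂ) * I :=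
      ofRealCLM.differentiable.mul_const I
    by_cases hpos : 0 < z.re
    -- The factor iy - z is replaced by its negative, which lies in the right half-plane for all y,
    -- so the principal logarithm is smooth along the whole axis. The sign goes into the constant c.
    · have hsl : ∀ y : ℝ, z - y * I ∈ slitPlane := fun y => by simp [slitPlane, hpos]
      refine ⟨fun y => F y + log (z - y * I), ?_, ⟨-c, by simpa, ?_⟩, ?_, ?_⟩
      · intro y
        exact (hF y).add (((hd y).const_sub z).hasDerivAt.clog_real (hsl y)).differentiableAt
      · intro y
        rw [Complex.exp_add, hexp, exp_log (slitPlane_ne_zero (hsl y))]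
        simp only [Multiset.map_cons, Multiset.prod_cons]
        ring
      · have := htop.add (tendsto_arg_sub_mul_I_atTop z)
        simp only [add_im, log_im]
        convert this using 2
        simp [halfPlaneBalance, hpos]
        ring
      · have := hbot.add (tendsto_arg_sub_mul_I_atBot z)
        simp only [add_im, log_im]
        convert this using 2
        simp [halfPlaneBalance, hpos]
        ring
    · have hneg : z.re < 0 := lt_of_le_of_ne (not_lt.mp hpos) hz
      -- For z on the left the factor iy - z itself stays in the right half-plane, and its argument
      -- turns the other way.
      have hsl : ∀ y : ℝ, -z + y * I ∈ slitPlane := fun y => by simp [slitPlane, hneg]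
      refine ⟨fun y => F y + log (-z + y * I), ?_, ⟨c, hc, ?_⟩, ?_, ?_⟩
      · intro y
        exact (hF y).add (((hd y).const_add (-z)).hasDerivAt.clog_real (hsl y)).differentiableAt
      · intro y
        rw [Complex.exp_add, hexp, exp_log (slitPlane_ne_zero (hsl y))]
        simp only [Multiset.map_cons, Multiset.prod_cons]
        ring
      · have := htop.add (tendsto_arg_add_mul_I_atTop (-z))
        simp only [add_im, log_im]
        convert this using 2
        simp [halfPlaneBalance, hpos]
        ring
      · have := hbot.add (tendsto_arg_add_mul_I_atBot (-z))
        simp only [add_im, log_im]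
        convert this using 2
        simp [halfPlaneBalance, hpos]
        ring

lemma eval_eq_leadingCoeff_mul_prod (p : Polynomial ℂ) (x : ℂ) :
    p.eval x = p.leadingCoeff * (p.roots.map fun z => x - z).prod := by
  have := IsAlgClosed.splits p
  conv_lhs => rw [this.eq_prod_roots]
  simp [Polynomial.eval_multiset_prod, Multiset.map_map]

/-- If `p / q` stays in the right half-plane along the imaginary axis and tends to `1` at both ends,
then `p` and `q` have the same balance of zeros between the two half-planes. -/
theorem halfPlaneBalance_roots_eq (p q : Polynomial ℂ)
    (hre : ∀ y : ℝ, 0 < (p.eval (y * I) / q.eval (y * I)).re)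
    (htop : Tendsto (fun y : ℝ => p.eval (y * I) / q.eval (y * I)) atTop (𝓝 1))
    (hbot : Tendsto (fun y : ℝ => p.eval (y * I) / q.eval (y * I)) atBot (𝓝 1)) :
    halfPlaneBalance p.roots = halfPlaneBalance q.roots := by
  have hp : ∀ y : ℝ, p.eval (y * I) ≠ 0 := fun y h => by simpa [h] using hre y
  have hq : ∀ y : ℝ, q.eval (y * I) ≠ 0 := fun y h => by simpa [h] using hre y
  have key : ∀ f : Polynomial ℂ, (∀ y : ℝ, f.eval (y * I) ≠ 0) → ∀ z ∈ f.roots, z.re ≠ 0 := by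
    intro f hf z hz hzre
    refine hf z.im ?_
    have : (z.im : ℂ) * I = z := by
      apply Complex.ext <;> simp [hzre]
    rw [this]
    exact (Polynomial.mem_roots'.mp hz).2
  obtain ⟨F, hF, ⟨a, ha, hFe⟩, hFt, hFb⟩ := exists_log_prod p.roots (key p hp)
  obtain ⟨G, hG, ⟨b, hb, hGe⟩, hGt, hGb⟩ := exists_log_prod q.roots (key q hq)
  set h : ℝ → ℂ := fun y => p.eval (y * I) / q.eval (y * I) with hh
  have hsl : ∀ y, h y ∈ slitPlane := fun y => Or.inl (hre y)
  have hd : Differentiable ℝ fun y : ℝ => (y : ℂ) * I :=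
    ofRealCLM.differentiable.mul_const I
  have hpoly : ∀ f : Polynomial ℂ, Differentiable ℝ fun y : ℝ => f.eval (y * I) := fun f y =>
    (f.differentiable.restrictScalars ℝ).differentiableAt.comp y (hd y)
  have hhd : Differentiable ℝ h := fun y => (hpoly p y).div (hpoly q y) (hq y)
  -- Both F - G and log (p/q) are logarithms of p/q up to a constant factor, so exp K is constant; K
  -- is differentiable, hence constant, and its imaginary part has equal limits at both ends.
  set K : ℝ → ℂ := fun y => F y - G y - log (h y) with hK
  have hKd : Differentiable ℝ K := fun y =>
    ((hF y).sub (hG y)).sub ((hhd y).hasDerivAt.clog_real (hsl y)).differentiableAt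
  have hp0 : p.leadingCoeff ≠ 0 := fun h0 => hp 0 (by
    rw [Polynomial.leadingCoeff_eq_zero.mp h0]; simp)
  have hq0 : q.leadingCoeff ≠ 0 := fun h0 => hq 0 (by
    rw [Polynomial.leadingCoeff_eq_zero.mp h0]; simp)
  have hKe : ∀ y, exp (K y) = a * q.leadingCoeff / (b * p.leadingCoeff) := by
    intro y
    have e1 := eval_eq_leadingCoeff_mul_prod p (y * I)
    have e2 := eval_eq_leadingCoeff_mul_prod q (y * I)
    have n1 := hp y
    have n2 := hq y
    rw [e1] at n1
    rw [e2] at n2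
    have n3 := right_ne_zero_of_mul n1
    have n4 := right_ne_zero_of_mul n2
    simp only [hK]
    rw [Complex.exp_sub, Complex.exp_sub, hFe, hGe, exp_log (slitPlane_ne_zero (hsl y))]
    simp only [hh, e1, e2]
    field_simp
  have hKder : ∀ y, deriv K y = 0 := by
    intro y
    have h1 := (hKd y).hasDerivAt.cexp
    have h2 : (fun y => exp (K y)) = fun _ => a * q.leadingCoeff / (b * p.leadingCoeff) :=
      funext hKe
    rw [h2] at h1
    have := h1.unique (hasDerivAt_const y _)
    exact (mul_eq_zero.mp this).resolve_left (exp_ne_zero _)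
  have hKc : ∀ y, K y = K 0 := fun y => is_const_of_deriv_eq_zero hKd hKder y 0
  have harg : ∀ l : Filter ℝ, Tendsto h l (𝓝 1) → Tendsto (fun y => (log (h y)).im) l (𝓝 0) := by
    intro l hl
    have := (continuousAt_arg (x := 1) (by simp)).tendsto.comp hl
    simpa [Function.comp_def, log_im] using this
  have t1 := (hFt.sub hGt).sub (harg _ htop)
  have t2 := (hFb.sub hGb).sub (harg _ hbot)
  have hc : (fun y => (F y).im - (G y).im - (log (h y)).im) = fun _ => (K 0).im := by
    funext y
    rw [← hKc y]
    simp [hK]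
  rw [hc] at t1 t2
  have u1 := tendsto_nhds_unique t1 tendsto_const_nhds
  have u2 := tendsto_nhds_unique t2 tendsto_const_nhds
  -- The limits of Im K at the two ends are ∓π/2 times the difference of the balances, and both
  -- equal Im K(0).
  have : (halfPlaneBalance p.roots - halfPlaneBalance q.roots) * Real.pi = 0 := by linarith
  have := (mul_eq_zero.mp this).resolve_right Real.pi_ne_zero
  linarith

lemma halfPlaneBalance_eq (S : Multiset ℂ) :
    halfPlaneBalance S = 2 * (S.countP fun z => 0 < z.re) - S.card := by
  induction S using Multiset.induction_on with
  | empty => simp [halfPlaneBalance]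
  | cons z S ih =>
    have : halfPlaneBalance (z ::ₘ S) = (if 0 < z.re then (1 : ℝ) else -1) + halfPlaneBalance S := by
      simp [halfPlaneBalance]
    rw [this, ih, Multiset.countP_cons]
    split_ifs <;> push_cast [Multiset.card_cons] <;> ring

lemma analyticOrderNatAt_eval (p : Polynomial ℂ) (hp : p ≠ 0) (z : ℂ) :
    analyticOrderNatAt (fun x => p.eval x) z = p.rootMultiplicity z := by
  obtain ⟨q, hq, hdvd⟩ := Polynomial.exists_eq_pow_rootMultiplicity_mul_and_not_dvd p hp z
  have hqz : q.eval z ≠ 0 := fun h => hdvd (Polynomial.dvd_iff_isRoot.mpr h)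
  have han : AnalyticAt ℂ (fun x => p.eval x) z := by
    simpa using (p.differentiable.analyticAt z)
  have : analyticOrderAt (fun x => p.eval x) z = (p.rootMultiplicity z : ℕ) := by
    rw [han.analyticOrderAt_eq_natCast]
    refine ⟨fun x => q.eval x, q.differentiable.analyticAt z, hqz, ?_⟩
    refine Eventually.of_forall fun x => ?_
    conv_lhs => rw [hq]
    simp
  simp [analyticOrderNatAt, this]

end ArgumentCount

/-! ### Integrals against combinations of exponentials. -/

section CombExp

variable {n : ℕ} {A α : Fin n → ℝ}

/-- The density with rates α_i/a is f(w/a)/a, so nonnegativity is inherited from the density with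
rates α_i. -/
lemma IsCombExp.scale {a : ℝ} (h : IsCombExp A α) (ha : 0 < a) {β : Fin n → ℝ}
    (hβ : ∀ i, β i = α i / a) : IsCombExp A β where
  rate_pos i := by rw [hβ]; exact div_pos (h.rate_pos i) ha
  rate_strictMono i j hij := by
    rw [hβ, hβ]; exact div_lt_div_of_pos_right (h.rate_strictMono hij) ha
  weight_ne_zero := h.weight_ne_zero
  weight_sum := h.weight_sum
  density_nonneg w := by
    by_cases hw : 0 < w
    · have h1 := h.density_nonneg (w / a)
      have hwa : w / a ∈ Set.Ioi (0 : ℝ) := div_pos hw ha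
      rw [combExpDensity, Set.indicator_of_mem hwa] at h1
      rw [combExpDensity, Set.indicator_of_mem (show w ∈ Set.Ioi (0 : ℝ) from hw)]
      have : ∑ i, A i * β i * Real.exp (-β i * w)
          = (∑ i, A i * α i * Real.exp (-α i * (w / a))) / a := by
        rw [Finset.sum_div]
        refine Finset.sum_congr rfl fun i _ => ?_
        rw [hβ, show -(α i / a) * w = -α i * (w / a) by ring]
        ring
      rw [this]
      exact div_nonneg h1 ha.le
    · rw [combExpDensity, Set.indicator_of_notMem (by simpa using hw)]

lemma measurable_combExpDensity : Measurable (combExpDensity A α) :=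
  Measurable.indicator (by fun_prop) measurableSet_Ioi

lemma density_smul_eq {E : Type*} [AddCommGroup E] [Module ℝ E]
    (f : ℝ → E) (w : ℝ) :
    combExpDensity A α w • f w =
      (Set.Ioi 0).indicator
        (fun w => ∑ i, (A i * α i) • (Real.exp (-α i * w) • f w)) w := by
  by_cases hw : w ∈ Set.Ioi (0 : ℝ)
  · simp only [combExpDensity, Set.indicator_of_mem hw, Finset.sum_smul, smul_smul]
  · simp only [combExpDensity, Set.indicator_of_notMem hw, zero_smul]

/-- Some weights may be negative, so the law is not a mixture of exponential laws; but the density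
is a linear combination of exponentials, and integrability may be checked term by term. -/
lemma IsCombExp.integrable (h : IsCombExp A α) {f : ℝ → ℂ}
    (hf : ∀ i, IntegrableOn (fun w => Real.exp (-α i * w) • f w) (Set.Ioi 0)) :
    Integrable f (combExpMeasure A α) := by
  rw [combExpMeasure, integrable_withDensity_iff_integrable_smul'
    measurable_combExpDensity.ennreal_ofReal (by simp)]
  simp only [ENNReal.toReal_ofReal (h.density_nonneg _)]
  simp only [density_smul_eq]
  rw [integrable_indicator_iff measurableSet_Ioi]
  exact integrable_finsetSum _ fun i _ => (hf i).smul (A i * α i)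

lemma IsCombExp.integral_eq (h : IsCombExp A α) {f : ℝ → ℂ}
    (hf : ∀ i, IntegrableOn (fun w => Real.exp (-α i * w) • f w) (Set.Ioi 0)) :
    ∫ w, f w ∂(combExpMeasure A α) =
      ∑ i, (A i : ℂ) * α i * ∫ w in Set.Ioi 0, Real.exp (-α i * w) • f w := by
  rw [combExpMeasure, integral_withDensity_eq_integral_toReal_smul
    measurable_combExpDensity.ennreal_ofReal (by simp)]
  simp only [ENNReal.toReal_ofReal (h.density_nonneg _)]
  simp only [density_smul_eq]
  rw [integral_indicator measurableSet_Ioi,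
    integral_finsetSum _ (f := fun i w => (A i * α i) • (Real.exp (-α i * w) • f w))
      fun i _ => (hf i).smul (A i * α i)]
  refine Finset.sum_congr rfl fun i _ => ?_
  rw [integral_smul, Complex.real_smul]
  push_cast
  ring

lemma exp_smul_exp (a w : ℝ) (z : ℂ) :
    Real.exp (-a * w) • Complex.exp (-z * w) = Complex.exp (-(a + z) * w) := by
  rw [Complex.real_smul, Complex.ofReal_exp, ← Complex.exp_add]
  push_cast
  ring_nf

lemma integrableOn_exp_smul_exp {a : ℝ} {z : ℂ} (hz : 0 < a + z.re) :
    IntegrableOn (fun w : ℝ => Real.exp (-a * w) • Complex.exp (-z * w)) (Set.Ioi 0) := by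
  simp only [exp_smul_exp]
  exact integrableOn_exp_mul_complex_Ioi (by simp; linarith) 0

lemma integral_exp_smul_exp {a : ℝ} {z : ℂ} (hz : 0 < a + z.re) :
    ∫ w : ℝ in Set.Ioi 0, Real.exp (-a * w) • Complex.exp (-z * w) = 1 / (a + z) := by
  simp only [exp_smul_exp]
  rw [integral_exp_mul_complex_Ioi (by simp; linarith) 0]
  have : (a : ℂ) + z ≠ 0 := fun h => by
    have := congrArg Complex.re h
    simp at this
    linarith
  rw [Complex.ofReal_zero, mul_zero, Complex.exp_zero, neg_div_neg_eq]

lemma IsCombExp.integrable_exp (h : IsCombExp A α) {z : ℂ} (hz : 0 ≤ z.re) :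
    Integrable (fun w : ℝ => Complex.exp (-z * w)) (combExpMeasure A α) :=
  h.integrable fun i => integrableOn_exp_smul_exp (by linarith [h.rate_pos i])

/-- The Laplace transform of a combination of exponentials. -/
lemma IsCombExp.integral_exp (h : IsCombExp A α) {z : ℂ} (hz : 0 ≤ z.re) :
    ∫ w : ℝ, Complex.exp (-z * w) ∂(combExpMeasure A α) =
      ∑ i, (A i : ℂ) * (α i / (α i + z)) := by
  rw [h.integral_eq fun i => integrableOn_exp_smul_exp (by linarith [h.rate_pos i])]
  refine Finset.sum_congr rfl fun i _ => ?_
  rw [integral_exp_smul_exp (by linarith [h.rate_pos i])]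
  ring

lemma integral_mul_exp_Ioi {a : ℝ} (ha : 0 < a) :
    ∫ w in Set.Ioi (0 : ℝ), Real.exp (-a * w) * w = 1 / a ^ 2 := by
  have := Real.integral_rpow_mul_exp_neg_mul_Ioi (a := 2) (r := a) (by norm_num) ha
  have h2 : Real.Gamma 2 = 1 := by simp
  rw [h2, mul_one, Real.rpow_two] at this
  rw [div_pow, one_pow] at this
  rw [← this]
  refine setIntegral_congr_fun measurableSet_Ioi fun w _ => ?_
  norm_num
  ring

lemma integrableOn_mul_exp_Ioi {a : ℝ} (ha : 0 < a) :
    IntegrableOn (fun w : ℝ => Real.exp (-a * w) * w) (Set.Ioi 0) := by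
  -- A non-integrable function has Bochner integral 0 by convention, whereas the value computed
  -- above is positive.
  by_contra h
  have := integral_mul_exp_Ioi ha
  rw [integral_undef h] at this
  have : 0 < 1 / a ^ 2 := by positivity
  linarith

lemma IsCombExp.integrableOn_exp_smul_id (h : IsCombExp A α) (i : Fin n) :
    IntegrableOn (fun w : ℝ => Real.exp (-α i * w) • (w : ℂ)) (Set.Ioi 0) := by
  have := (integrableOn_mul_exp_Ioi (h.rate_pos i)).ofReal (𝕜 := ℂ)
  simpa [IntegrableOn] using this

lemma IsCombExp.integrable_id (h : IsCombExp A α) :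
    Integrable (fun w : ℝ => (w : ℂ)) (combExpMeasure A α) :=
  h.integrable h.integrableOn_exp_smul_id

lemma IsCombExp.integral_id (h : IsCombExp A α) :
    ∫ w : ℝ, (w : ℂ) ∂(combExpMeasure A α) = ∑ i, (A i : ℂ) / α i := by
  rw [h.integral_eq h.integrableOn_exp_smul_id]
  refine Finset.sum_congr rfl fun i _ => ?_
  have h1 : ∫ w in Set.Ioi (0 : ℝ), Real.exp (-α i * w) • (w : ℂ)
      = ((∫ w in Set.Ioi (0 : ℝ), Real.exp (-α i * w) * w : ℝ) : ℂ) := by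
    rw [← integral_complex_ofReal]
    simp
  have h0 : (α i : ℂ) ≠ 0 := by exact_mod_cast (h.rate_pos i).ne'
  rw [h1, integral_mul_exp_Ioi (h.rate_pos i)]
  push_cast
  field_simp

lemma IsCombExp.weight_sum_complex (h : IsCombExp A α) : ∑ i, (A i : ℂ) = 1 := by
  exact_mod_cast h.weight_sum

/-- The total mass is the Laplace transform at 0, that is, the sum of the weights. -/
lemma IsCombExp.isProbabilityMeasure (h : IsCombExp A α) :
    IsProbabilityMeasure (combExpMeasure A α) := by
  have h1 : Integrable (fun w : ℝ => (1 : ℂ)) (combExpMeasure A α) := by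
    simpa using h.integrable_exp (z := 0) le_rfl
  have hfin : IsFiniteMeasure (combExpMeasure A α) := by
    rwa [integrable_const_iff_isFiniteMeasure one_ne_zero] at h1
  have h2 : ∫ w : ℝ, (1 : ℂ) ∂(combExpMeasure A α) = 1 := by
    have h3 := h.integral_exp (z := 0) le_rfl
    simp only [neg_zero, zero_mul, Complex.exp_zero] at h3
    rw [h3, ← h.weight_sum_complex]
    refine Finset.sum_congr rfl fun i _ => ?_
    have h0 : (α i : ℂ) ≠ 0 := by exact_mod_cast (h.rate_pos i).ne'
    rw [add_zero, div_self h0, mul_one]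
  rw [integral_const, Complex.real_smul, mul_one] at h2
  have h4 : (combExpMeasure A α).real Set.univ = 1 := by exact_mod_cast h2
  exact ⟨by rwa [measureReal_def, ENNReal.toReal_eq_one_iff] at h4⟩

lemma combExpMeasure_ae_pos : ∀ᵐ w ∂(combExpMeasure A α), 0 < w := by
  rw [combExpMeasure, ae_withDensity_iff measurable_combExpDensity.ennreal_ofReal]
  refine Eventually.of_forall fun w hw => ?_
  by_contra h
  exact hw (by simp [combExpDensity, h])

/-- The characteristic function of a probability law is bounded by `1`. -/
lemma IsCombExp.norm_laplace_le_one (h : IsCombExp A α) {z : ℂ} (hz : 0 ≤ z.re) :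
    ‖∑ i, (A i : ℂ) * (α i / (α i + z))‖ ≤ 1 := by
  have := h.isProbabilityMeasure
  rw [← h.integral_exp hz]
  refine (norm_integral_le_of_norm_le_const (C := 1) ?_).trans (by simp)
  filter_upwards [combExpMeasure_ae_pos] with w hw
  rw [Complex.norm_exp, Real.exp_le_one_iff]
  simp
  positivity

/-- Killing below 0 cuts the integral at w = u; on the compact interval that remains continuity
suffices for integrability, with no growth condition on f. -/
lemma IsCombExp.integral_indicator_Ici_sub (h : IsCombExp A α) (f : ℝ → ℂ) (hf : Continuous f)
    (u : ℝ) :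
    Integrable (fun w => (Set.Ici 0).indicator f (u - w)) (combExpMeasure A α) ∧
    (0 ≤ u → ∫ w, (Set.Ici 0).indicator f (u - w) ∂(combExpMeasure A α) =
      ∑ i, (A i : ℂ) * α i * ∫ w in (0 : ℝ)..u, Real.exp (-α i * w) • f (u - w)) := by
  have hind : (fun w => (Set.Ici 0).indicator f (u - w)) =
      (Set.Iic u).indicator fun w => f (u - w) := by
    funext w
    by_cases hw : w ≤ u
    · rw [Set.indicator_of_mem (by simpa using hw), Set.indicator_of_mem (by simpa using hw)]
    · rw [Set.indicator_of_notMem (by simpa using hw), Set.indicator_of_notMem (by simpa using hw)]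
  have hsm : ∀ i, (fun w => Real.exp (-α i * w) • (Set.Iic u).indicator (fun w => f (u - w)) w) =
      (Set.Iic u).indicator fun w => Real.exp (-α i * w) • f (u - w) := by
    intro i
    funext w
    by_cases hw : w ∈ Set.Iic u
    · simp only [Set.indicator_of_mem hw]
    · simp only [Set.indicator_of_notMem hw, smul_zero]
  have hint : ∀ i, IntegrableOn
      (fun w => Real.exp (-α i * w) • (Set.Iic u).indicator (fun w => f (u - w)) w)
      (Set.Ioi 0) := by
    intro i
    rw [hsm, IntegrableOn, integrable_indicator_iff measurableSet_Iic, IntegrableOn,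
      Measure.restrict_restrict measurableSet_Iic, Set.Iic_inter_Ioi, ← IntegrableOn]
    refine (Continuous.integrableOn_Icc (a := 0) (b := u) ?_).mono_set Set.Ioc_subset_Icc_self
    fun_prop
  rw [hind]
  refine ⟨h.integrable hint, fun hu => ?_⟩
  rw [h.integral_eq hint]
  refine Finset.sum_congr rfl fun i _ => ?_
  rw [hsm, integral_indicator measurableSet_Iic, Measure.restrict_restrict measurableSet_Iic,
    Set.Iic_inter_Ioi, intervalIntegral.integral_of_le hu]

lemma intervalIntegral_exp_smul_exp {a u : ℝ} {r : ℂ} (har : r ≠ a) :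
    ∫ w in (0 : ℝ)..u, Real.exp (-a * w) • Complex.exp (-r * ((u - w : ℝ) : ℂ)) =
      (Complex.exp (-r * u) - Complex.exp (-a * u)) / (a - r) := by
  have h0 : r - a ≠ 0 := sub_ne_zero.mpr har
  have h1 : (a : ℂ) - r ≠ 0 := sub_ne_zero.mpr har.symm
  have : ∀ w : ℝ, Real.exp (-a * w) • Complex.exp (-r * ((u - w : ℝ) : ℂ)) =
      Complex.exp (-r * u) * Complex.exp ((r - a) * w) := by
    intro w
    rw [Complex.real_smul, Complex.ofReal_exp, ← Complex.exp_add, ← Complex.exp_add]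
    push_cast
    ring_nf
  simp only [this]
  rw [intervalIntegral.integral_const_mul, integral_exp_mul_complex h0, mul_div_assoc',
    mul_sub, ← Complex.exp_add, Complex.ofReal_zero, mul_zero, Complex.exp_zero, mul_one,
    div_eq_div_iff h0 h1]
  ring_nf

lemma intervalIntegral_exp_smul_id {a u : ℝ} (ha : a ≠ 0) :
    ∫ w in (0 : ℝ)..u, Real.exp (-a * w) • ((u - w : ℝ) : ℂ) =
      u / a - (1 - Complex.exp (-a * u)) / a ^ 2 := by
  have ha' : (a : ℂ) ≠ 0 := by exact_mod_cast ha
  have hd : ∀ w ∈ Set.uIcc 0 u, HasDerivAt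
      (fun w : ℝ => -(u - w) * Real.exp (-a * w) / a + Real.exp (-a * w) / a ^ 2)
      (Real.exp (-a * w) * (u - w)) w := by
    intro w _
    have he : HasDerivAt (fun w : ℝ => Real.exp (-a * w)) (Real.exp (-a * w) * (-a)) w := by
      simpa using ((hasDerivAt_id w).const_mul (-a)).exp
    have hl : HasDerivAt (fun w : ℝ => -(u - w)) 1 w := by
      have := ((hasDerivAt_id w).const_sub u).neg
      rwa [neg_neg] at this
    convert! ((hl.mul he).div_const a).add (he.div_const (a ^ 2)) using 1
    field_simp
    ring
  have h1 := intervalIntegral.integral_eq_sub_of_hasDerivAt hd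
    (Continuous.intervalIntegrable (by fun_prop) _ _)
  have h2 : ∫ w in (0 : ℝ)..u, Real.exp (-a * w) • ((u - w : ℝ) : ℂ) =
      ((∫ w in (0 : ℝ)..u, Real.exp (-a * w) * (u - w) : ℝ) : ℂ) := by
    rw [← intervalIntegral.integral_ofReal]
    simp
  rw [h2, h1]
  push_cast
  rw [show -(a : ℂ) * 0 = 0 by ring, Complex.exp_zero]
  field_simp
  ring

lemma intervalIntegral_exp_smul_one {a u : ℝ} (ha : a ≠ 0) :
    ∫ w in (0 : ℝ)..u, Real.exp (-a * w) • (1 : ℂ) = (1 - Complex.exp (-a * u)) / a := by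
  have h := intervalIntegral_exp_smul_exp (a := a) (u := u) (r := 0)
    (by exact_mod_cast ha.symm)
  simpa using h

end CombExp

/-! ### The numerator of a partial fraction. -/

section Roots

open Polynomial in
/-- The numerator of `1 - c⁻¹ * ∑ w i / (x - v i)` over the common denominator `∏ (x - v i)`. -/
noncomputable def partialFractionNumerator {ι : Type*} [Fintype ι] [DecidableEq ι]
    (w v : ι → ℂ) (c : ℂ) : ℂ[X] :=
  Lagrange.nodal Finset.univ v -
    ∑ i, C (w i / c) * Lagrange.nodal (Finset.univ.erase i) v

variable {ι : Type*} [Fintype ι] [DecidableEq ι] {w v : ι → ℂ} {c : ℂ}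

lemma eval_partialFractionNumerator {x : ℂ} (hx : ∀ i, x ≠ v i) :
    (partialFractionNumerator w v c).eval x =
      (1 - c⁻¹ * ∑ i, w i / (x - v i)) * (Lagrange.nodal Finset.univ v).eval x := by
  rw [partialFractionNumerator, Polynomial.eval_sub, Polynomial.eval_finsetSum, sub_mul, one_mul,
    Finset.mul_sum, Finset.sum_mul]
  congr 1
  refine Finset.sum_congr rfl fun i _ => ?_
  rw [Lagrange.nodal_eq_mul_nodal_erase (Finset.mem_univ i)]
  have := sub_ne_zero.mpr (hx i)
  simp
  field_simp

/-- At a node every product containing that node vanishes, and only the summand carrying its own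
residue is left. So a pole with nonzero residue is never a zero of the numerator. -/
lemma eval_partialFractionNumerator_node (hv : Function.Injective v) (i : ι) (hw : w i ≠ 0)
    (hc : c ≠ 0) : (partialFractionNumerator w v c).eval (v i) ≠ 0 := by
  rw [partialFractionNumerator, Polynomial.eval_sub, Polynomial.eval_finsetSum,
    Lagrange.eval_nodal_at_node (Finset.mem_univ i), Finset.sum_eq_single i]
  · rw [Polynomial.eval_mul, Polynomial.eval_C, Lagrange.eval_nodal, zero_sub, neg_ne_zero]
    refine mul_ne_zero (div_ne_zero hw hc) (Finset.prod_ne_zero_iff.mpr fun j hj => ?_)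
    exact sub_ne_zero.mpr fun h => (Finset.ne_of_mem_erase hj) (hv h).symm
  · intro j _ hj
    rw [Polynomial.eval_mul, Lagrange.eval_nodal_at_node (by simp [hj.symm]), mul_zero]
  · simp

/-- The subtracted products each lack one factor, so they cannot affect the leading term. -/
lemma natDegree_partialFractionNumerator :
    (partialFractionNumerator w v c).natDegree = Fintype.card ι := by
  rw [partialFractionNumerator, ← Finset.card_univ, ← Lagrange.natDegree_nodal (v := v)]
  refine Polynomial.natDegree_eq_of_degree_eq (Polynomial.degree_sub_eq_left_of_degree_lt ?_)
  rw [Lagrange.degree_nodal]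
  refine (Polynomial.degree_sum_le _ _).trans_lt ?_
  rw [Finset.sup_lt_iff (WithBot.bot_lt_coe _)]
  intro i hi
  refine ((Polynomial.degree_mul_le _ _).trans (add_le_add_left Polynomial.degree_C_le _)).trans_lt ?_
  rw [Lagrange.degree_nodal, zero_add]
  exact_mod_cast Finset.card_erase_lt_of_mem hi

end Roots

/-! ### The number of roots of the Lundberg equation. -/

section LundbergRoots

variable {n : ℕ} {A α β : Fin n → ℝ} {lam mud t : ℝ}

/-- The poles of the Lundberg function. -/
noncomputable def lundbergPole (α β : Fin n → ℝ) : Fin n ⊕ Fin n → ℂ :=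
  Sum.elim (fun i => -(β i : ℂ)) (fun i => (α i : ℂ))

/-- The residues of the Lundberg function at its poles. -/
noncomputable def lundbergResidue (lam mud : ℝ) (A α β : Fin n → ℝ) : Fin n ⊕ Fin n → ℂ :=
  Sum.elim (fun i => (lam * A i * β i : ℂ)) (fun i => -(mud * A i * α i : ℂ))

/-- The numerator of the Lundberg function, up to sign and a constant factor. -/
noncomputable def lundbergNumerator (lam mud t : ℝ) (A α β : Fin n → ℝ) : Polynomial ℂ :=
  partialFractionNumerator (lundbergResidue lam mud A α β) (lundbergPole α β)
    (lam + mud + 1 / t)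

lemma sum_residue_div (r : ℂ) :
    ∑ i, lundbergResidue lam mud A α β i / (r - lundbergPole α β i) =
      lam * ∑ i, (A i : ℂ) * (β i / (β i + r)) + mud * ∑ i, (A i : ℂ) * (α i / (α i - r)) := by
  rw [Fintype.sum_sum_type, Finset.mul_sum, Finset.mul_sum]
  congr 1 <;> refine Finset.sum_congr rfl fun i _ => ?_
  · simp only [lundbergResidue, lundbergPole, Sum.elim_inl]
    rw [sub_neg_eq_add, add_comm r]
    ring
  · simp only [lundbergResidue, lundbergPole, Sum.elim_inr]
    rw [← neg_sub (α i : ℂ) r, neg_div_neg_eq]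
    ring

lemma total_rate_ne_zero (hlam : 0 < lam) (hmud : 0 < mud) (ht : 0 < t) :
    (lam + mud + 1 / t : ℂ) ≠ 0 := by
  have : 0 < lam + mud + 1 / t := by positivity
  exact_mod_cast this.ne'

lemma lundberg_eq (hlam : 0 < lam) (hmud : 0 < mud) (ht : 0 < t) (r : ℂ) :
    lundberg lam mud t A α β r = -(lam + mud + 1 / t : ℂ) * (1 - (lam + mud + 1 / t : ℂ)⁻¹ *
      ∑ i, lundbergResidue lam mud A α β i / (r - lundbergPole α β i)) := by
  have := total_rate_ne_zero hlam hmud ht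
  rw [lundberg, sum_residue_div, neg_mul, mul_sub, mul_inv_cancel_left₀ this, mul_one]
  ring

lemma lundbergPole_injective (hα : IsCombExp A α) (hβ : IsCombExp A β) :
    Function.Injective (lundbergPole α β) := by
  refine Function.Injective.sumElim (fun i j h => ?_) (fun i j h => ?_) fun i j h => ?_
  · exact hβ.rate_strictMono.injective (by exact_mod_cast neg_injective h)
  · exact hα.rate_strictMono.injective (by exact_mod_cast h)
  · have h1 : -β i = α j := by exact_mod_cast h
    linarith [hα.rate_pos j, hβ.rate_pos i]

lemma ne_lundbergPole (hβ : IsCombExp A β) {r : ℂ} (h0 : 0 < r.re) (hr : ∀ i, r ≠ α i) :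
    ∀ i, r ≠ lundbergPole α β i := by
  rintro (i | i)
  · intro h
    rw [h] at h0
    simp [lundbergPole] at h0
    linarith [hβ.rate_pos i]
  · exact hr i

lemma mul_I_ne_lundbergPole (hα : IsCombExp A α) (hβ : IsCombExp A β) (y : ℝ) :
    ∀ i, (y * Complex.I : ℂ) ≠ lundbergPole α β i := by
  rintro (i | i) h
  · have := congrArg Complex.re h
    simp [lundbergPole] at this
    linarith [hβ.rate_pos i]
  · have := congrArg Complex.re h
    simp [lundbergPole] at this
    linarith [hα.rate_pos i]

/-- In the right half-plane the only poles are the α_i, and there the numerator is nonzero because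
A_i ≠ 0; elsewhere the denominator is nonzero and the two equations are equivalent. -/
lemma mem_lundbergRoots_iff (hα : IsCombExp A α) (hβ : IsCombExp A β) (hlam : 0 < lam)
    (hmud : 0 < mud) (ht : 0 < t) (r : ℂ) :
    r ∈ lundbergRoots lam mud t A α β ↔
      0 < r.re ∧ r ∈ (lundbergNumerator lam mud t A α β).roots := by
  have hc := total_rate_ne_zero hlam hmud ht
  have hp0 : lundbergNumerator lam mud t A α β ≠ 0 := by
    intro h
    -- The zero polynomial has `natDegree` 0, so the degree 2n contradicts p = 0 only once n = 0 is
    -- excluded; the weights sum to 1, so n is not 0.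
    have h1 : n ≠ 0 := by
      rintro rfl
      have := hα.weight_sum
      simp at this
    have := natDegree_partialFractionNumerator (w := lundbergResidue lam mud A α β)
      (v := lundbergPole α β) (c := (lam + mud + 1 / t : ℂ))
    rw [lundbergNumerator] at h
    rw [h] at this
    simp at this
    omega
  rw [Polynomial.mem_roots hp0, Polynomial.IsRoot.def, lundbergRoots, Set.mem_ofPred_eq]
  refine and_congr_right fun h0 => ⟨fun ⟨hr, h⟩ => ?_, fun h => ?_⟩
  · rw [lundberg_eq hlam hmud ht] at h
    rw [lundbergNumerator, eval_partialFractionNumerator (ne_lundbergPole hβ h0 hr),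
      (mul_eq_zero.mp h).resolve_left (neg_ne_zero.mpr hc), zero_mul]
  · have hr : ∀ i, r ≠ α i := by
      rintro i rfl
      refine eval_partialFractionNumerator_node (lundbergPole_injective hα hβ) (Sum.inr i) ?_ hc h
      simp only [lundbergResidue, Sum.elim_inr, neg_ne_zero]
      have h1 := hα.weight_ne_zero i
      have h2 := (hα.rate_pos i).ne'
      have h3 := hmud.ne'
      exact_mod_cast mul_ne_zero (mul_ne_zero h3 h1) h2
    refine ⟨hr, ?_⟩
    have hne := ne_lundbergPole hβ h0 hr
    rw [lundbergNumerator, eval_partialFractionNumerator hne] at h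
    rw [lundberg_eq hlam hmud ht, (mul_eq_zero.mp h).resolve_right, mul_zero]
    rw [Lagrange.eval_nodal]
    exact Finset.prod_ne_zero_iff.mpr fun i _ => sub_ne_zero.mpr (hne i)

/-- Near a root the Lundberg function is p times a nonvanishing analytic function, so orders of
vanishing agree. -/
lemma analyticOrderNatAt_lundberg (hβ : IsCombExp A β) (hlam : 0 < lam)
    (hmud : 0 < mud) (ht : 0 < t) (hp0 : lundbergNumerator lam mud t A α β ≠ 0) {r : ℂ}
    (hr : r ∈ lundbergRoots lam mud t A α β) :
    analyticOrderNatAt (lundberg lam mud t A α β) r =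
      (lundbergNumerator lam mud t A α β).rootMultiplicity r := by
  have hc := total_rate_ne_zero hlam hmud ht
  have hne := ne_lundbergPole hβ hr.1 hr.2.1
  rw [← analyticOrderNatAt_eval _ hp0]
  set q := Lagrange.nodal Finset.univ (lundbergPole α β) with hqdef
  have hq : q.eval r ≠ 0 := by
    rw [Lagrange.eval_nodal]
    exact Finset.prod_ne_zero_iff.mpr fun i _ => sub_ne_zero.mpr (hne i)
  have hev : ∀ᶠ x in 𝓝 r, ∀ i, x ≠ lundbergPole α β i :=
    eventually_all.mpr fun i => isOpen_ne.mem_nhds (hne i)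
  have hqa : AnalyticAt ℂ (fun x => q.eval x) r := q.differentiable.analyticAt r
  have hga : AnalyticAt ℂ (fun x => -(lam + mud + 1 / t : ℂ) * (q.eval x)⁻¹) r :=
    analyticAt_const.mul (hqa.inv hq)
  have hg0 : analyticOrderAt (fun x => -(lam + mud + 1 / t : ℂ) * (q.eval x)⁻¹) r = 0 :=
    hga.analyticOrderAt_eq_zero.mpr (mul_ne_zero (neg_ne_zero.mpr hc) (inv_ne_zero hq))
  have heq : lundberg lam mud t A α β =ᶠ[𝓝 r]
      (fun x => -(lam + mud + 1 / t : ℂ) * (q.eval x)⁻¹) *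
        fun x => (lundbergNumerator lam mud t A α β).eval x := by
    filter_upwards [hev] with x hx
    have hqx : q.eval x ≠ 0 := by
      rw [Lagrange.eval_nodal]
      exact Finset.prod_ne_zero_iff.mpr fun i _ => sub_ne_zero.mpr (hx i)
    rw [Pi.mul_apply, lundbergNumerator, eval_partialFractionNumerator hx,
      lundberg_eq hlam hmud ht, ← hqdef]
    field_simp
  rw [analyticOrderNatAt, analyticOrderAt_congr heq, analyticOrderAt_mul hga
    (Polynomial.differentiable _ |>.analyticAt r), hg0, zero_add, analyticOrderNatAt]

lemma tendsto_div_mul_I_add (l : Filter ℝ) (hl : Tendsto (fun y : ℝ => ‖y‖) l atTop) (w z : ℂ) :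
    Tendsto (fun y : ℝ => w / (y * Complex.I - z)) l (𝓝 0) := by
  rw [tendsto_zero_iff_norm_tendsto_zero]
  simp only [norm_div]
  refine Tendsto.div_atTop tendsto_const_nhds ?_
  refine tendsto_atTop_mono (f := fun y : ℝ => ‖y‖ - ‖z‖) (fun y => ?_)
    (tendsto_atTop_add_const_right _ _ hl)
  have := norm_sub_norm_le ((y : ℂ) * Complex.I) z
  simpa using this

/-- The two transforms are bounded by 1 on the imaginary axis, so the subtracted term has modulus at
most (λ + μ_d)/(λ + μ_d + 1/t); strictness comes from killing at the positive rate 1/t. -/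
lemma re_one_sub_pos (hα : IsCombExp A α) (hβ : IsCombExp A β) (hlam : 0 < lam)
    (hmud : 0 < mud) (ht : 0 < t) (y : ℝ) :
    0 < (1 - (lam + mud + 1 / t : ℂ)⁻¹ * ∑ i, lundbergResidue lam mud A α β i /
      (y * Complex.I - lundbergPole α β i)).re := by
  have hc : 0 < lam + mud + 1 / t := by positivity
  rw [sum_residue_div]
  set z := (lam * ∑ i, (A i : ℂ) * (β i / (β i + y * Complex.I)) +
    mud * ∑ i, (A i : ℂ) * (α i / (α i - y * Complex.I)) : ℂ) with hz
  have h1 := hβ.norm_laplace_le_one (z := y * Complex.I) (by simp)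
  have h2 := hα.norm_laplace_le_one (z := -(y * Complex.I)) (by simp)
  simp only [← sub_eq_add_neg] at h2
  have h3 : ‖z‖ ≤ lam + mud := by
    refine (norm_add_le _ _).trans ?_
    rw [norm_mul, norm_mul, Complex.norm_real, Complex.norm_real, Real.norm_of_nonneg hlam.le,
      Real.norm_of_nonneg hmud.le]
    nlinarith
  have h4 : ‖(lam + mud + 1 / t : ℂ)⁻¹ * z‖ < 1 := by
    have : (lam + mud + 1 / t : ℂ) = ((lam + mud + 1 / t : ℝ) : ℂ) := by push_cast; rfl
    rw [norm_mul, norm_inv, this, Complex.norm_real, Real.norm_of_nonneg hc.le,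
      inv_mul_lt_one₀ hc]
    have : 0 < 1 / t := by positivity
    linarith
  have h5 := (Complex.re_le_norm ((lam + mud + 1 / t : ℂ)⁻¹ * z)).trans_lt h4
  rw [Complex.sub_re, Complex.one_re]
  linarith

/-- The n poles -β_i on the left balance the n poles α_i on the right. -/
lemma halfPlaneBalance_nodal (hα : IsCombExp A α) (hβ : IsCombExp A β) :
    halfPlaneBalance (Lagrange.nodal Finset.univ (lundbergPole α β)).roots = 0 := by
  have : (Lagrange.nodal Finset.univ (lundbergPole α β)).roots =
      Finset.univ.val.map (lundbergPole α β) := by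
    rw [Lagrange.nodal_eq]
    have := Polynomial.roots_multiset_prod_X_sub_C (Finset.univ.val.map (lundbergPole α β))
    rw [Multiset.map_map] at this
    exact this
  rw [this, halfPlaneBalance, Multiset.map_map]
  change ∑ i, (fun z : ℂ => if 0 < z.re then (1 : ℝ) else -1) (lundbergPole α β i) = 0
  rw [Fintype.sum_sum_type]
  have h1 : ∀ i, ¬ (0 < (lundbergPole α β (Sum.inl i)).re) := fun i => by
    simp [lundbergPole, (hβ.rate_pos i).le]
  have h2 : ∀ i, 0 < (lundbergPole α β (Sum.inr i)).re := fun i => by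
    simp [lundbergPole, hα.rate_pos i]
  simp [h1, h2]

/-- The generalized Lundberg equation has exactly `n` solutions in the right half-plane. -/
theorem lundbergRoots_count (hα : IsCombExp A α) (hβ : IsCombExp A β) (hlam : 0 < lam)
    (hmud : 0 < mud) (ht : 0 < t) :
    (lundbergRoots lam mud t A α β).Finite ∧
      ∑ᶠ r ∈ lundbergRoots lam mud t A α β,
        analyticOrderNatAt (lundberg lam mud t A α β) r = n := by
  classical
  set p := lundbergNumerator lam mud t A α β with hp
  set q := Lagrange.nodal Finset.univ (lundbergPole α β) with hq
  have hq0 : ∀ y : ℝ, q.eval (y * Complex.I) ≠ 0 := fun y => by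
    rw [hq, Lagrange.eval_nodal]
    exact Finset.prod_ne_zero_iff.mpr fun i _ =>
      sub_ne_zero.mpr (mul_I_ne_lundbergPole hα hβ y i)
  have hratio : ∀ y : ℝ, p.eval (y * Complex.I) / q.eval (y * Complex.I) =
      1 - (lam + mud + 1 / t : ℂ)⁻¹ * ∑ i, lundbergResidue lam mud A α β i /
        (y * Complex.I - lundbergPole α β i) := fun y => by
    rw [hp, lundbergNumerator, eval_partialFractionNumerator (mul_I_ne_lundbergPole hα hβ y),
      mul_div_cancel_right₀ _ (hq0 y)]
  have hre : ∀ y : ℝ, 0 < (p.eval (y * Complex.I) / q.eval (y * Complex.I)).re := fun y => by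
    rw [hratio]
    exact re_one_sub_pos hα hβ hlam hmud ht y
  have hlim : ∀ l : Filter ℝ, Tendsto (fun y : ℝ => ‖y‖) l atTop →
      Tendsto (fun y : ℝ => p.eval (y * Complex.I) / q.eval (y * Complex.I)) l (𝓝 1) := by
    intro l hl
    simp only [hratio]
    have : Tendsto (fun y : ℝ => ∑ i, lundbergResidue lam mud A α β i /
        (y * Complex.I - lundbergPole α β i)) l (𝓝 (∑ _i : Fin n ⊕ Fin n, 0)) :=
      tendsto_finsetSum _ fun i _ => tendsto_div_mul_I_add l hl _ _
    simpa using (this.const_mul (lam + mud + 1 / t : ℂ)⁻¹).const_sub 1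
  have hbal := halfPlaneBalance_roots_eq p q hre (hlim _ tendsto_abs_atTop_atTop)
    (hlim _ tendsto_abs_atBot_atTop)
  rw [halfPlaneBalance_nodal hα hβ, halfPlaneBalance_eq] at hbal
  have hcard : p.roots.card = 2 * n := by
    rw [← (IsAlgClosed.splits p).natDegree_eq_card_roots, hp, lundbergNumerator,
      natDegree_partialFractionNumerator]
    simp
    ring
  have hcount : p.roots.countP (fun z => 0 < z.re) = n := by
    rw [hcard] at hbal
    push_cast at hbal
    have : ((p.roots.countP fun z => 0 < z.re : ℕ) : ℝ) = n := by linarith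
    exact_mod_cast this
  have hp0 : p ≠ 0 := by
    intro h
    have := hre 0
    simp [h] at this
  have hset : lundbergRoots lam mud t A α β =
      ((p.roots.filter fun z => 0 < z.re).toFinset : Set ℂ) := by
    ext r
    rw [mem_lundbergRoots_iff hα hβ hlam hmud ht]
    simp [and_comm, hp]
  refine ⟨hset ▸ Finset.finite_toSet _, ?_⟩
  rw [finsum_mem_congr rfl fun r hr => analyticOrderNatAt_lundberg hβ hlam hmud ht hp0 hr, hset,
    finsum_mem_coe_finset]
  have hsum : ∀ r ∈ (p.roots.filter fun z => 0 < z.re).toFinset,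
      p.rootMultiplicity r = (p.roots.filter fun z => 0 < z.re).count r := by
    intro r hr
    rw [Multiset.mem_toFinset, Multiset.mem_filter] at hr
    rw [Multiset.count_filter_of_pos (p := fun z : ℂ => 0 < z.re) hr.2, Polynomial.count_roots]
  rw [Finset.sum_congr rfl hsum, Multiset.toFinset_sum_count_eq, ← Multiset.countP_eq_card_filter,
    hcount]

end LundbergRoots

/-! ### The explicit formula solves the first-event equation. -/

section Candidate

variable {n : ℕ} {A α β : Fin n → ℝ} {lam mud t : ℝ} {r : Fin n → ℂ}

/-- The coefficients `C_k` solve the Cauchy system `∑ k, C_k / (α_j - r_k) = B_j`. -/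
lemma sum_coeffC_div (hα : Function.Injective α) (hr : Function.Injective r)
    (hne : ∀ j k, (α j : ℂ) ≠ r k) (j : Fin n) :
    ∑ k, coeffC lam mud t A α β r k / (α j - r k) = coeffB lam mud t A α β j := by
  set a : Fin n → ℂ := fun j => (α j : ℂ) with ha
  have hainj : Set.InjOn a (Finset.univ : Finset (Fin n)) := fun x _ y _ h =>
    hα (by simpa [ha] using h)
  have hrinj : Set.InjOn r (Finset.univ : Finset (Fin n)) := hr.injOn
  set v : Fin n → ℂ := fun j => (coeffB lam mud t A α β j : ℂ) * ∏ h, (a j - r h) with hv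
  -- Q has degree less than n and takes the value B_j ∏ (α_j - r_h) at α_j, so C_k = Q(r_k)/∏_{h≠k}
  -- (r_k - r_h). Interpolating Q again, now at the nodes r_k, and evaluating at α_j gives the
  -- system after division by ∏ (α_j - r_h).
  set Q := Lagrange.interpolate Finset.univ a v with hQ
  have hQr : ∀ k, Q.eval (r k) = ∑ j, v j * ∏ i ∈ Finset.univ.erase j, (r k - a i) / (a j - a i) := by
    intro k
    rw [hQ, Lagrange.interpolate_apply, Polynomial.eval_finsetSum]
    refine Finset.sum_congr rfl fun j _ => ?_
    rw [Polynomial.eval_mul, Polynomial.eval_C, Lagrange.basis, Polynomial.eval_prod]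
    congr 1
    refine Finset.prod_congr rfl fun i _ => ?_
    simp [Lagrange.basisDivisor]
    ring
  have hdeg : Q.degree < (Finset.univ : Finset (Fin n)).card :=
    Lagrange.degree_interpolate_lt _ hainj
  have hQi := Lagrange.eq_interpolate hrinj hdeg
  have hev : Q.eval (a j) = v j := Lagrange.eval_interpolate_at_node _ hainj (Finset.mem_univ j)
  rw [hQi, Lagrange.eval_interpolate_not_at_node _ fun k _ => hne j k, Lagrange.eval_nodal] at hev
  simp only [hv] at hev
  rw [mul_comm (coeffB lam mud t A α β j : ℂ)] at hev
  have hprod : ∏ h, (a j - r h) ≠ 0 :=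
    Finset.prod_ne_zero_iff.mpr fun h _ => sub_ne_zero.mpr (hne j h)
  rw [← mul_left_cancel₀ hprod hev]
  refine Finset.sum_congr rfl fun k _ => ?_
  rw [coeffC, Lagrange.nodalWeight, hQr, Finset.prod_inv_distrib]
  simp only [hv, ha]
  rw [div_div, div_eq_mul_inv, mul_inv]
  ring

/-- The claimed value of `V̂(x, t)`. -/
noncomputable def explicitValue (lam mud t : ℝ) (A α β : Fin n → ℝ) (r : Fin n → ℂ) (x : ℝ) : ℂ :=
  ∑ k, coeffC lam mud t A α β r k * Complex.exp (-r k * x) + x + t * (drift lam mud A α β : ℂ)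

/-- Rewards are positive, so killing never acts, and e^{-r_k x} is multiplied by the Laplace
transform at r_k. -/
lemma integral_explicitValue_add (hβ : IsCombExp A β) (hr : ∀ k, 0 < (r k).re) {u : ℝ}
    (hu : 0 ≤ u) :
    ∫ b, (Set.Ici 0).indicator (explicitValue lam mud t A α β r) (u + b) ∂(combExpMeasure A β) =
      ∑ k, coeffC lam mud t A α β r k * Complex.exp (-r k * u) *
        (∑ i, (A i : ℂ) * (β i / (β i + r k))) + u + ∑ i, (A i : ℂ) / β i +
        t * (drift lam mud A α β : ℂ) := by
  have := hβ.isProbabilityMeasure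
  have hae : (fun b => (Set.Ici 0).indicator (explicitValue lam mud t A α β r) (u + b))
      =ᵐ[combExpMeasure A β] fun b => ∑ k, coeffC lam mud t A α β r k * Complex.exp (-r k * u) *
        Complex.exp (-r k * b) + b + (u + t * (drift lam mud A α β : ℂ)) := by
    filter_upwards [combExpMeasure_ae_pos] with b hb
    rw [Set.indicator_of_mem (show u + b ∈ Set.Ici (0 : ℝ) by simp; linarith), explicitValue]
    have : ∀ k, Complex.exp (-r k * ((u + b : ℝ) : ℂ)) =
        Complex.exp (-r k * u) * Complex.exp (-r k * b) := fun k => by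
      rw [← Complex.exp_add]; push_cast; ring_nf
    simp only [this, ← mul_assoc]
    push_cast
    ring
  have hi : ∀ k, Integrable (fun b : ℝ => coeffC lam mud t A α β r k * Complex.exp (-r k * u) *
        Complex.exp (-r k * b)) (combExpMeasure A β) := fun k =>
    (hβ.integrable_exp (hr k).le).const_mul _
  have hsum : Integrable (fun b : ℝ => ∑ k, coeffC lam mud t A α β r k * Complex.exp (-r k * u) *
        Complex.exp (-r k * b)) (combExpMeasure A β) := integrable_finsetSum _ fun k _ => hi k
  have hsum' : Integrable (fun b : ℝ => ∑ k, coeffC lam mud t A α β r k * Complex.exp (-r k * u) *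
        Complex.exp (-r k * b) + (b : ℂ)) (combExpMeasure A β) := hsum.add hβ.integrable_id
  rw [integral_congr_ae hae, integral_add hsum' (integrable_const _),
    integral_add hsum hβ.integrable_id, integral_finsetSum _ fun k _ => hi k, hβ.integral_id,
    integral_const]
  simp only [integral_const_mul, hβ.integral_exp (hr _).le, probReal_univ, one_smul]
  ring

lemma continuous_explicitValue : Continuous (explicitValue lam mud t A α β r) := by
  unfold explicitValue
  fun_prop

/-- Cutting the integral at w = u leaves terms e^{-α_i u}. With δ the drift, their coefficient is a
multiple of 1/α_i² - tδ/α_i - ∑ C_k/(α_i - r_k), which is B_i - B_i = 0 by the Cauchy system. What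
remains is what a formal transform at -r_k would give, although that integral may diverge. -/
lemma integral_explicitValue_sub (hα : IsCombExp A α) (hr : Function.Injective r)
    (hne : ∀ j k, (α j : ℂ) ≠ r k) {u : ℝ} (hu : 0 ≤ u) :
    ∫ w, (Set.Ici 0).indicator (explicitValue lam mud t A α β r) (u - w) ∂(combExpMeasure A α) =
      ∑ k, coeffC lam mud t A α β r k * Complex.exp (-r k * u) *
        (∑ i, (A i : ℂ) * (α i / (α i - r k))) + u - ∑ i, (A i : ℂ) / α i +
        t * (drift lam mud A α β : ℂ) := by
  rw [(hα.integral_indicator_Ici_sub _ continuous_explicitValue u).2 hu]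
  have key : ∀ i, (A i : ℂ) * α i * ∫ w in (0 : ℝ)..u,
      Real.exp (-α i * w) • explicitValue lam mud t A α β r (u - w) =
      ∑ k, coeffC lam mud t A α β r k * Complex.exp (-r k * u) * ((A i : ℂ) * (α i / (α i - r k)))
        + (A i : ℂ) * (u + t * (drift lam mud A α β : ℂ)) - (A i : ℂ) / α i := by
    intro i
    have h0 : (α i : ℂ) ≠ 0 := by exact_mod_cast (hα.rate_pos i).ne'
    have hexp : ∀ w : ℝ, Real.exp (-α i * w) • explicitValue lam mud t A α β r (u - w) =
        ∑ k, coeffC lam mud t A α β r k *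
          (Real.exp (-α i * w) • Complex.exp (-r k * ((u - w : ℝ) : ℂ))) +
        Real.exp (-α i * w) • ((u - w : ℝ) : ℂ) +
        t * (drift lam mud A α β : ℂ) * (Real.exp (-α i * w) • (1 : ℂ)) := by
      intro w
      simp only [explicitValue, Complex.real_smul, mul_add, Finset.mul_sum, mul_one]
      congr 1
      · congr 1
        exact Finset.sum_congr rfl fun k _ => by ring
      · ring
    have hc : ∀ f : ℝ → ℂ, Continuous f → IntervalIntegrable f volume 0 u := fun f hf =>
      hf.intervalIntegrable _ _
    simp only [hexp]
    rw [intervalIntegral.integral_add (hc _ (by fun_prop)) (hc _ (by fun_prop)),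
      intervalIntegral.integral_add (hc _ (by fun_prop)) (hc _ (by fun_prop)),
      intervalIntegral.integral_finsetSum fun k _ => hc _ (by fun_prop),
      intervalIntegral.integral_const_mul,
      intervalIntegral_exp_smul_id (hα.rate_pos i).ne',
      intervalIntegral_exp_smul_one (hα.rate_pos i).ne']
    simp only [intervalIntegral.integral_const_mul]
    simp only [intervalIntegral_exp_smul_exp (hne i _).symm]
    have hcauchy := sum_coeffC_div (lam := lam) (mud := mud) (t := t) (A := A) (β := β)
      hα.rate_strictMono.injective hr hne i
    have hsplit : ∑ k, coeffC lam mud t A α β r k *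
        ((Complex.exp (-r k * u) - Complex.exp (-α i * u)) / (α i - r k)) =
        ∑ k, coeffC lam mud t A α β r k * Complex.exp (-r k * u) * (1 / (α i - r k)) -
        Complex.exp (-α i * u) * coeffB lam mud t A α β i := by
      rw [← hcauchy, Finset.mul_sum, ← Finset.sum_sub_distrib]
      exact Finset.sum_congr rfl fun k _ => by ring
    have hpull : ∑ k, coeffC lam mud t A α β r k * Complex.exp (-r k * u) *
        ((A i : ℂ) * (α i / (α i - r k))) = A i * α i *
        ∑ k, coeffC lam mud t A α β r k * Complex.exp (-r k * u) * (1 / (α i - r k)) := by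
      rw [Finset.mul_sum]
      exact Finset.sum_congr rfl fun k _ => by ring
    rw [hsplit, hpull, coeffB]
    generalize ∑ k, coeffC lam mud t A α β r k * Complex.exp (-r k * u) * (1 / (α i - r k)) = S
    push_cast
    field_simp
    ring
  simp only [key]
  rw [Finset.sum_sub_distrib, Finset.sum_add_distrib, ← Finset.sum_mul, hα.weight_sum_complex,
    Finset.sum_comm]
  simp only [Finset.mul_sum]
  ring

/-- The explicit function solves the equation obtained by conditioning on the first event. -/
theorem explicitValue_step (hα : IsCombExp A α) (hβ : IsCombExp A β) (ht : 0 < t)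
    (hr : Function.Injective r) (hroot : ∀ k, r k ∈ lundbergRoots lam mud t A α β) {u : ℝ}
    (hu : 0 ≤ u) :
    (lam + mud + 1 / t : ℂ) * explicitValue lam mud t A α β r u = 1 / t * u +
      (lam * ∫ b, (Set.Ici 0).indicator (explicitValue lam mud t A α β r) (u + b)
        ∂(combExpMeasure A β) +
      mud * ∫ w, (Set.Ici 0).indicator (explicitValue lam mud t A α β r) (u - w)
        ∂(combExpMeasure A α)) := by
  have ht' : (t : ℂ) ≠ 0 := by exact_mod_cast ht.ne'
  rw [integral_explicitValue_add hβ (fun k => (hroot k).1) hu,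
    integral_explicitValue_sub hα hr (fun j k h => (hroot k).2.1 j h.symm) hu]
  -- The Lundberg equation says that the total rate is the factor which the two jump terms produce
  -- on e^{-r_k u}.
  have hk : ∀ k, (lam + mud + 1 / t : ℂ) =
      lam * (∑ i, (A i : ℂ) * (β i / (β i + r k))) +
      mud * ∑ i, (A i : ℂ) * (α i / (α i - r k)) := fun k => by
    have := (hroot k).2.2
    rw [lundberg, sub_eq_zero] at this
    exact this.symm
  have hsum : (lam + mud + 1 / t : ℂ) *
      ∑ k, coeffC lam mud t A α β r k * Complex.exp (-r k * u) =
      lam * ∑ k, coeffC lam mud t A α β r k * Complex.exp (-r k * u) *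
        (∑ i, (A i : ℂ) * (β i / (β i + r k))) +
      mud * ∑ k, coeffC lam mud t A α β r k * Complex.exp (-r k * u) *
        (∑ i, (A i : ℂ) * (α i / (α i - r k))) := by
    rw [Finset.mul_sum, Finset.mul_sum, Finset.mul_sum, ← Finset.sum_add_distrib]
    refine Finset.sum_congr rfl fun k _ => ?_
    rw [hk k]
    ring
  have hdrift : (drift lam mud A α β : ℂ) =
      lam * ∑ i, (A i : ℂ) / β i - mud * ∑ i, (A i : ℂ) / α i := by
    rw [drift, Finset.mul_sum, Finset.mul_sum, ← Finset.sum_sub_distrib]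
    push_cast
    exact Finset.sum_congr rfl fun i _ => by ring
  rw [explicitValue, mul_add, mul_add, hsum]
  set δ := (drift lam mud A α β : ℂ)
  -- The constant tδ carries the rate λ + μ_d + 1/t on the left but only λ + μ_d on the right; the
  -- excess δ is the mean displacement from the linear term u.
  have : (1 / t : ℂ) * (t * δ) = δ := by field_simp
  linear_combination this + hdrift

/-- The roots have positive real part, so the exponentials are bounded on [0,∞). This places the
candidate in the class where the first-event equation determines its solution. -/
lemma norm_explicitValue_le (hr : ∀ k, 0 < (r k).re) {x : ℝ} (hx : 0 ≤ x) :
    ‖explicitValue lam mud t A α β r x‖ ≤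
      (∑ k, ‖coeffC lam mud t A α β r k‖ + ‖(t * (drift lam mud A α β : ℂ) : ℂ)‖) + x := by
  have h1 : ‖∑ k, coeffC lam mud t A α β r k * Complex.exp (-r k * x)‖ ≤
      ∑ k, ‖coeffC lam mud t A α β r k‖ := by
    refine (norm_sum_le _ _).trans (Finset.sum_le_sum fun k _ => ?_)
    rw [norm_mul]
    refine mul_le_of_le_one_right (norm_nonneg _) ?_
    rw [Complex.norm_exp, Real.exp_le_one_iff]
    simp
    exact mul_nonneg (hr k).le hx
  rw [explicitValue]
  refine (norm_add_le _ _).trans ?_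
  have h2 := norm_add_le (∑ k, coeffC lam mud t A α β r k * Complex.exp (-r k * x)) (x : ℂ)
  rw [Complex.norm_real, Real.norm_of_nonneg hx] at h2
  linarith

end Candidate

/-! ### Independence of a Poisson increment from the past. -/

section Independence

variable {Ω : Type*} {mΩ : MeasurableSpace Ω} {P : Measure Ω}

/-- The intersections form a π-system, so independence from a supremum need only be checked on them.
-/
lemma sup_eq_generateFrom_inter (b c : MeasurableSpace Ω) :
    b ⊔ c = MeasurableSpace.generateFrom
      {s | ∃ B C, MeasurableSet[b] B ∧ MeasurableSet[c] C ∧ s = B ∩ C} := by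
  refine le_antisymm (sup_le ?_ ?_) (MeasurableSpace.generateFrom_le ?_)
  · intro B hB
    exact MeasurableSpace.measurableSet_generateFrom
      ⟨B, Set.univ, hB, MeasurableSet.univ, by simp⟩
  · intro C hC
    exact MeasurableSpace.measurableSet_generateFrom
      ⟨Set.univ, C, MeasurableSet.univ, hC, by simp⟩
  · rintro s ⟨B, C, hB, hC, rfl⟩
    exact MeasurableSet.inter ((le_sup_left : b ≤ b ⊔ c) B hB) ((le_sup_right : c ≤ b ⊔ c) C hC)

/-- If `a` is independent of `b`, and `a ⊔ b` of `c`, then `a` is independent of `b ⊔ c`. -/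
lemma indep_sup_right_of_indep_sup_left [IsProbabilityMeasure P] {a b c : MeasurableSpace Ω}
    (ha : a ≤ mΩ) (hb : b ≤ mΩ) (hc : c ≤ mΩ) (hab : Indep a b P) (habc : Indep (a ⊔ b) c P) :
    Indep a (b ⊔ c) P := by
  refine IndepSets.indep ha (sup_le hb hc) (@MeasurableSpace.isPiSystem_measurableSet Ω a) ?_
    (@MeasurableSpace.generateFrom_measurableSet Ω a).symm (sup_eq_generateFrom_inter b c) ?_
  · rintro _ ⟨B, C, hB, hC, rfl⟩ _ ⟨B', C', hB', hC', rfl⟩ _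
    exact ⟨B ∩ B', C ∩ C', hB.inter hB', hC.inter hC', by rw [Set.inter_inter_inter_comm]⟩
  · rw [IndepSets_iff]
    rintro A _ hA ⟨B, C, hB, hC, rfl⟩
    rw [Indep_iff] at hab habc
    have hA' : MeasurableSet[a ⊔ b] A := (le_sup_left : a ≤ a ⊔ b) A hA
    have hB' : MeasurableSet[a ⊔ b] B := (le_sup_right : b ≤ a ⊔ b) B hB
    rw [← Set.inter_assoc, habc _ _ (hA'.inter hB') hC, hab _ _ hA hB, habc _ _ hB' hC, mul_assoc]

/-- The information in the path of `N` up to time `s`. -/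
abbrev pastSigma (N : ℝ≥0 → Ω → ℕ) (s : ℝ≥0) : MeasurableSpace Ω :=
  ⨆ v : Set.Iic s, MeasurableSpace.comap (N v) inferInstance

lemma measurable_pastSigma (N : ℝ≥0 → Ω → ℕ) {v s : ℝ≥0} (h : v ≤ s) :
    Measurable[pastSigma N s] (N v) := by
  have : MeasurableSpace.comap (N v) inferInstance ≤ pastSigma N s :=
    le_iSup (fun v : Set.Iic s => MeasurableSpace.comap (N v) inferInstance) ⟨v, h⟩
  exact measurable_iff_comap_le.mpr this

lemma pastSigma_le_iSup (N : ℝ≥0 → Ω → ℕ) (s : ℝ≥0) :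
    pastSigma N s ≤ ⨆ v, MeasurableSpace.comap (N v) inferInstance :=
  iSup_le fun v => le_iSup (fun v => MeasurableSpace.comap (N v) inferInstance) (v : ℝ≥0)

variable {rate : ℝ} {N : ℝ≥0 → Ω → ℕ}

lemma IsPoissonProcess.pastSigma_le (hN : IsPoissonProcess P rate N) (s : ℝ≥0) :
    pastSigma N s ≤ mΩ :=
  iSup_le fun v => (hN.measurable v).comap_le

/-- Each value N_v with v ≤ s is a sum of increments along a finite ordered grid ending at s, and
these increments are independent of the next one, over [s, s']. -/
lemma IsPoissonProcess.indepFun_tuple_increment [IsProbabilityMeasure P]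
    (hN : IsPoissonProcess P rate N) {s s' : ℝ≥0} (hs : s ≤ s') (F : Finset (Set.Iic s)) :
    IndepFun (fun ω (v : F) => N v ω) (fun ω => N s' ω - N s ω) P := by
  classical
  -- The point 0 lets the increments telescope from N_0 = 0; the point s makes the step after the
  -- grid exactly [s, s'].
  set F' : Finset ℝ≥0 := insert 0 (insert s (F.map (Function.Embedding.subtype _))) with hF'
  have hne : F'.Nonempty := ⟨0, by simp [hF']⟩
  have hle : ∀ x ∈ F', x ≤ s := by
    intro x hx
    simp only [hF', Finset.mem_insert, Finset.mem_map, Function.Embedding.coe_subtype] at hx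
    rcases hx with rfl | rfl | ⟨v, -, rfl⟩
    · exact zero_le
    · exact le_rfl
    · exact v.2
  have hcard : 0 < F'.card := hne.card_pos
  set e := F'.orderEmbOfFin rfl with he
  -- The ordered grid is continued by the constant s', so increment number `F'.card - 1` is the one
  -- over [s, s'].
  set t : ℕ → ℝ≥0 := fun k => if h : k < F'.card then e ⟨k, h⟩ else s' with ht
  have htmono : Monotone t := by
    intro i j hij
    simp only [ht]
    split_ifs with h1 h2 h2
    · exact e.monotone hij
    · exact (hle _ (F'.orderEmbOfFin_mem rfl _)).trans hs
    · omega
    · exact le_rfl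
  have ht0 : t 0 = 0 := by
    simp only [ht, dif_pos hcard, he, Finset.orderEmbOfFin_zero rfl hcard]
    exact le_antisymm (Finset.min'_le _ _ (by simp [hF'])) zero_le
  have htK : t (F'.card - 1) = s := by
    have h1 : F'.card - 1 < F'.card := by omega
    simp only [ht, dif_pos h1, he, Finset.orderEmbOfFin_last rfl hcard]
    exact le_antisymm (hle _ (Finset.max'_mem _ _)) (Finset.le_max' _ _ (by simp [hF']))
  have htK' : t (F'.card - 1 + 1) = s' := by
    simp only [ht]
    rw [dif_neg (by omega)]
  have hidx : ∀ v : F, ∃ j, j ≤ F'.card - 1 ∧ t j = ((v : Set.Iic s) : ℝ≥0) := by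
    intro v
    have hmem : ((v : Set.Iic s) : ℝ≥0) ∈ F' := by
      simp only [hF', Finset.mem_insert, Finset.mem_map]
      exact Or.inr (Or.inr ⟨v, v.2, rfl⟩)
    have : ((v : Set.Iic s) : ℝ≥0) ∈ Set.range e := by
      rw [he, Finset.range_orderEmbOfFin]; exact hmem
    obtain ⟨⟨j, hj⟩, hje⟩ := this
    exact ⟨j, by omega, by simp only [ht, dif_pos hj, hje]⟩
  choose j hjle hj using hidx
  have hind := hN.indep_increments.nat htmono
  have hST : Disjoint (Finset.range (F'.card - 1)) {F'.card - 1} := by simp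
  have h1 := hind.indepFun_finset _ _ hST
    fun i => (hN.measurable _).sub (hN.measurable _)
  have hφ : Measurable fun (x : Finset.range (F'.card - 1) → ℕ) (v : F) =>
      ∑ i ∈ (Finset.range (j v)).attach,
        x ⟨i, Finset.mem_range.mpr ((Finset.mem_range.mp i.2).trans_le (hjle v))⟩ :=
    measurable_pi_lambda _ fun v => Finset.measurable_fun_sum _ fun i _ => measurable_pi_apply _
  have hψ : Measurable fun x : ({F'.card - 1} : Finset ℕ) → ℕ =>
      x ⟨F'.card - 1, Finset.mem_singleton_self _⟩ := measurable_pi_apply _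
  have h2 := h1.comp hφ hψ
  refine h2.congr ?_ ?_
  · filter_upwards [hN.start_zero, hN.monotone_paths] with ω h0 hm
    funext v
    simp only [Function.comp]
    -- Truncated subtraction of natural numbers telescopes because the path is monotone.
    rw [Finset.sum_attach (Finset.range (j v)) fun i => N (t (i + 1)) ω - N (t i) ω,
      Finset.sum_range_tsub (f := fun i => N (t i) ω) (fun a b hab => hm (htmono hab)), ht0, h0,
      hj, Nat.sub_zero]
  · refine Eventually.of_forall fun ω => ?_
    simp only [Function.comp, htK, htK']

/-- The increments of a Poisson process after time `s` are independent of the past of `s`. -/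
lemma IsPoissonProcess.indep_pastSigma_increment [IsProbabilityMeasure P]
    (hN : IsPoissonProcess P rate N) {s s' : ℝ≥0} (hs : s ≤ s') :
    Indep (pastSigma N s)
      (MeasurableSpace.comap (fun ω => N s' ω - N s ω) inferInstance) P := by
  set m : Finset (Set.Iic s) → MeasurableSpace Ω := fun F =>
    MeasurableSpace.comap (fun ω (v : F) => N v ω) inferInstance with hm
  have hmono : Monotone m := by
    intro F G hFG
    refine (measurable_iff_comap_le (m₁ := m G)).mp ?_
    refine @measurable_pi_lambda _ _ _ (m G) _ _ fun v => ?_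
    exact (measurable_pi_apply (⟨v, hFG v.2⟩ : G)).comp
      (comap_measurable fun ω (v : G) => N v ω)
  -- The past is the directed supremum of the σ-algebras of finite tuples, and independence passes
  -- to directed suprema.
  have h1 : Indep (⨆ F, m F)
      (MeasurableSpace.comap (fun ω => N s' ω - N s ω) inferInstance) P := by
    refine indep_iSup_of_directed_le (fun F => ?_) (fun F => ?_) ?_ hmono.directed_le
    · exact hN.indepFun_tuple_increment hs F
    · exact Measurable.comap_le (measurable_pi_lambda _ fun v => hN.measurable v)
    · exact Measurable.comap_le ((hN.measurable _).sub (hN.measurable _))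
  refine indep_of_indep_of_le_left h1 (iSup_le fun v => le_iSup_of_le {v} ?_)
  refine (measurable_iff_comap_le (m₁ := m {v})).mp ?_
  exact (measurable_pi_apply (⟨v, by simp⟩ : ({v} : Finset (Set.Iic s)))).comp
    (comap_measurable fun ω (w : ({v} : Finset (Set.Iic s))) => N w ω)

end Independence

/-! ### The event of survival with prescribed jump counts. -/

section Survival

variable {Ω : Type*} {mΩ : MeasurableSpace Ω} {P : Measure Ω}

/-- The information in a sequence of random variables. -/
abbrev seqSigma (B : ℕ → Ω → ℝ) : MeasurableSpace Ω :=
  ⨆ k, MeasurableSpace.comap (B k) inferInstance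

/-- The information in the first `i` terms of a sequence of random variables. -/
abbrev initSigma (B : ℕ → Ω → ℝ) (i : ℕ) : MeasurableSpace Ω :=
  ⨆ k : Set.Iio i, MeasurableSpace.comap (B k) inferInstance

lemma initSigma_le_seqSigma (B : ℕ → Ω → ℝ) (i : ℕ) : initSigma B i ≤ seqSigma B :=
  iSup_le fun k => le_iSup (fun k => MeasurableSpace.comap (B k) inferInstance) (k : ℕ)

lemma measurable_initSigma (B : ℕ → Ω → ℝ) {k i : ℕ} (h : k < i) :
    Measurable[initSigma B i] (B k) := by
  have : MeasurableSpace.comap (B k) inferInstance ≤ initSigma B i :=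
    le_iSup (fun k : Set.Iio i => MeasurableSpace.comap (B k) inferInstance) ⟨k, h⟩
  exact measurable_iff_comap_le.mpr this

lemma measurable_seqSigma (B : ℕ → Ω → ℝ) (k : ℕ) : Measurable[seqSigma B] (B k) := by
  have : MeasurableSpace.comap (B k) inferInstance ≤ seqSigma B :=
    le_iSup (fun k => MeasurableSpace.comap (B k) inferInstance) k
  exact measurable_iff_comap_le.mpr this

/-- The capital after `i` rewards and `j` payments. -/
def level (W B : ℕ → Ω → ℝ) (u : ℝ) (i j : ℕ) (ω : Ω) : ℝ :=
  u - ∑ k ∈ Finset.range j, W k ω + ∑ k ∈ Finset.range i, B k ω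

variable {N M : ℝ≥0 → Ω → ℕ} {W B : ℕ → Ω → ℝ} {u : ℝ}

lemma measurable_level {m : MeasurableSpace Ω} {i j : ℕ} (hW : initSigma W j ≤ m)
    (hB : initSigma B i ≤ m) : Measurable[m] (level W B u i j) := by
  refine Measurable.add (Measurable.sub measurable_const ?_) ?_
  · refine Finset.measurable_fun_sum _ fun k hk => ?_
    exact (measurable_initSigma W (Finset.mem_range.mp hk)).mono hW le_rfl
  · refine Finset.measurable_fun_sum _ fun k hk => ?_
    exact (measurable_initSigma B (Finset.mem_range.mp hk)).mono hB le_rfl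

/-- The event that at time `s` there have been `i` rewards, `j` payments and no ruin, up to a null
set. -/
def survivalSet (N M : ℝ≥0 → Ω → ℕ) (W B : ℕ → Ω → ℝ) (u : ℝ) (s : ℝ≥0) (i j : ℕ) : Set Ω :=
  {ω | N s ω = i} ∩ {ω | M s ω = j} ∩ {ω | 0 ≤ level W B u i j ω} ∩
    ⋂ q ∈ {k : ℕ | TopologicalSpace.denseSeq ℝ≥0 k ≤ s},
      ⋃ i' : Set.Iic i, ⋃ j' : Set.Iic j,
        {ω | N (TopologicalSpace.denseSeq ℝ≥0 q) ω = i'} ∩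
        {ω | M (TopologicalSpace.denseSeq ℝ≥0 q) ω = j'} ∩ {ω | 0 ≤ level W B u i' j' ω}

lemma initSigma_mono (B : ℕ → Ω → ℝ) {i i' : ℕ} (h : i' ≤ i) : initSigma B i' ≤ initSigma B i :=
  iSup_le fun k => le_iSup_of_le (⟨k, k.2.trans_le h⟩ : Set.Iio i) le_rfl

/-- Only countably many times up to s and the first i rewards and j payments enter. The next jump
sizes therefore remain independent of the event. -/
lemma measurableSet_survivalSet {m : MeasurableSpace Ω} {s : ℝ≥0} {i j : ℕ}
    (hN : pastSigma N s ≤ m) (hM : pastSigma M s ≤ m)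
    (hW : initSigma W j ≤ m) (hB : initSigma B i ≤ m) :
    MeasurableSet[m] (survivalSet N M W B u s i j) := by
  have hNm : ∀ v ≤ s, ∀ i, MeasurableSet[m] {ω | N v ω = i} := fun v hv i =>
    ((measurable_pastSigma N hv).mono hN le_rfl) (measurableSet_singleton i)
  have hMm : ∀ v ≤ s, ∀ i, MeasurableSet[m] {ω | M v ω = i} := fun v hv i =>
    ((measurable_pastSigma M hv).mono hM le_rfl) (measurableSet_singleton i)
  have hL : ∀ i' ≤ i, ∀ j' ≤ j, MeasurableSet[m] {ω | 0 ≤ level W B u i' j' ω} :=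
    fun i' hi j' hj => (measurable_level ((initSigma_mono W hj).trans hW)
      ((initSigma_mono B hi).trans hB)) measurableSet_Ici
  refine (((hNm s le_rfl i).inter (hMm s le_rfl j)).inter (hL i le_rfl j le_rfl)).inter ?_
  refine MeasurableSet.biInter (Set.to_countable _) fun q hq => ?_
  refine MeasurableSet.iUnion fun i' => MeasurableSet.iUnion fun j' => ?_
  exact ((hNm _ hq i').inter (hMm _ hq j')).inter (hL i' i'.2 j' j'.2)

/-- The regularity of the paths that holds almost surely. -/
structure RegularPath (N M : ℝ≥0 → Ω → ℕ) (ω : Ω) : Prop where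
  zero_left : N 0 ω = 0
  zero_right : M 0 ω = 0
  mono_left : Monotone fun s => N s ω
  mono_right : Monotone fun s => M s ω
  const_after : ∀ s, ∀ᶠ v in 𝓝[≥] s, N v ω = N s ω ∧ M v ω = M s ω

lemma ae_regularPath {a b : ℝ} (hN : IsPoissonProcess P a N) (hM : IsPoissonProcess P b M) :
    ∀ᵐ ω ∂P, RegularPath N M ω := by
  filter_upwards [hN.start_zero, hM.start_zero, hN.monotone_paths, hM.monotone_paths,
    hN.rightContinuous_paths, hM.rightContinuous_paths] with ω h1 h2 h3 h4 h5 h6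
  refine ⟨h1, h2, h3, h4, fun s => ?_⟩
  have e1 : ∀ᶠ v in 𝓝[≥] s, N v ω = N s ω :=
    (h5 s).eventually ((isOpen_discrete {N s ω}).mem_nhds rfl)
  have e2 : ∀ᶠ v in 𝓝[≥] s, M v ω = M s ω :=
    (h6 s).eventually ((isOpen_discrete {M s ω}).mem_nhds rfl)
  exact e1.and e2

/-- For v < s the path is constant just after v, so its level at v is also seen at a dense time in
(v, s). Time s has no such successor, which is why the level at s is a separate condition. -/
lemma RegularPath.mem_survivalSet_iff {ω : Ω} (h : RegularPath N M ω) {s : ℝ≥0} {i j : ℕ} :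
    ω ∈ survivalSet N M W B u s i j ↔
      N s ω = i ∧ M s ω = j ∧ ∀ v ≤ s, 0 ≤ surplus N M W B u v ω := by
  simp only [survivalSet, Set.mem_inter_iff, Set.mem_ofPred_eq, Set.mem_iInter, Set.mem_iUnion]
  constructor
  · rintro ⟨⟨⟨hi, hj⟩, hl⟩, hq⟩
    refine ⟨hi, hj, fun v hv => ?_⟩
    rcases hv.eq_or_lt with rfl | hv
    · have : surplus N M W B u v ω = level W B u i j ω := by rw [← hi, ← hj]; rfl
      rwa [this]
    · have h1 : ∀ᶠ x in 𝓝[>] v, N x ω = N v ω ∧ M x ω = M v ω :=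
        (h.const_after v).filter_mono (nhdsWithin_mono _ Set.Ioi_subset_Ici_self)
      obtain ⟨δ, hδ, hsub⟩ := (mem_nhdsGT_iff_exists_Ioo_subset' hv).mp
        (h1.and (Ioo_mem_nhdsGT hv))
      obtain ⟨k, hk⟩ := (TopologicalSpace.denseRange_denseSeq ℝ≥0).exists_mem_open
        isOpen_Ioo (Set.nonempty_Ioo.mpr hδ)
      obtain ⟨⟨e1, e2⟩, e3⟩ := hsub hk
      obtain ⟨i', j', ⟨f1, f2⟩, f3⟩ := hq k e3.2.le
      have : surplus N M W B u v ω = level W B u i' j' ω := by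
        rw [← f1, ← f2, e1, e2]; rfl
      rwa [this]
  · rintro ⟨hi, hj, hv⟩
    refine ⟨⟨⟨hi, hj⟩, ?_⟩, fun k hk => ?_⟩
    · rw [← hi, ← hj]
      exact hv s le_rfl
    · refine ⟨⟨_, ?_⟩, ⟨_, ?_⟩, ⟨rfl, rfl⟩, hv _ hk⟩
      · rw [← hi]; exact h.mono_left hk
      · rw [← hj]; exact h.mono_right hk

end Survival

/-! ### Independence between the ingredients of the model. -/

section ModelIndependence

variable {Ω : Type*} {mΩ : MeasurableSpace Ω} {P : Measure Ω}
  {lam mud t : ℝ} {lawW lawB : Measure ℝ} {N M : ℝ≥0 → Ω → ℕ} {W B : ℕ → Ω → ℝ} {T : Ω → ℝ≥0}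

lemma iSup_comap_le {ι E : Type*} [MeasurableSpace E] {X : ι → Ω → E} (h : ∀ i, Measurable (X i)) :
    ⨆ i, MeasurableSpace.comap (X i) inferInstance ≤ mΩ :=
  iSup_le fun i => (h i).comap_le

/-- The five independent sources of randomness. -/
abbrev modelSigma (N M : ℝ≥0 → Ω → ℕ) (W B : ℕ → Ω → ℝ) (T : Ω → ℝ≥0) :
    Fin 5 → MeasurableSpace Ω :=
  ![⨆ s, MeasurableSpace.comap (N s) inferInstance,
    ⨆ s, MeasurableSpace.comap (M s) inferInstance,
    ⨆ k, MeasurableSpace.comap (W k) inferInstance,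
    ⨆ k, MeasurableSpace.comap (B k) inferInstance,
    MeasurableSpace.comap T inferInstance]

lemma IsPoolModel.indep_iSup (h : IsPoolModel P lam mud t lawW lawB N M W B T)
    {S S' : Set (Fin 5)} (hS : Disjoint S S') :
    Indep (⨆ i ∈ S, modelSigma N M W B T i) (⨆ i ∈ S', modelSigma N M W B T i) P := by
  refine indep_iSup_of_disjoint (fun i => ?_) h.iIndep_all hS
  fin_cases i
  · exact iSup_comap_le h.poisson_N.measurable
  · exact iSup_comap_le h.poisson_M.measurable
  · exact iSup_comap_le h.measurable_W
  · exact iSup_comap_le h.measurable_B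
  · exact h.measurable_T.comap_le

lemma indep_mono {a b a' b' : MeasurableSpace Ω} (h : Indep a b P) (ha : a' ≤ a) (hb : b' ≤ b) :
    Indep a' b' P :=
  indep_of_indep_of_le_left (indep_of_indep_of_le_right h hb) ha

/-- The information in the paths up to time `s` and all jump sizes. -/
abbrev pastAndJumps (N M : ℝ≥0 → Ω → ℕ) (W B : ℕ → Ω → ℝ) (s : ℝ≥0) : MeasurableSpace Ω :=
  pastSigma N s ⊔ pastSigma M s ⊔ seqSigma W ⊔ seqSigma B

lemma comap_sub_le (N : ℝ≥0 → Ω → ℕ) (s s' : ℝ≥0) :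
    MeasurableSpace.comap (fun ω => N s' ω - N s ω) inferInstance ≤
      ⨆ v, MeasurableSpace.comap (N v) inferInstance := by
  have h : ∀ v, Measurable[⨆ v, MeasurableSpace.comap (N v) inferInstance] (N v) := fun v =>
    measurable_iff_comap_le.mpr (le_iSup (fun v => MeasurableSpace.comap (N v) inferInstance) v)
  exact measurable_iff_comap_le.mp ((h s').sub (h s))

lemma IsPoolModel.pastAndJumps_le (h : IsPoolModel P lam mud t lawW lawB N M W B T) (s : ℝ≥0) :
    pastAndJumps N M W B s ≤ mΩ :=
  sup_le (sup_le (sup_le (h.poisson_N.pastSigma_le s) (h.poisson_M.pastSigma_le s))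
    (iSup_comap_le h.measurable_W)) (iSup_comap_le h.measurable_B)

/-- The increment is independent of the past of N, and the whole process N is independent of M, W
and B; `indep_sup_right_of_indep_sup_left` joins the two facts. The increment of M is included so
that the two increments can be split off one after the other. -/
lemma IsPoolModel.indep_increment_left [IsProbabilityMeasure P]
    (h : IsPoolModel P lam mud t lawW lawB N M W B T)
    {s s' : ℝ≥0} (hs : s ≤ s') :
    Indep (MeasurableSpace.comap (fun ω => N s' ω - N s ω) inferInstance)
      (pastAndJumps N M W B s ⊔
        MeasurableSpace.comap (fun ω => M s' ω - M s ω) inferInstance) P := by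
  have hX := ((h.poisson_N.measurable s').sub (h.poisson_N.measurable s)).comap_le
  have hY := ((h.poisson_M.measurable s').sub (h.poisson_M.measurable s)).comap_le
  have key := indep_sup_right_of_indep_sup_left
    (c := pastSigma M s ⊔ seqSigma W ⊔ seqSigma B ⊔
      MeasurableSpace.comap (fun ω => M s' ω - M s ω) inferInstance)
    hX (h.poisson_N.pastSigma_le s)
    (sup_le (sup_le (sup_le (h.poisson_M.pastSigma_le s) (iSup_comap_le h.measurable_W))
      (iSup_comap_le h.measurable_B)) hY)
    (h.poisson_N.indep_pastSigma_increment hs).symm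
    (indep_mono (h.indep_iSup (S := {0}) (S' := {1, 2, 3}) (by simp)) ?_ ?_)
  · refine indep_of_indep_of_le_right key ?_
    simp only [pastAndJumps, sup_assoc, le_refl]
  · exact le_iSup₂_of_le 0 rfl (sup_le (comap_sub_le N s s') (pastSigma_le_iSup N s))
  · refine sup_le (sup_le (sup_le ?_ ?_) ?_) ?_
    · exact le_iSup₂_of_le 1 (by simp) (pastSigma_le_iSup M s)
    · exact le_iSup₂_of_le 2 (by simp) le_rfl
    · exact le_iSup₂_of_le 3 (by simp) le_rfl
    · exact le_iSup₂_of_le 1 (by simp) (comap_sub_le M s s')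

lemma IsPoolModel.indep_increment_right [IsProbabilityMeasure P]
    (h : IsPoolModel P lam mud t lawW lawB N M W B T)
    {s s' : ℝ≥0} (hs : s ≤ s') :
    Indep (MeasurableSpace.comap (fun ω => M s' ω - M s ω) inferInstance)
      (pastAndJumps N M W B s) P := by
  have hY := ((h.poisson_M.measurable s').sub (h.poisson_M.measurable s)).comap_le
  have key := indep_sup_right_of_indep_sup_left
    (c := pastSigma N s ⊔ seqSigma W ⊔ seqSigma B)
    hY (h.poisson_M.pastSigma_le s)
    (sup_le (sup_le (h.poisson_N.pastSigma_le s) (iSup_comap_le h.measurable_W))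
      (iSup_comap_le h.measurable_B))
    (h.poisson_M.indep_pastSigma_increment hs).symm
    (indep_mono (h.indep_iSup (S := {1}) (S' := {0, 2, 3}) (by simp)) ?_ ?_)
  · refine indep_of_indep_of_le_right key ?_
    rw [pastAndJumps, sup_comm (pastSigma N s)]
    simp only [sup_assoc, le_refl]
  · exact le_iSup₂_of_le 1 rfl (sup_le (comap_sub_le M s s') (pastSigma_le_iSup M s))
  · refine sup_le (sup_le ?_ ?_) ?_
    · exact le_iSup₂_of_le 0 (by simp) (pastSigma_le_iSup N s)
    · exact le_iSup₂_of_le 2 (by simp) le_rfl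
    · exact le_iSup₂_of_le 3 (by simp) le_rfl

lemma indep_initSigma {B : ℕ → Ω → ℝ} (hB : ∀ k, Measurable (B k)) (hind : iIndepFun B P) (i : ℕ) :
    Indep (MeasurableSpace.comap (B i) inferInstance) (initSigma B i) P := by
  have h1 := indep_iSup_of_disjoint (fun k => (hB k).comap_le) hind
    (show Disjoint ({i} : Set ℕ) (Set.Iio i) by simp)
  refine indep_of_indep_of_le_left (indep_of_indep_of_le_right h1 ?_) ?_
  · exact iSup_le fun k => le_iSup₂_of_le (k : ℕ) k.2 le_rfl
  · exact le_iSup₂_of_le i rfl le_rfl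

/-- The information in the paths up to time `s`, the first `j` payments and the first `i` rewards. -/
abbrev pastAndInit (N M : ℝ≥0 → Ω → ℕ) (W B : ℕ → Ω → ℝ) (s : ℝ≥0) (i j : ℕ) :
    MeasurableSpace Ω :=
  pastSigma N s ⊔ pastSigma M s ⊔ initSigma W j ⊔ initSigma B i

lemma pastAndInit_le_pastAndJumps (N M : ℝ≥0 → Ω → ℕ) (W B : ℕ → Ω → ℝ) (s : ℝ≥0) (i j : ℕ) :
    pastAndInit N M W B s i j ≤ pastAndJumps N M W B s :=
  sup_le_sup (sup_le_sup le_rfl (initSigma_le_seqSigma W j)) (initSigma_le_seqSigma B i)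

/-- The next reward, with index i because numbering starts at 0, is independent of the earlier
rewards and of the other sources of randomness. -/
lemma IsPoolModel.indep_reward [IsProbabilityMeasure P]
    (h : IsPoolModel P lam mud t lawW lawB N M W B T)
    (s : ℝ≥0) (i j : ℕ) :
    Indep (MeasurableSpace.comap (B i) inferInstance) (pastAndInit N M W B s i j) P := by
  have key := indep_sup_right_of_indep_sup_left
    (c := pastSigma N s ⊔ pastSigma M s ⊔ initSigma W j)
    (h.measurable_B i).comap_le
    ((initSigma_le_seqSigma B i).trans (iSup_comap_le h.measurable_B))
    (sup_le (sup_le (h.poisson_N.pastSigma_le s) (h.poisson_M.pastSigma_le s))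
      ((initSigma_le_seqSigma W j).trans (iSup_comap_le h.measurable_W)))
    (indep_initSigma h.measurable_B h.iIndep_B i)
    (indep_mono (h.indep_iSup (S := {3}) (S' := {0, 1, 2}) (by simp)) ?_ ?_)
  · rwa [sup_comm] at key
  · exact le_iSup₂_of_le 3 rfl (sup_le
      (le_iSup (fun k => MeasurableSpace.comap (B k) inferInstance) i) (initSigma_le_seqSigma B i))
  · refine sup_le (sup_le ?_ ?_) ?_
    · exact le_iSup₂_of_le 0 (by simp) (pastSigma_le_iSup N s)
    · exact le_iSup₂_of_le 1 (by simp) (pastSigma_le_iSup M s)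
    · exact le_iSup₂_of_le 2 (by simp) (initSigma_le_seqSigma W j)

lemma IsPoolModel.indep_payment [IsProbabilityMeasure P]
    (h : IsPoolModel P lam mud t lawW lawB N M W B T)
    (s : ℝ≥0) (i j : ℕ) :
    Indep (MeasurableSpace.comap (W j) inferInstance) (pastAndInit N M W B s i j) P := by
  have key := indep_sup_right_of_indep_sup_left
    (c := pastSigma N s ⊔ pastSigma M s ⊔ initSigma B i)
    (h.measurable_W j).comap_le
    ((initSigma_le_seqSigma W j).trans (iSup_comap_le h.measurable_W))
    (sup_le (sup_le (h.poisson_N.pastSigma_le s) (h.poisson_M.pastSigma_le s))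
      ((initSigma_le_seqSigma B i).trans (iSup_comap_le h.measurable_B)))
    (indep_initSigma h.measurable_W h.iIndep_W j)
    (indep_mono (h.indep_iSup (S := {2}) (S' := {0, 1, 3}) (by simp)) ?_ ?_)
  · rwa [← sup_assoc, sup_comm (initSigma W j)] at key
  · exact le_iSup₂_of_le 2 rfl (sup_le
      (le_iSup (fun k => MeasurableSpace.comap (W k) inferInstance) j) (initSigma_le_seqSigma W j))
  · refine sup_le (sup_le ?_ ?_) ?_
    · exact le_iSup₂_of_le 0 (by simp) (pastSigma_le_iSup N s)
    · exact le_iSup₂_of_le 1 (by simp) (pastSigma_le_iSup M s)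
    · exact le_iSup₂_of_le 3 (by simp) (initSigma_le_seqSigma B i)

lemma IsPoolModel.indep_horizon (h : IsPoolModel P lam mud t lawW lawB N M W B T) (s : ℝ≥0) :
    Indep (MeasurableSpace.comap T inferInstance) (pastAndJumps N M W B s) P := by
  refine indep_mono (h.indep_iSup (S := {4}) (S' := {0, 1, 2, 3}) (by simp)) ?_ ?_
  · exact le_iSup₂_of_le 4 rfl le_rfl
  · refine sup_le (sup_le (sup_le ?_ ?_) ?_) ?_
    · exact le_iSup₂_of_le 0 (by simp) (pastSigma_le_iSup N s)
    · exact le_iSup₂_of_le 1 (by simp) (pastSigma_le_iSup M s)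
    · exact le_iSup₂_of_le 2 (by simp) le_rfl
    · exact le_iSup₂_of_le 3 (by simp) le_rfl

end ModelIndependence

/-! ### The pathwise one-step comparison. -/

section Functional

variable {Ω : Type*} {mΩ : MeasurableSpace Ω} {P : Measure Ω}
  {N M : ℝ≥0 → Ω → ℕ} {W B : ℕ → Ω → ℝ} {u : ℝ}

/-- Measurable functions of at most linear growth. -/
def LinearGrowth (f : ℝ → ℂ) : Prop :=
  Measurable f ∧ ∃ C, 0 ≤ C ∧ ∀ x, ‖f x‖ ≤ C * (1 + |x|)

/-- The sum of `H i j` over the events "`i` rewards, `j` payments and no ruin up to time `s`" with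
`i + j = m`. -/
noncomputable def survivalSum (N M : ℝ≥0 → Ω → ℕ) (W B : ℕ → Ω → ℝ) (u : ℝ)
    (H : ℕ → ℕ → Ω → ℂ) (m : ℕ) (s : ℝ≥0) (ω : Ω) : ℂ :=
  ∑ p ∈ Finset.HasAntidiagonal.antidiagonal m, (survivalSet N M W B u s p.1 p.2).indicator (H p.1 p.2) ω

/-- `survivalSum` for `i + j + 1 = m`. -/
noncomputable def survivalSumPrev (N M : ℝ≥0 → Ω → ℕ) (W B : ℕ → Ω → ℝ) (u : ℝ)
    (H : ℕ → ℕ → Ω → ℂ) (m : ℕ) (s : ℝ≥0) (ω : Ω) : ℂ :=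
  match m with
  | 0 => 0
  | m + 1 => survivalSum N M W B u H m s ω

-- On a regular path the events for different pairs of counts are disjoint, so only the pair (N_s,
-- M_s) can contribute.
open scoped Classical in
lemma RegularPath.survivalSum_eq {ω : Ω} (h : RegularPath N M ω) (H : ℕ → ℕ → Ω → ℂ) (m : ℕ)
    (s : ℝ≥0) :
    survivalSum N M W B u H m s ω =
      if (∀ v ≤ s, 0 ≤ surplus N M W B u v ω) ∧ N s ω + M s ω = m then H (N s ω) (M s ω) ω
      else 0 := by
  rw [survivalSum]
  split_ifs with hc
  · rw [Finset.sum_eq_single (N s ω, M s ω)]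
    · rw [Set.indicator_of_mem]
      exact h.mem_survivalSet_iff.mpr ⟨rfl, rfl, hc.1⟩
    · intro p _ hp
      rw [Set.indicator_of_notMem]
      rw [h.mem_survivalSet_iff]
      rintro ⟨h1, h2, -⟩
      exact hp (by ext <;> simp [h1, h2])
    · intro hmem
      simp [hc.2] at hmem
  · refine Finset.sum_eq_zero fun p hp => ?_
    rw [Set.indicator_of_notMem]
    rw [h.mem_survivalSet_iff]
    rintro ⟨h1, h2, h3⟩
    refine hc ⟨h3, ?_⟩
    rw [h1, h2]
    simpa using hp

open scoped Classical in
lemma RegularPath.survivalSumPrev_eq {ω : Ω} (h : RegularPath N M ω) (H : ℕ → ℕ → Ω → ℂ) (m : ℕ)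
    (s : ℝ≥0) :
    survivalSumPrev N M W B u H m s ω =
      if (∀ v ≤ s, 0 ≤ surplus N M W B u v ω) ∧ N s ω + M s ω + 1 = m then H (N s ω) (M s ω) ω
      else 0 := by
  cases m with
  | zero => simp [survivalSumPrev]
  | succ m => simp [survivalSumPrev, h.survivalSum_eq]

/-- With at most one jump in (s, s'], every level taken in between is the level at s or the level at
s'. -/
lemma RegularPath.survives_iff {ω : Ω} (h : RegularPath N M ω) {s s' : ℝ≥0} (hs : s ≤ s')
    (hj : N s' ω + M s' ω ≤ N s ω + M s ω + 1) :
    (∀ v ≤ s', 0 ≤ surplus N M W B u v ω) ↔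
      (∀ v ≤ s, 0 ≤ surplus N M W B u v ω) ∧ 0 ≤ surplus N M W B u s' ω := by
  refine ⟨fun hv => ⟨fun v hvs => hv v (hvs.trans hs), hv s' le_rfl⟩, fun ⟨h1, h2⟩ v hv => ?_⟩
  rcases le_total v s with hvs | hvs
  · exact h1 v hvs
  · have a1 : N s ω ≤ N v ω := h.mono_left hvs
    have a2 : N v ω ≤ N s' ω := h.mono_left hv
    have a3 : M s ω ≤ M v ω := h.mono_right hvs
    have a4 : M v ω ≤ M s' ω := h.mono_right hv
    rcases (show (N v ω = N s ω ∧ M v ω = M s ω) ∨ (N v ω = N s' ω ∧ M v ω = M s' ω) by omega)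
      with ⟨e1, e2⟩ | ⟨e1, e2⟩
    · have := h1 s le_rfl
      rw [surplus] at this ⊢
      rwa [e1, e2]
    · rw [surplus] at h2 ⊢
      rwa [e1, e2]

lemma level_succ_left (i j : ℕ) (ω : Ω) : level W B u (i + 1) j ω = level W B u i j ω + B i ω := by
  rw [level, level, Finset.sum_range_succ]
  ring

lemma level_succ_right (i j : ℕ) (ω : Ω) :
    level W B u i (j + 1) ω = level W B u i j ω - W j ω := by
  rw [level, level, Finset.sum_range_succ]
  ring

/-- A bound for the capital after at most `m` events. -/
def envelope (W B : ℕ → Ω → ℝ) (u : ℝ) (m : ℕ) (ω : Ω) : ℝ :=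
  |u| + ∑ k ∈ Finset.range m, |W k ω| + ∑ k ∈ Finset.range m, |B k ω|

lemma abs_level_le {i j m : ℕ} (hi : i ≤ m) (hj : j ≤ m) (ω : Ω) :
    |level W B u i j ω| ≤ envelope W B u m ω := by
  have h1 : |∑ k ∈ Finset.range j, W k ω| ≤ ∑ k ∈ Finset.range m, |W k ω| :=
    (Finset.abs_sum_le_sum_abs _ _).trans (Finset.sum_le_sum_of_subset_of_nonneg
      (Finset.range_mono hj) fun _ _ _ => abs_nonneg _)
  have h2 : |∑ k ∈ Finset.range i, B k ω| ≤ ∑ k ∈ Finset.range m, |B k ω| :=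
    (Finset.abs_sum_le_sum_abs _ _).trans (Finset.sum_le_sum_of_subset_of_nonneg
      (Finset.range_mono hi) fun _ _ _ => abs_nonneg _)
  rw [level, envelope]
  have h3 := abs_add_le (u - ∑ k ∈ Finset.range j, W k ω) (∑ k ∈ Finset.range i, B k ω)
  have h4 := abs_sub u (∑ k ∈ Finset.range j, W k ω)
  linarith

lemma envelope_nonneg (m : ℕ) (ω : Ω) : 0 ≤ envelope W B u m ω := by
  rw [envelope]; positivity

/-- The `0`-`1` variable of the event that `X` takes the value `a`. -/
def eqInd (𝕜 : Type*) [Zero 𝕜] [One 𝕜] (X : Ω → ℕ) (a : ℕ) (ω : Ω) : 𝕜 :=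
  if X ω = a then 1 else 0

/-- Up to an event of two or more jumps, the change over `[s, s']` is governed by a single jump. -/
lemma RegularPath.norm_step_le {ω : Ω} (h : RegularPath N M ω) {f : ℝ → ℂ} {C : ℝ} (hC0 : 0 ≤ C)
    (hC : ∀ x, ‖f x‖ ≤ C * (1 + |x|)) (m : ℕ) {s s' : ℝ≥0} (hs : s ≤ s') :
    ‖survivalSum N M W B u (fun i j ω => f (level W B u i j ω)) m s' ω -
      survivalSum N M W B u (fun i j ω => f (level W B u i j ω)) m s ω *
        eqInd ℂ (fun ω => N s' ω - N s ω) 0 ω * eqInd ℂ (fun ω => M s' ω - M s ω) 0 ω -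
      survivalSumPrev N M W B u
        (fun i j ω => (Set.Ici 0).indicator f (level W B u i j ω + B i ω)) m s ω *
        eqInd ℂ (fun ω => N s' ω - N s ω) 1 ω * eqInd ℂ (fun ω => M s' ω - M s ω) 0 ω -
      survivalSumPrev N M W B u
        (fun i j ω => (Set.Ici 0).indicator f (level W B u i j ω - W j ω)) m s ω *
        eqInd ℂ (fun ω => N s' ω - N s ω) 0 ω * eqInd ℂ (fun ω => M s' ω - M s ω) 1 ω‖ ≤
    C * (1 + envelope W B u m ω) -
      C * (1 + envelope W B u m ω) *
        eqInd ℝ (fun ω => N s' ω - N s ω) 0 ω * eqInd ℝ (fun ω => M s' ω - M s ω) 0 ω -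
      C * (1 + envelope W B u m ω) *
        eqInd ℝ (fun ω => N s' ω - N s ω) 1 ω * eqInd ℝ (fun ω => M s' ω - M s ω) 0 ω -
      C * (1 + envelope W B u m ω) *
        eqInd ℝ (fun ω => N s' ω - N s ω) 0 ω * eqInd ℝ (fun ω => M s' ω - M s ω) 1 ω := by
  classical
  rw [h.survivalSum_eq, h.survivalSum_eq, h.survivalSumPrev_eq, h.survivalSumPrev_eq]
  have hN : N s ω ≤ N s' ω := h.mono_left hs
  have hM : M s ω ≤ M s' ω := h.mono_right hs
  simp only [eqInd]
  -- With at most one jump the right side is 0, so the comparison must be an identity. The cases are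
  -- no jump, one reward and one payment.
  by_cases h00 : N s' ω - N s ω = 0 ∧ M s' ω - M s ω = 0
  · have e1 : N s' ω = N s ω := by omega
    have e2 : M s' ω = M s ω := by omega
    have e3 := h.survives_iff (W := W) (B := B) (u := u) hs (by omega)
    have e4 : surplus N M W B u s' ω = surplus N M W B u s ω := by rw [surplus, e1, e2, surplus]
    have e5 : (∀ v ≤ s', 0 ≤ surplus N M W B u v ω) ↔ ∀ v ≤ s, 0 ≤ surplus N M W B u v ω := by
      rw [e3, e4]
      exact ⟨fun h => h.1, fun h => ⟨h, h s le_rfl⟩⟩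
    simp only [e5, e1, e2]
    simp
  by_cases h10 : N s' ω - N s ω = 1 ∧ M s' ω - M s ω = 0
  · have e1 : N s' ω = N s ω + 1 := by omega
    have e2 : M s' ω = M s ω := by omega
    have e3 := h.survives_iff (W := W) (B := B) (u := u) hs (by omega)
    have e4 : surplus N M W B u s' ω = level W B u (N s ω) (M s ω) ω + B (N s ω) ω := by
      rw [← level_succ_left, ← e1, ← e2]; rfl
    simp only [e3, e4, e1, e2, level_succ_left]
    by_cases hx : 0 ≤ level W B u (N s ω) (M s ω) ω + B (N s ω) ω
    · simp [hx, add_right_comm]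
    · simp [hx]
  by_cases h01 : N s' ω - N s ω = 0 ∧ M s' ω - M s ω = 1
  · have e1 : N s' ω = N s ω := by omega
    have e2 : M s' ω = M s ω + 1 := by omega
    have e3 := h.survives_iff (W := W) (B := B) (u := u) hs (by omega)
    have e4 : surplus N M W B u s' ω = level W B u (N s ω) (M s ω) ω - W (M s ω) ω := by
      rw [← level_succ_right, ← e1, ← e2]; rfl
    simp only [e3, e4, e1, e2, level_succ_right]
    by_cases hx : 0 ≤ level W B u (N s ω) (M s ω) ω - W (M s ω) ω
    · simp [hx, ← add_assoc]
    · have : ¬ W (M s ω) ω ≤ level W B u (N s ω) (M s ω) ω := by simpa using hx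
      simp [this]
  -- With two or more jumps all indicator products vanish, and only the bound on the value at s'
  -- remains.
  · have z00 : ∀ (𝕜 : Type) [RCLike 𝕜] (x : 𝕜), x * (if N s' ω - N s ω = 0 then 1 else 0) *
        (if M s' ω - M s ω = 0 then 1 else 0) = 0 := fun 𝕜 _ x => by
      split_ifs with a b <;> simp_all
    have z10 : ∀ (𝕜 : Type) [RCLike 𝕜] (x : 𝕜), x * (if N s' ω - N s ω = 1 then 1 else 0) *
        (if M s' ω - M s ω = 0 then 1 else 0) = 0 := fun 𝕜 _ x => by
      split_ifs with a b <;> simp_all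
    have z01 : ∀ (𝕜 : Type) [RCLike 𝕜] (x : 𝕜), x * (if N s' ω - N s ω = 0 then 1 else 0) *
        (if M s' ω - M s ω = 1 then 1 else 0) = 0 := fun 𝕜 _ x => by
      split_ifs with a b <;> simp_all
    rw [z00 ℂ, z10 ℂ, z01 ℂ, z00 ℝ, z10 ℝ, z01 ℝ]
    simp only [sub_zero]
    split_ifs with hc
    · refine (hC _).trans ?_
      have := abs_level_le (W := W) (B := B) (u := u) (i := N s' ω) (j := M s' ω) (m := m)
        (by omega) (by omega) ω
      gcongr
    · rw [norm_zero]
      have := envelope_nonneg (W := W) (B := B) (u := u) m ω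
      positivity

end Functional

/-! ### The jump operator on functions of linear growth. -/

section StepOperator

variable {lam mud : ℝ} {lawW lawB : Measure ℝ}

/-- The jump part of the generator, killed below `0`. -/
noncomputable def stepOp (lam mud : ℝ) (lawW lawB : Measure ℝ) (f : ℝ → ℂ) (x : ℝ) : ℂ :=
  lam * ∫ b, (Set.Ici 0).indicator f (x + b) ∂lawB +
    mud * ∫ w, (Set.Ici 0).indicator f (x - w) ∂lawW

lemma LinearGrowth.indicator {f : ℝ → ℂ} (hf : LinearGrowth f) :
    LinearGrowth ((Set.Ici 0).indicator f) := by
  obtain ⟨hm, C, hC0, hC⟩ := hf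
  refine ⟨hm.indicator measurableSet_Ici, C, hC0, fun x => ?_⟩
  exact (norm_indicator_le_norm_self _ _).trans (hC x)

lemma LinearGrowth.integrable_comp {f : ℝ → ℂ} (hf : LinearGrowth f) {E : Type*}
    [MeasurableSpace E] {ν : Measure E} [IsFiniteMeasure ν] {X : E → ℝ} (hX : Measurable X)
    (hint : Integrable X ν) : Integrable (fun x => f (X x)) ν := by
  obtain ⟨hm, C, hC0, hC⟩ := hf
  exact Integrable.mono' (((integrable_const (1 : ℝ)).add hint.abs).const_mul C)
    (hm.comp hX).aestronglyMeasurable (Eventually.of_forall fun x => hC _)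

lemma LinearGrowth.integrable_add [IsFiniteMeasure lawB] (hB : Integrable (fun b : ℝ => b) lawB)
    {f : ℝ → ℂ} (hf : LinearGrowth f) (x : ℝ) : Integrable (fun b => f (x + b)) lawB :=
  hf.integrable_comp (by fun_prop) ((integrable_const x).add hB)

lemma LinearGrowth.integrable_sub [IsFiniteMeasure lawW] (hW : Integrable (fun w : ℝ => w) lawW)
    {f : ℝ → ℂ} (hf : LinearGrowth f) (x : ℝ) : Integrable (fun w => f (x - w)) lawW :=
  hf.integrable_comp (by fun_prop) ((integrable_const x).sub hW)

lemma LinearGrowth.integral_shift {ν : Measure ℝ} [IsProbabilityMeasure ν]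
    (hν : Integrable (fun b : ℝ => b) ν) {f : ℝ → ℂ} (hf : LinearGrowth f) {σ : ℝ → ℝ → ℝ}
    (hσ : Measurable (Function.uncurry σ)) (hle : ∀ x b, |σ x b| ≤ |x| + |b|) :
    LinearGrowth fun x => ∫ b, f (σ x b) ∂ν := by
  obtain ⟨hm, C, hC0, hC⟩ := hf
  refine ⟨?_, C * (1 + ∫ b, |b| ∂ν), ?_, fun x => ?_⟩
  · have : StronglyMeasurable (Function.uncurry fun x b => f (σ x b)) :=
      (hm.comp hσ).stronglyMeasurable
    exact this.integral_prod_right.measurable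
  · have : 0 ≤ ∫ b, |b| ∂ν := integral_nonneg fun b => abs_nonneg b
    positivity
  · have hi : Integrable (fun b : ℝ => C * (1 + |x| + |b|)) ν :=
      ((integrable_const (1 + |x|)).add hν.abs).const_mul C
    have h1 : ‖∫ b, f (σ x b) ∂ν‖ ≤ ∫ b, C * (1 + |x| + |b|) ∂ν := by
      refine norm_integral_le_of_norm_le hi (Eventually.of_forall fun b => (hC _).trans ?_)
      have := hle x b
      refine mul_le_mul_of_nonneg_left ?_ hC0
      linarith
    refine h1.trans ?_
    rw [integral_const_mul, integral_add (integrable_const _) hν.abs, integral_const]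
    simp only [probReal_univ, one_smul]
    have h2 : 0 ≤ ∫ b, |b| ∂ν := integral_nonneg fun b => abs_nonneg b
    have h3 : 0 ≤ (∫ b, |b| ∂ν) * |x| := mul_nonneg h2 (abs_nonneg x)
    rw [mul_assoc]
    refine mul_le_mul_of_nonneg_left ?_ hC0
    linarith

lemma LinearGrowth.integral_add [IsProbabilityMeasure lawB]
    (hB : Integrable (fun b : ℝ => b) lawB) {f : ℝ → ℂ} (hf : LinearGrowth f) :
    LinearGrowth fun x => ∫ b, f (x + b) ∂lawB :=
  hf.integral_shift (σ := fun x b => x + b) hB (by fun_prop) abs_add_le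

lemma LinearGrowth.integral_sub [IsProbabilityMeasure lawW]
    (hW : Integrable (fun w : ℝ => w) lawW) {f : ℝ → ℂ} (hf : LinearGrowth f) :
    LinearGrowth fun x => ∫ w, f (x - w) ∂lawW :=
  hf.integral_shift (σ := fun x w => x - w) hW (by fun_prop) fun x w => abs_sub x w

lemma LinearGrowth.add {f g : ℝ → ℂ} (hf : LinearGrowth f) (hg : LinearGrowth g) :
    LinearGrowth fun x => f x + g x := by
  obtain ⟨hfm, C, hC0, hC⟩ := hf
  obtain ⟨hgm, D, hD0, hD⟩ := hg
  refine ⟨hfm.add hgm, C + D, by positivity, fun x => (norm_add_le _ _).trans ?_⟩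
  rw [add_mul]
  exact add_le_add (hC x) (hD x)

lemma LinearGrowth.const_mul {f : ℝ → ℂ} (hf : LinearGrowth f) (a : ℂ) :
    LinearGrowth fun x => a * f x := by
  obtain ⟨hfm, C, hC0, hC⟩ := hf
  refine ⟨hfm.const_mul a, ‖a‖ * C, by positivity, fun x => ?_⟩
  rw [norm_mul, mul_assoc]
  exact mul_le_mul_of_nonneg_left (hC x) (norm_nonneg a)

lemma LinearGrowth.stepOp [IsProbabilityMeasure lawW] [IsProbabilityMeasure lawB]
    (hW : Integrable (fun w : ℝ => w) lawW) (hB : Integrable (fun b : ℝ => b) lawB)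
    {f : ℝ → ℂ} (hf : LinearGrowth f) : LinearGrowth (stepOp lam mud lawW lawB f) :=
  ((hf.indicator.integral_add hB).const_mul _).add ((hf.indicator.integral_sub hW).const_mul _)

end StepOperator

/-! ### Factoring expectations by independence. -/

section Expectation

lemma measurable_indicator_prodMk {Ω : Type*} {m : MeasurableSpace Ω} {S : Set Ω} {ξ : Ω → ℝ}
    (hS : MeasurableSet S) (hξ : Measurable ξ) :
    Measurable fun ω => (S.indicator (fun _ => (1 : ℝ)) ω, ξ ω) :=
  (measurable_const.indicator hS).prodMk hξ

/-- This is conditioning on J: by independence the pair (data in J, Z) has a product law, and Fubini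
integrates Z out. -/
lemma integral_indicator_comp_of_indep {Ω : Type*} {J mΩ : MeasurableSpace Ω} {P : Measure Ω}
    [IsProbabilityMeasure P] (hJ : J ≤ mΩ) {Z : Ω → ℝ}
    (hZ : Measurable Z) (hind : Indep (MeasurableSpace.comap Z inferInstance) J P)
    {law : Measure ℝ} [IsProbabilityMeasure law] (hlaw : HasLaw Z law P) {S : Set Ω}
    (hS : MeasurableSet[J] S) {ξ : Ω → ℝ} (hξ : Measurable[J] ξ) {H : ℝ → ℝ → ℂ}
    (hH : Measurable (Function.uncurry H)) (hint : Integrable (fun ω => H (ξ ω) (Z ω)) P) :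
    ∫ ω, S.indicator (fun ω => H (ξ ω) (Z ω)) ω ∂P =
      ∫ ω, S.indicator (fun ω => ∫ z, H (ξ ω) z ∂law) ω ∂P := by
  -- Carrying the indicator of S as a second real coordinate turns the set integral into the
  -- integral of one function under the product law.
  set η : Ω → ℝ × ℝ := fun ω => (Set.indicator S (fun _ => (1 : ℝ)) ω, ξ ω) with hη
  have hηJ : Measurable[J] η :=
    measurable_indicator_prodMk hS hξ
  have hηm : Measurable η := hηJ.mono hJ le_rfl
  have hSm : MeasurableSet S := hJ _ hS
  have hind' : IndepFun η Z P := (IndepFun_iff_Indep _ _ _).mpr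
    (indep_mono hind.symm hηJ.comap_le le_rfl)
  have hmap := (indepFun_iff_map_prod_eq_prod_map_map hηm.aemeasurable hZ.aemeasurable).mp hind'
  rw [hlaw.map_eq] at hmap
  set G : (ℝ × ℝ) × ℝ → ℂ := fun q => (q.1.1 : ℂ) * H q.1.2 q.2 with hG
  have hGm : Measurable G := by
    refine Measurable.mul (by fun_prop) ?_
    exact hH.comp (by fun_prop : Measurable fun q : (ℝ × ℝ) × ℝ => (q.1.2, q.2))
  have e1 : ∀ ω, S.indicator (fun ω => H (ξ ω) (Z ω)) ω = G (η ω, Z ω) := by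
    intro ω
    by_cases hω : ω ∈ S
    · simp [hG, hη, hω]
    · simp [hG, hη, hω]
  have e2 : ∀ ω, S.indicator (fun ω => ∫ z, H (ξ ω) z ∂law) ω = ∫ z, G (η ω, z) ∂law := by
    intro ω
    by_cases hω : ω ∈ S
    · simp [hG, hη, hω]
    · simp [hG, hη, hω]
  have hGint : Integrable G ((P.map η).prod law) := by
    rw [← hmap, integrable_map_measure hGm.aestronglyMeasurable (hηm.prodMk hZ).aemeasurable]
    refine (hint.indicator hSm).congr (Eventually.of_forall fun ω => ?_)
    exact e1 ω
  simp only [e1, e2]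
  rw [← integral_map (φ := fun ω => (η ω, Z ω)) (hηm.prodMk hZ).aemeasurable
    hGm.aestronglyMeasurable, hmap, integral_prod _ hGint,
    integral_map hηm.aemeasurable]
  exact hGm.stronglyMeasurable.integral_prod_right'.aestronglyMeasurable

variable {Ω : Type*} {mΩ : MeasurableSpace Ω} {P : Measure Ω}
  {lam mud t : ℝ} {lawW lawB : Measure ℝ} {N M : ℝ≥0 → Ω → ℕ} {W B : ℕ → Ω → ℝ} {T : Ω → ℝ≥0}
  {u : ℝ}

lemma integral_eqInd {𝕜 : Type*} [RCLike 𝕜] {X : Ω → ℕ} {μ : Measure ℕ} (hX : Measurable X)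
    (hlaw : HasLaw X μ P) (a : ℕ) : ∫ ω, eqInd 𝕜 X a ω ∂P = (μ.real {a} : 𝕜) := by
  have h1 : (fun ω => eqInd 𝕜 X a ω) = (X ⁻¹' {a}).indicator fun _ => (1 : 𝕜) := by
    funext ω
    by_cases hx : X ω = a
    · rw [Set.indicator_of_mem (by simpa using hx)]; simp [eqInd, hx]
    · rw [Set.indicator_of_notMem (by simpa using hx)]; simp [eqInd, hx]
  rw [h1, integral_indicator_const _ (hX (measurableSet_singleton a)), ← hlaw.map_eq,
    map_measureReal_apply hX (measurableSet_singleton a), RCLike.real_smul_eq_coe_mul, mul_one]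

lemma measurable_eqInd {𝕜 : Type*} [RCLike 𝕜] {m : MeasurableSpace Ω} {X : Ω → ℕ}
    (hX : Measurable[m] X) (a : ℕ) : Measurable[m] (eqInd 𝕜 X a) :=
  (measurable_from_top (f := fun k : ℕ => if k = a then (1 : 𝕜) else 0)).comp hX

lemma integral_mul_of_indep {𝕜 : Type*} [RCLike 𝕜] {a b : MeasurableSpace Ω} (ha : a ≤ mΩ)
    (hb : b ≤ mΩ) (hab : Indep a b P) {X Y : Ω → 𝕜} (hX : Measurable[a] X)
    (hY : Measurable[b] Y) : ∫ ω, X ω * Y ω ∂P = (∫ ω, X ω ∂P) * ∫ ω, Y ω ∂P := by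
  have hXY : IndepFun X Y P := (IndepFun_iff_Indep _ _ _).mpr
    (indep_mono hab hX.comap_le hY.comap_le)
  exact hXY.integral_fun_mul_eq_mul_integral (hX.mono ha le_rfl).aestronglyMeasurable
    (hY.mono hb le_rfl).aestronglyMeasurable

/-- The increment of N is split off first, being independent of the past together with the increment
of M; then the increment of M is split off from the past. -/
lemma IsPoolModel.integral_mul_eqInd [IsProbabilityMeasure P] {𝕜 : Type*} [RCLike 𝕜]
    (h : IsPoolModel P lam mud t lawW lawB N M W B T) {s s' : ℝ≥0} (hs : s ≤ s') {ξ : Ω → 𝕜}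
    (hξ : Measurable[pastAndJumps N M W B s] ξ) (a b : ℕ) :
    ∫ ω, ξ ω * eqInd 𝕜 (fun ω => N s' ω - N s ω) a ω *
      eqInd 𝕜 (fun ω => M s' ω - M s ω) b ω ∂P =
    (∫ ω, ξ ω ∂P) * ((poissonMeasure (lam.toNNReal * (s' - s))).real {a} : 𝕜) *
      ((poissonMeasure (mud.toNNReal * (s' - s))).real {b} : 𝕜) := by
  have hX : Measurable fun ω => N s' ω - N s ω :=
    (h.poisson_N.measurable s').sub (h.poisson_N.measurable s)
  have hY : Measurable fun ω => M s' ω - M s ω :=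
    (h.poisson_M.measurable s').sub (h.poisson_M.measurable s)
  have hG := h.pastAndJumps_le s
  have h1 := integral_mul_of_indep (sup_le hG hY.comap_le) hX.comap_le
    (h.indep_increment_left hs).symm
    (X := fun ω => ξ ω * eqInd 𝕜 (fun ω => M s' ω - M s ω) b ω)
    (Y := eqInd 𝕜 (fun ω => N s' ω - N s ω) a)
    ((hξ.mono le_sup_left le_rfl).mul
      ((measurable_eqInd (comap_measurable _) b).mono le_sup_right le_rfl))
    (measurable_eqInd (comap_measurable _) a)
  have h2 := integral_mul_of_indep hG hY.comap_le
    (h.indep_increment_right hs).symm (X := ξ)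
    (Y := eqInd 𝕜 (fun ω => M s' ω - M s ω) b) hξ (measurable_eqInd (comap_measurable _) b)
  rw [← integral_eqInd hX (h.poisson_N.law_increments s s' hs) a,
    ← integral_eqInd hY (h.poisson_M.law_increments s s' hs) b]
  refine (integral_congr_ae (Eventually.of_forall fun ω => mul_right_comm _ _ _)).trans ?_
  rw [h1, h2]
  ring

lemma integrable_of_hasLaw {X : Ω → ℝ} {law : Measure ℝ} (hX : Measurable X)
    (hlaw : HasLaw X law P) (hint : Integrable (fun x : ℝ => x) law) : Integrable X P := by
  rw [← hlaw.map_eq, integrable_map_measure (by fun_prop) hX.aemeasurable] at hint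
  exact hint

lemma integrable_survivalSum {H : ℕ → ℕ → Ω → ℂ} (hH : ∀ i j, Integrable (H i j) P)
    (hN : ∀ s, Measurable (N s)) (hM : ∀ s, Measurable (M s)) (hW : ∀ k, Measurable (W k))
    (hB : ∀ k, Measurable (B k)) (m : ℕ) (s : ℝ≥0) :
    Integrable (survivalSum N M W B u H m s) P := by
  refine integrable_finsetSum _ fun p _ => (hH p.1 p.2).indicator ?_
  refine measurableSet_survivalSet (iSup_comap_le fun v => hN v) (iSup_comap_le fun v => hM v)
    (iSup_comap_le fun v => hW v) (iSup_comap_le fun v => hB v)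

lemma IsPoolModel.integrable_survivalSum (h : IsPoolModel P lam mud t lawW lawB N M W B T)
    {H : ℕ → ℕ → Ω → ℂ} (hH : ∀ i j, Integrable (H i j) P) (m : ℕ) (s : ℝ≥0) :
    Integrable (survivalSum N M W B u H m s) P :=
  MiningPool.integrable_survivalSum hH h.poisson_N.measurable h.poisson_M.measurable
    h.measurable_W h.measurable_B m s

lemma measurable_survivalSum {H : ℕ → ℕ → Ω → ℂ} {s : ℝ≥0}
    (hH : ∀ i j, Measurable[pastAndJumps N M W B s] (H i j)) (m : ℕ) :
    Measurable[pastAndJumps N M W B s] (survivalSum N M W B u H m s) := by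
  refine Finset.measurable_fun_sum _ fun p _ => (hH p.1 p.2).indicator ?_
  have hle := pastAndInit_le_pastAndJumps N M W B s p.1 p.2
  exact measurableSet_survivalSet ((le_sup_left.trans le_sup_left).trans le_sup_left |>.trans hle)
    ((le_sup_right.trans le_sup_left).trans le_sup_left |>.trans hle)
    (le_sup_right.trans le_sup_left |>.trans hle) (le_sup_right.trans hle)

end Expectation

/-! ### Recovering a primitive from a quadratic increment estimate. -/

section Increment

lemma hasDerivWithinAt_Ici_of_quadratic {w : ℝ → ℂ} {v : ℂ} {x b C : ℝ} (hx : x < b)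
    (hw : ∀ y, x ≤ y → y ≤ b → ‖w y - w x - (y - x) • v‖ ≤ C * (y - x) ^ 2) :
    HasDerivWithinAt w v (Set.Ici x) x := by
  rw [hasDerivWithinAt_iff_isLittleO]
  have h1 : (fun y => w y - w x - (y - x) • v) =O[𝓝[≥] x] fun y => (y - x) ^ 2 := by
    refine Asymptotics.IsBigO.of_bound C ?_
    filter_upwards [Icc_mem_nhdsGE hx] with y hy
    rw [Real.norm_of_nonneg (sq_nonneg _)]
    exact hw y hy.1 hy.2
  refine h1.trans_isLittleO ?_
  have h2 : Tendsto (fun y : ℝ => y - x) (𝓝[≥] x) (𝓝 0) := by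
    have : Tendsto (fun y : ℝ => y - x) (𝓝 x) (𝓝 (x - x)) := tendsto_id.sub_const x
    rw [sub_self] at this
    exact this.mono_left nhdsWithin_le_nhds
  simp only [sq]
  have h3 : (fun y : ℝ => y - x) =o[𝓝[≥] x] fun _ => (1 : ℝ) :=
    (Asymptotics.isLittleO_one_iff ℝ).mpr h2
  simpa using h3.mul_isBigO (Asymptotics.isBigO_refl (fun y : ℝ => y - x) (𝓝[≥] x))

/-- A function whose increments are `v x * (y - x)` up to a quadratic error is the primitive of
`v`. -/
lemma eq_primitive_of_quadratic {w V v : ℝ → ℂ} {b C : ℝ} (hb : 0 ≤ b)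
    (hw : ∀ x y, 0 ≤ x → x ≤ y → y ≤ b → ‖w y - w x - (y - x) • v x‖ ≤ C * (y - x) ^ 2)
    (hV : ∀ x, HasDerivAt V (v x) x) (hv : Continuous v) (h0 : w 0 = V 0) : w b = V b := by
  obtain ⟨L, hL⟩ := (isCompact_Icc (a := 0) (b := b)).exists_bound_of_continuousOn hv.continuousOn
  -- The estimate looks forward from x and yields only a right derivative. Uniqueness from right
  -- derivatives also needs continuity, which this Lipschitz bound supplies.
  have hLip : ∀ x ∈ Set.Icc 0 b, ∀ y ∈ Set.Icc 0 b, x ≤ y →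
      ‖w y - w x‖ ≤ (|L| + |C| * b) * (y - x) := by
    intro x hx y hy hxy
    have h1 := hw x y hx.1 hxy hy.2
    have h2 : ‖(y - x) • v x‖ ≤ (y - x) * |L| := by
      rw [norm_smul, Real.norm_of_nonneg (by linarith)]
      exact mul_le_mul_of_nonneg_left ((hL x hx).trans (le_abs_self L)) (by linarith)
    have h3 := norm_add_le (w y - w x - (y - x) • v x) ((y - x) • v x)
    rw [sub_add_cancel] at h3
    have h4 : C * (y - x) ^ 2 ≤ |C| * b * (y - x) := by
      have : (y - x) ^ 2 ≤ b * (y - x) := by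
        rw [sq]
        exact mul_le_mul_of_nonneg_right (by linarith [hx.1, hy.2]) (by linarith)
      calc C * (y - x) ^ 2 ≤ |C| * (y - x) ^ 2 :=
            mul_le_mul_of_nonneg_right (le_abs_self C) (sq_nonneg _)
        _ ≤ |C| * (b * (y - x)) := mul_le_mul_of_nonneg_left this (abs_nonneg C)
        _ = |C| * b * (y - x) := by ring
    linarith
  have hcont : ContinuousOn w (Set.Icc 0 b) := by
    have : LipschitzOnWith (Real.toNNReal (|L| + |C| * b)) w (Set.Icc 0 b) := by
      refine LipschitzOnWith.of_dist_le_mul fun x hx y hy => ?_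
      rw [Real.coe_toNNReal _ (by positivity)]
      rcases le_total x y with hxy | hxy
      · rw [dist_comm, dist_comm x y, dist_eq_norm, Real.dist_eq,
          abs_of_nonneg (sub_nonneg.mpr hxy)]
        exact hLip x hx y hy hxy
      · rw [dist_eq_norm, Real.dist_eq, abs_of_nonneg (sub_nonneg.mpr hxy)]
        exact hLip y hy x hx hxy
    exact this.continuousOn
  exact eq_of_has_deriv_right_eq
    (fun x hx => hasDerivWithinAt_Ici_of_quadratic hx.2 fun y hxy hy => hw x y hx.1 hxy hy)
    (fun x _ => (hV x).hasDerivWithinAt) hcont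
    (fun x _ => (hV x).continuousAt.continuousWithinAt) h0 b (Set.right_mem_Icc.mpr hb)

end Increment

/-! ### Expectations with a fixed number of jumps. -/

section Evolution

variable {Ω : Type*} {mΩ : MeasurableSpace Ω} {P : Measure Ω}
  {lam mud t : ℝ} {lawW lawB : Measure ℝ}
  {N M : ℝ≥0 → Ω → ℕ} {W B : ℕ → Ω → ℝ} {T : Ω → ℝ≥0} {u : ℝ}

lemma IsPoolModel.integrable_level [IsProbabilityMeasure P]
    (h : IsPoolModel P lam mud t lawW lawB N M W B T)
    (hW : Integrable (fun w : ℝ => w) lawW) (hB : Integrable (fun b : ℝ => b) lawB) (i j : ℕ) :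
    Integrable (level W B u i j) P :=
  ((integrable_const u).sub (integrable_finsetSum _ fun k _ =>
    integrable_of_hasLaw (h.measurable_W k) (h.law_W k) hW)).add
    (integrable_finsetSum _ fun k _ => integrable_of_hasLaw (h.measurable_B k) (h.law_B k) hB)

lemma IsPoolModel.integrable_envelope [IsProbabilityMeasure P]
    (h : IsPoolModel P lam mud t lawW lawB N M W B T)
    (hW : Integrable (fun w : ℝ => w) lawW) (hB : Integrable (fun b : ℝ => b) lawB) (m : ℕ) :
    Integrable (envelope W B u m) P :=
  ((integrable_const |u|).add (integrable_finsetSum _ fun k _ =>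
    (integrable_of_hasLaw (h.measurable_W k) (h.law_W k) hW).abs)).add
    (integrable_finsetSum _ fun k _ =>
      (integrable_of_hasLaw (h.measurable_B k) (h.law_B k) hB).abs)

lemma measurable_level_pastAndInit (s : ℝ≥0) (i j : ℕ) :
    Measurable[pastAndInit N M W B s i j] (level W B u i j) :=
  measurable_level (le_sup_right.trans le_sup_left) le_sup_right

lemma measurable_level_pastAndJumps (s : ℝ≥0) (i j : ℕ) :
    Measurable[pastAndJumps N M W B s] (level W B u i j) :=
  (measurable_level_pastAndInit s i j).mono (pastAndInit_le_pastAndJumps N M W B s i j) le_rfl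

lemma IsPoolModel.measurable_level (h : IsPoolModel P lam mud t lawW lawB N M W B T) (i j : ℕ) :
    Measurable (level W B u i j) :=
  (measurable_level_pastAndJumps (N := N) (M := M) 0 i j).mono (h.pastAndJumps_le 0) le_rfl

lemma measurableSet_survivalSet_pastAndInit (s : ℝ≥0) (i j : ℕ) :
    MeasurableSet[pastAndInit N M W B s i j] (survivalSet N M W B u s i j) :=
  measurableSet_survivalSet ((le_sup_left.trans le_sup_left).trans le_sup_left)
    ((le_sup_right.trans le_sup_left).trans le_sup_left) (le_sup_right.trans le_sup_left)
    le_sup_right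

lemma IsPoolModel.measurableSet_survivalSet (h : IsPoolModel P lam mud t lawW lawB N M W B T)
    (s : ℝ≥0) (i j : ℕ) : MeasurableSet (survivalSet N M W B u s i j) :=
  h.pastAndJumps_le s _ (pastAndInit_le_pastAndJumps N M W B s i j _
    (measurableSet_survivalSet_pastAndInit s i j))

/-- `E[f(R_s); no ruin up to time s, m events up to time s]`. -/
noncomputable def expSurvival (P : Measure Ω) (N M : ℝ≥0 → Ω → ℕ) (W B : ℕ → Ω → ℝ) (u : ℝ)
    (f : ℝ → ℂ) (m : ℕ) (s : ℝ≥0) : ℂ :=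
  ∫ ω, survivalSum N M W B u (fun i j ω => f (level W B u i j ω)) m s ω ∂P

/-- `expSurvival` with one event less. -/
noncomputable def expSurvivalPrev (P : Measure Ω) (N M : ℝ≥0 → Ω → ℕ) (W B : ℕ → Ω → ℝ) (u : ℝ)
    (f : ℝ → ℂ) (m : ℕ) (s : ℝ≥0) : ℂ :=
  match m with
  | 0 => 0
  | m + 1 => expSurvival P N M W B u f m s

/-- On the event with i rewards so far, B_i is the first unused reward, so it is independent of the
event and of the level and may be averaged out. -/
lemma IsPoolModel.integral_survivalSum_reward [IsProbabilityMeasure P] [IsProbabilityMeasure lawB]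
    (h : IsPoolModel P lam mud t lawW lawB N M W B T)
    (hW : Integrable (fun w : ℝ => w) lawW) (hB : Integrable (fun b : ℝ => b) lawB) {f : ℝ → ℂ}
    (hf : LinearGrowth f) (m : ℕ) (s : ℝ≥0) :
    ∫ ω, survivalSum N M W B u (fun i j ω => f (level W B u i j ω + B i ω)) m s ω ∂P =
      expSurvival P N M W B u (fun x => ∫ b, f (x + b) ∂lawB) m s := by
  have hi : ∀ i j, Integrable (fun ω => f (level W B u i j ω + B i ω)) P := fun i j =>
    hf.integrable_comp ((h.measurable_level i j).add (h.measurable_B i))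
      ((h.integrable_level hW hB i j).add
        (integrable_of_hasLaw (h.measurable_B i) (h.law_B i) hB))
  have hi' : ∀ i j, Integrable (fun ω => ∫ b, f (level W B u i j ω + b) ∂lawB) P := fun i j =>
    (hf.integral_add hB).integrable_comp (h.measurable_level i j) (h.integrable_level hW hB i j)
  simp only [expSurvival, survivalSum]
  rw [integral_finsetSum _ fun p _ => (hi p.1 p.2).indicator (h.measurableSet_survivalSet s _ _),
    integral_finsetSum _ fun p _ => (hi' p.1 p.2).indicator (h.measurableSet_survivalSet s _ _)]
  refine Finset.sum_congr rfl fun p _ => ?_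
  refine integral_indicator_comp_of_indep (H := fun x b => f (x + b))
    ((pastAndInit_le_pastAndJumps N M W B s p.1 p.2).trans (h.pastAndJumps_le s))
    (h.measurable_B p.1) (h.indep_reward s p.1 p.2) (h.law_B p.1)
    (measurableSet_survivalSet_pastAndInit s p.1 p.2) (measurable_level_pastAndInit s p.1 p.2)
    (hf.1.comp (by fun_prop)) (hi p.1 p.2)

lemma IsPoolModel.integral_survivalSum_payment [IsProbabilityMeasure P] [IsProbabilityMeasure lawW]
    (h : IsPoolModel P lam mud t lawW lawB N M W B T)
    (hW : Integrable (fun w : ℝ => w) lawW) (hB : Integrable (fun b : ℝ => b) lawB) {f : ℝ → ℂ}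
    (hf : LinearGrowth f) (m : ℕ) (s : ℝ≥0) :
    ∫ ω, survivalSum N M W B u (fun i j ω => f (level W B u i j ω - W j ω)) m s ω ∂P =
      expSurvival P N M W B u (fun x => ∫ w, f (x - w) ∂lawW) m s := by
  have hi : ∀ i j, Integrable (fun ω => f (level W B u i j ω - W j ω)) P := fun i j =>
    hf.integrable_comp ((h.measurable_level i j).sub (h.measurable_W j))
      ((h.integrable_level hW hB i j).sub
        (integrable_of_hasLaw (h.measurable_W j) (h.law_W j) hW))
  have hi' : ∀ i j, Integrable (fun ω => ∫ w, f (level W B u i j ω - w) ∂lawW) P := fun i j =>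
    (hf.integral_sub hW).integrable_comp (h.measurable_level i j) (h.integrable_level hW hB i j)
  simp only [expSurvival, survivalSum]
  rw [integral_finsetSum _ fun p _ => (hi p.1 p.2).indicator (h.measurableSet_survivalSet s _ _),
    integral_finsetSum _ fun p _ => (hi' p.1 p.2).indicator (h.measurableSet_survivalSet s _ _)]
  refine Finset.sum_congr rfl fun p _ => ?_
  refine integral_indicator_comp_of_indep (H := fun x w => f (x - w))
    ((pastAndInit_le_pastAndJumps N M W B s p.1 p.2).trans (h.pastAndJumps_le s))
    (h.measurable_W p.2) (h.indep_payment s p.1 p.2) (h.law_W p.2)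
    (measurableSet_survivalSet_pastAndInit s p.1 p.2) (measurable_level_pastAndInit s p.1 p.2)
    (hf.1.comp (by fun_prop)) (hi p.1 p.2)

lemma IsPoolModel.expSurvival_linear [IsProbabilityMeasure P]
    (h : IsPoolModel P lam mud t lawW lawB N M W B T)
    (hW : Integrable (fun w : ℝ => w) lawW) (hB : Integrable (fun b : ℝ => b) lawB) {f g : ℝ → ℂ}
    (hf : LinearGrowth f) (hg : LinearGrowth g) (a b : ℂ) (m : ℕ) (s : ℝ≥0) :
    expSurvival P N M W B u (fun x => a * f x + b * g x) m s =
      a * expSurvival P N M W B u f m s + b * expSurvival P N M W B u g m s := by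
  have hi : ∀ {f : ℝ → ℂ}, LinearGrowth f → Integrable
      (survivalSum N M W B u (fun i j ω => f (level W B u i j ω)) m s) P := fun {f} hf =>
    h.integrable_survivalSum (fun i j => hf.integrable_comp (h.measurable_level i j)
      (h.integrable_level hW hB i j)) m s
  simp only [expSurvival]
  rw [← integral_const_mul, ← integral_const_mul,
    ← integral_add ((hi hf).const_mul a) ((hi hg).const_mul b)]
  refine integral_congr_ae (Eventually.of_forall fun ω => ?_)
  simp only [survivalSum, Finset.mul_sum, ← Finset.sum_add_distrib]
  refine Finset.sum_congr rfl fun p _ => ?_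
  by_cases hω : ω ∈ survivalSet N M W B u s p.1 p.2
  · simp only [Set.indicator_of_mem hω]
  · simp only [Set.indicator_of_notMem hω, mul_zero, add_zero]

/-- This identifies the single-jump terms of the pathwise comparison with the jump operator,
weighted by the two intensities. -/
lemma IsPoolModel.expSurvivalPrev_stepOp [IsProbabilityMeasure P] [IsProbabilityMeasure lawW]
    [IsProbabilityMeasure lawB] (h : IsPoolModel P lam mud t lawW lawB N M W B T)
    (hW : Integrable (fun w : ℝ => w) lawW) (hB : Integrable (fun b : ℝ => b) lawB) {f : ℝ → ℂ}
    (hf : LinearGrowth f) (m : ℕ) (s : ℝ≥0) :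
    expSurvivalPrev P N M W B u (stepOp lam mud lawW lawB f) m s =
      lam * ∫ ω, survivalSumPrev N M W B u
        (fun i j ω => (Set.Ici 0).indicator f (level W B u i j ω + B i ω)) m s ω ∂P +
      mud * ∫ ω, survivalSumPrev N M W B u
        (fun i j ω => (Set.Ici 0).indicator f (level W B u i j ω - W j ω)) m s ω ∂P := by
  cases m with
  | zero => simp [expSurvivalPrev, survivalSumPrev]
  | succ m =>
    simp only [expSurvivalPrev, survivalSumPrev]
    rw [h.integral_survivalSum_reward hW hB hf.indicator,
      h.integral_survivalSum_payment hW hB hf.indicator,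
      ← h.expSurvival_linear hW hB (hf.indicator.integral_add hB) (hf.indicator.integral_sub hW)]
    rfl

end Evolution

/-! ### The one-step estimate in expectation. -/

section ClosedForm

variable {Ω : Type*} {mΩ : MeasurableSpace Ω} {P : Measure Ω}
  {lam mud t : ℝ} {lawW lawB : Measure ℝ}
  {N M : ℝ≥0 → Ω → ℕ} {W B : ℕ → Ω → ℝ} {T : Ω → ℝ≥0} {u : ℝ}

lemma norm_eqInd_le {𝕜 : Type*} [RCLike 𝕜] (X : Ω → ℕ) (a : ℕ) (ω : Ω) : ‖eqInd 𝕜 X a ω‖ ≤ 1 := by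
  rw [eqInd]
  split_ifs <;> simp

lemma integrable_mul_eqInd {𝕜 : Type*} [RCLike 𝕜] {ξ : Ω → 𝕜} (hξ : Integrable ξ P) {X Y : Ω → ℕ}
    (hX : Measurable X) (hY : Measurable Y) (a b : ℕ) :
    Integrable (fun ω => ξ ω * eqInd 𝕜 X a ω * eqInd 𝕜 Y b ω) P := by
  refine Integrable.mono' hξ.norm ((hξ.aestronglyMeasurable.mul
    (measurable_eqInd hX a).aestronglyMeasurable).mul
    (measurable_eqInd hY b).aestronglyMeasurable) (Eventually.of_forall fun ω => ?_)
  rw [norm_mul, norm_mul]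
  exact (mul_le_of_le_one_right (by positivity) (norm_eqInd_le Y b ω)).trans
    (mul_le_of_le_one_right (by positivity) (norm_eqInd_le X a ω))

lemma measurable_envelope (s : ℝ≥0) (m : ℕ) :
    Measurable[pastAndJumps N M W B s] (envelope W B u m) := by
  have h1 : ∀ k, Measurable[pastAndJumps N M W B s] (W k) := fun k =>
    (measurable_seqSigma W k).mono (le_sup_right.trans le_sup_left) le_rfl
  have h2 : ∀ k, Measurable[pastAndJumps N M W B s] (B k) := fun k =>
    (measurable_seqSigma B k).mono le_sup_right le_rfl
  refine (measurable_const.add (Finset.measurable_fun_sum _ fun k _ => ?_)).add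
    (Finset.measurable_fun_sum _ fun k _ => ?_)
  · exact measurable_norm.comp (h1 k)
  · exact measurable_norm.comp (h2 k)

lemma measurable_jump_pastAndJumps (s : ℝ≥0) (k : ℕ) :
    Measurable[pastAndJumps N M W B s] (W k) ∧ Measurable[pastAndJumps N M W B s] (B k) :=
  ⟨(measurable_seqSigma W k).mono (le_sup_right.trans le_sup_left) le_rfl,
    (measurable_seqSigma B k).mono le_sup_right le_rfl⟩

lemma poissonMeasure_real_increment {rate : ℝ} (hr : 0 ≤ rate) {s s' : ℝ≥0} (hs : s ≤ s') :
    (poissonMeasure (rate.toNNReal * (s' - s))).real {0} = Real.exp (-(rate * (s' - s))) ∧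
    (poissonMeasure (rate.toNNReal * (s' - s))).real {1} =
      Real.exp (-(rate * (s' - s))) * (rate * (s' - s)) := by
  rw [poissonMeasure_real_singleton, poissonMeasure_real_singleton]
  simp [NNReal.coe_sub hs, Real.coe_toNNReal _ hr]

/-- The left side is the probability of at least two jumps for a Poisson variable of mean x; since
e^{-x} ≥ 1 - x, it is at most 1 - (1 - x)(1 + x). -/
lemma one_sub_exp_mul_le {x : ℝ} (hx : 0 ≤ x) : 1 - Real.exp (-x) * (1 + x) ≤ x ^ 2 := by
  have h1 := Real.add_one_le_exp (-x)
  nlinarith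

lemma integrable_sub_sub_sub {E : Type*} [NormedAddCommGroup E] {a b c d : Ω → E}
    (ha : Integrable a P) (hb : Integrable b P) (hc : Integrable c P) (hd : Integrable d P) :
    Integrable (fun ω => a ω - b ω - c ω - d ω) P :=
  ((ha.sub hb).sub hc).sub hd

lemma integral_sub_sub_sub {E : Type*} [NormedAddCommGroup E] [NormedSpace ℝ E]
    {a b c d : Ω → E}
    (ha : Integrable a P) (hb : Integrable b P) (hc : Integrable c P) (hd : Integrable d P) :
    ∫ ω, a ω - b ω - c ω - d ω ∂P =
      ∫ ω, a ω ∂P - ∫ ω, b ω ∂P - ∫ ω, c ω ∂P - ∫ ω, d ω ∂P := by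
  have h1 : Integrable (fun ω => a ω - b ω) P := ha.sub hb
  have h2 : Integrable (fun ω => a ω - b ω - c ω) P := h1.sub hc
  rw [integral_sub h2 hd, integral_sub h1 hc, integral_sub ha hb]

/-- The one-step estimate for the evolution of `expSurvival` in time. -/
theorem IsPoolModel.norm_expSurvival_step [IsProbabilityMeasure P] [IsProbabilityMeasure lawW]
    [IsProbabilityMeasure lawB] (h : IsPoolModel P lam mud t lawW lawB N M W B T)
    (hlam : 0 ≤ lam) (hmud : 0 ≤ mud)
    (hW : Integrable (fun w : ℝ => w) lawW) (hB : Integrable (fun b : ℝ => b) lawB) {f : ℝ → ℂ}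
    (hf : LinearGrowth f) (m : ℕ) :
    ∃ D, 0 ≤ D ∧ ∀ s s' : ℝ≥0, s ≤ s' →
      ‖expSurvival P N M W B u f m s' -
        Real.exp (-((lam + mud) * (s' - s))) * expSurvival P N M W B u f m s -
        Real.exp (-((lam + mud) * (s' - s))) * (s' - s : ℝ) *
          expSurvivalPrev P N M W B u (stepOp lam mud lawW lawB f) m s‖ ≤
      D * ((lam + mud) * (s' - s)) ^ 2 := by
  obtain ⟨-, C, hC0, hC⟩ := id hf
  have henv : Integrable (fun ω => C * (1 + envelope W B u m ω)) P :=
    ((integrable_const 1).add (h.integrable_envelope hW hB m)).const_mul C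
  have hD0 : 0 ≤ ∫ ω, C * (1 + envelope W B u m ω) ∂P := integral_nonneg fun ω => by
    have := envelope_nonneg (W := W) (B := B) (u := u) m ω
    positivity
  refine ⟨∫ ω, C * (1 + envelope W B u m ω) ∂P, hD0, fun s s' hs => ?_⟩
  set ν := lam + mud with hν
  set D := ∫ ω, C * (1 + envelope W B u m ω) ∂P with hD
  have hX : Measurable fun ω => N s' ω - N s ω :=
    (h.poisson_N.measurable s').sub (h.poisson_N.measurable s)
  have hY : Measurable fun ω => M s' ω - M s ω :=
    (h.poisson_M.measurable s').sub (h.poisson_M.measurable s)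
  have hlevel := fun i j => h.integrable_level (u := u) hW hB i j
  have hBi := fun i => integrable_of_hasLaw (h.measurable_B i) (h.law_B i) hB
  have hWi := fun j => integrable_of_hasLaw (h.measurable_W j) (h.law_W j) hW
  have iF : ∀ s, Integrable (survivalSum N M W B u (fun i j ω => f (level W B u i j ω)) m s) P :=
    fun s => h.integrable_survivalSum
      (fun i j => hf.integrable_comp (h.measurable_level i j) (hlevel i j)) m s
  have iFB : Integrable (survivalSumPrev N M W B u
      (fun i j ω => (Set.Ici 0).indicator f (level W B u i j ω + B i ω)) m s) P := by
    cases m with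
    | zero => exact integrable_zero _ _ _
    | succ m => exact h.integrable_survivalSum (fun i j => hf.indicator.integrable_comp
        ((h.measurable_level i j).add (h.measurable_B i)) ((hlevel i j).add (hBi i))) m s
  have iFW : Integrable (survivalSumPrev N M W B u
      (fun i j ω => (Set.Ici 0).indicator f (level W B u i j ω - W j ω)) m s) P := by
    cases m with
    | zero => exact integrable_zero _ _ _
    | succ m => exact h.integrable_survivalSum (fun i j => hf.indicator.integrable_comp
        ((h.measurable_level i j).sub (h.measurable_W j)) ((hlevel i j).sub (hWi j))) m s
  have mF : Measurable[pastAndJumps N M W B s]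
      (survivalSum N M W B u (fun i j ω => f (level W B u i j ω)) m s) :=
    measurable_survivalSum (fun i j => hf.1.comp (measurable_level_pastAndJumps s i j)) m
  have mFB : Measurable[pastAndJumps N M W B s] (survivalSumPrev N M W B u
      (fun i j ω => (Set.Ici 0).indicator f (level W B u i j ω + B i ω)) m s) := by
    cases m with
    | zero => exact measurable_const
    | succ m => exact measurable_survivalSum (fun i j => hf.indicator.1.comp
        ((measurable_level_pastAndJumps s i j).add (measurable_jump_pastAndJumps s i).2)) m
  have mFW : Measurable[pastAndJumps N M W B s] (survivalSumPrev N M W B u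
      (fun i j ω => (Set.Ici 0).indicator f (level W B u i j ω - W j ω)) m s) := by
    cases m with
    | zero => exact measurable_const
    | succ m => exact measurable_survivalSum (fun i j => hf.indicator.1.comp
        ((measurable_level_pastAndJumps s i j).sub (measurable_jump_pastAndJumps s j).1)) m
  have mE : Measurable[pastAndJumps N M W B s] fun ω => C * (1 + envelope W B u m ω) :=
    ((measurable_envelope s m).const_add 1).const_mul C
  have hae : ∀ᵐ ω ∂P, _ := (ae_regularPath h.poisson_N h.poisson_M).mono fun ω hω =>
    hω.norm_step_le (W := W) (B := B) (u := u) (f := f) hC0 hC m hs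
  have i1 := integrable_mul_eqInd (iF s) hX hY 0 0
  have i2 := integrable_mul_eqInd iFB hX hY 1 0
  have i3 := integrable_mul_eqInd iFW hX hY 0 1
  have j1 := integrable_mul_eqInd henv hX hY 0 0
  have j2 := integrable_mul_eqInd henv hX hY 1 0
  have j3 := integrable_mul_eqInd henv hX hY 0 1
  -- On the right the factored expectations leave E[envelope bound] times the probability of at
  -- least two jumps.
  have key := norm_integral_le_of_norm_le (integrable_sub_sub_sub henv j1 j2 j3) hae
  rw [integral_sub_sub_sub (iF s') i1 i2 i3, integral_sub_sub_sub henv j1 j2 j3,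
    h.integral_mul_eqInd hs mF, h.integral_mul_eqInd hs mFB, h.integral_mul_eqInd hs mFW,
    h.integral_mul_eqInd hs mE, h.integral_mul_eqInd hs mE, h.integral_mul_eqInd hs mE] at key
  rw [h.expSurvivalPrev_stepOp hW hB hf]
  obtain ⟨a0, a1⟩ := poissonMeasure_real_increment hlam hs
  obtain ⟨b0, b1⟩ := poissonMeasure_real_increment hmud hs
  rw [a0, a1, b0, b1] at key
  have hexp : Real.exp (-(ν * (s' - s))) =
      Real.exp (-(lam * (s' - s))) * Real.exp (-(mud * (s' - s))) := by
    rw [← Real.exp_add, hν]; ring_nf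
  have hδ : (0 : ℝ) ≤ s' - s := sub_nonneg.mpr (by exact_mod_cast hs)
  have hνδ : 0 ≤ ν * (s' - s : ℝ) := mul_nonneg (by positivity) hδ
  refine le_trans (le_of_eq ?_) (key.trans ?_)
  · congr 1
    rw [expSurvival, expSurvival, hexp]
    generalize Real.exp (-(lam * (s' - s))) = e1
    generalize Real.exp (-(mud * (s' - s))) = e2
    simp only [RCLike.ofReal_eq_complex_ofReal]
    push_cast
    ring
  · have := mul_le_mul_of_nonneg_left (one_sub_exp_mul_le hνδ) hD0
    rw [hexp] at this
    refine le_trans (le_of_eq ?_) this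
    simp
    rw [← hD, hν]
    ring

end ClosedForm

/-! ### Closed form at a deterministic time. -/

section ClosedFormInTime

variable {Ω : Type*} {mΩ : MeasurableSpace Ω} {P : Measure Ω}
  {lam mud t : ℝ} {lawW lawB : Measure ℝ}
  {N M : ℝ≥0 → Ω → ℕ} {W B : ℕ → Ω → ℝ} {T : Ω → ℝ≥0} {u : ℝ}

/-- The integrating factor e^{(λ+μ_d)s} removes the decay term, so the one-step estimate says that
increments are v(x)(y - x) up to a quadratic error. -/
lemma IsPoolModel.exp_mul_expSurvival_eq [IsProbabilityMeasure P] [IsProbabilityMeasure lawW]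
    [IsProbabilityMeasure lawB] (h : IsPoolModel P lam mud t lawW lawB N M W B T)
    (hlam : 0 ≤ lam) (hmud : 0 ≤ mud)
    (hW : Integrable (fun w : ℝ => w) lawW) (hB : Integrable (fun b : ℝ => b) lawB) {f : ℝ → ℂ}
    (hf : LinearGrowth f) (m : ℕ) {V v : ℝ → ℂ} (hV : ∀ x, HasDerivAt V (v x) x)
    (hv : Continuous v) (h0 : expSurvival P N M W B u f m 0 = V 0)
    (hprev : ∀ s : ℝ≥0, Real.exp ((lam + mud) * s) *
      expSurvivalPrev P N M W B u (stepOp lam mud lawW lawB f) m s = v s) (s : ℝ≥0) :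
    Real.exp ((lam + mud) * s) * expSurvival P N M W B u f m s = V s := by
  obtain ⟨D, hD0, hD⟩ := h.norm_expSurvival_step (u := u) hlam hmud hW hB hf m
  set ν := lam + mud with hν
  have hν0 : 0 ≤ ν := by positivity
  -- In the constant, D ν² is the one-step error and e^{νs} bounds the integrating factor e^{νy} on
  -- [0, s].
  have key := eq_primitive_of_quadratic
    (w := fun x => Real.exp (ν * x) * expSurvival P N M W B u f m x.toNNReal) (V := V) (v := v)
    (b := s) (C := Real.exp (ν * s) * (D * ν ^ 2)) s.2 ?_ hV hv ?_
  · simpa using key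
  · intro x y hx hxy hy
    have hy0 : 0 ≤ y := hx.trans hxy
    have h1 := hD x.toNNReal y.toNNReal (Real.toNNReal_le_toNNReal hxy)
    rw [Real.coe_toNNReal _ hx, Real.coe_toNNReal _ hy0] at h1
    have h2 := hprev x.toNNReal
    rw [Real.coe_toNNReal _ hx] at h2
    have e1 : Real.exp (ν * x) = Real.exp (ν * y) * Real.exp (-(ν * (y - x))) := by
      rw [← Real.exp_add]; ring_nf
    have e2 : (Real.exp (ν * y) : ℂ) * expSurvival P N M W B u f m y.toNNReal -
        Real.exp (ν * x) * expSurvival P N M W B u f m x.toNNReal - (y - x) • v x =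
        (Real.exp (ν * y) : ℂ) * (expSurvival P N M W B u f m y.toNNReal -
        Real.exp (-(ν * (y - x))) * expSurvival P N M W B u f m x.toNNReal -
        Real.exp (-(ν * (y - x))) * (y - x : ℝ) * expSurvivalPrev P N M W B u
          (stepOp lam mud lawW lawB f) m x.toNNReal) := by
      rw [← h2, Complex.real_smul, e1]
      push_cast
      ring
    simp only [e2]
    rw [norm_mul, Complex.norm_real, Real.norm_of_nonneg (Real.exp_pos _).le]
    calc Real.exp (ν * y) * _ ≤ Real.exp (ν * y) * (D * (ν * (y - x)) ^ 2) :=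
          mul_le_mul_of_nonneg_left h1 (Real.exp_pos _).le
      _ ≤ Real.exp (ν * s) * (D * (ν * (y - x)) ^ 2) := by
          refine mul_le_mul_of_nonneg_right ?_ (by positivity)
          exact Real.exp_le_exp.mpr (mul_le_mul_of_nonneg_left hy hν0)
      _ = Real.exp (ν * s) * (D * ν ^ 2) * (y - x) ^ 2 := by ring
  · simp [h0]

lemma IsPoolModel.expSurvival_zero (h : IsPoolModel P lam mud t lawW lawB N M W B T)
    [IsProbabilityMeasure P] (hu : 0 ≤ u) (f : ℝ → ℂ) (m : ℕ) :
    expSurvival P N M W B u f m 0 = if m = 0 then f u else 0 := by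
  have : ∀ᵐ ω ∂P, survivalSum N M W B u (fun i j ω => f (level W B u i j ω)) m 0 ω =
      if m = 0 then f u else 0 := by
    filter_upwards [ae_regularPath h.poisson_N h.poisson_M] with ω hω
    have hs : ∀ v ≤ (0 : ℝ≥0), 0 ≤ surplus N M W B u v ω := by
      intro v hv
      obtain rfl : v = 0 := le_antisymm hv zero_le
      rw [surplus, hω.zero_left, hω.zero_right]
      simpa using hu
    rw [hω.survivalSum_eq]
    by_cases hm : m = 0
    · rw [if_pos ⟨hs, by rw [hω.zero_left, hω.zero_right, hm]⟩, if_pos hm, hω.zero_left,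
        hω.zero_right]
      simp [level]
    · rw [if_neg, if_neg hm]
      rintro ⟨-, h0⟩
      rw [hω.zero_left, hω.zero_right] at h0
      exact hm h0.symm
  rw [expSurvival, integral_congr_ae this, integral_const]
  simp

/-- The `m`-event part of the expected value at time `s`, killed at ruin. -/
theorem IsPoolModel.expSurvival_eq [IsProbabilityMeasure P] [IsProbabilityMeasure lawW]
    [IsProbabilityMeasure lawB] (h : IsPoolModel P lam mud t lawW lawB N M W B T)
    (hlam : 0 ≤ lam) (hmud : 0 ≤ mud)
    (hW : Integrable (fun w : ℝ => w) lawW) (hB : Integrable (fun b : ℝ => b) lawB)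
    (hu : 0 ≤ u) (m : ℕ) : ∀ {f : ℝ → ℂ}, LinearGrowth f → ∀ s : ℝ≥0,
    expSurvival P N M W B u f m s =
      Real.exp (-((lam + mud) * s)) * (s : ℝ) ^ m / m.factorial *
        ((stepOp lam mud lawW lawB)^[m] f) u := by
  have hinv : ∀ s : ℝ≥0, ((Real.exp (-((lam + mud) * s)) : ℝ) : ℂ) *
      ((Real.exp ((lam + mud) * s) : ℝ) : ℂ) = 1 := fun s => by
    rw [← Complex.ofReal_mul, ← Real.exp_add]; simp
  induction m with
  | zero =>
    intro f hf s
    have h1 := h.exp_mul_expSurvival_eq (u := u) hlam hmud hW hB hf 0 (V := fun _ => f u)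
      (v := fun _ => 0) (fun x => hasDerivAt_const x _) continuous_const
      (by rw [h.expSurvival_zero hu, if_pos rfl]) (fun s => by simp [expSurvivalPrev]) s
    rw [Function.iterate_zero_apply, ← h1]
    linear_combination (-expSurvival P N M W B u f 0 s) * hinv s
  | succ m ih =>
    intro f hf s
    have hKf : LinearGrowth (stepOp lam mud lawW lawB f) := hf.stepOp hW hB
    set c := ((stepOp lam mud lawW lawB)^[m + 1] f) u with hc
    have hder : ∀ x : ℝ, HasDerivAt (fun x : ℝ => (x : ℂ) ^ (m + 1) / (m + 1).factorial * c)
        ((x : ℂ) ^ m / m.factorial * c) x := by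
      intro x
      have h1 : HasDerivAt (fun x : ℝ => (x : ℂ) ^ (m + 1)) ((m + 1 : ℕ) * (x : ℂ) ^ m * 1) x :=
        (Complex.ofRealCLM.hasDerivAt (x := x)).pow (m + 1)
      convert! (h1.div_const ((m + 1).factorial : ℂ)).mul_const c using 1
      rw [Nat.factorial_succ]
      have h2 : (m.factorial : ℂ) ≠ 0 := by exact_mod_cast m.factorial_ne_zero
      have h3 : ((m + 1 : ℕ) : ℂ) ≠ 0 := by exact_mod_cast m.succ_ne_zero
      push_cast at h3 ⊢
      field_simp
    have h1 := h.exp_mul_expSurvival_eq (u := u) hlam hmud hW hB hf (m + 1) hder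
      (by fun_prop) (by rw [h.expSurvival_zero hu]; simp) (fun s => ?_) s
    · have h2 : expSurvival P N M W B u f (m + 1) s =
          ((Real.exp (-((lam + mud) * s)) : ℝ) : ℂ) * (((Real.exp ((lam + mud) * s) : ℝ) : ℂ) *
          expSurvival P N M W B u f (m + 1) s) := by rw [← mul_assoc, hinv, one_mul]
      rw [h2, h1]
      ring
    -- The induction hypothesis is applied to `stepOp f`, which is why it is stated for all f of
    -- linear growth.
    · simp only [expSurvivalPrev]
      rw [ih hKf, ← Function.iterate_succ_apply, ← hc]
      linear_combination ((s : ℂ) ^ m / m.factorial * c) * hinv s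

end ClosedFormInTime

/-! ### Replacing a deterministic time by an independent random one. -/

section Horizon

variable {Ω : Type*} {mΩ : MeasurableSpace Ω} {P : Measure Ω}
  {lam mud t : ℝ} {lawW lawB : Measure ℝ}
  {N M : ℝ≥0 → Ω → ℕ} {W B : ℕ → Ω → ℝ} {T : Ω → ℝ≥0} {u : ℝ}

lemma RegularPath.eventually_survivalSum_eq {ω : Ω} (h : RegularPath N M ω)
    (H : ℕ → ℕ → Ω → ℂ) (m : ℕ) (s : ℝ≥0) :
    ∀ᶠ v in 𝓝[≥] s, survivalSum N M W B u H m v ω = survivalSum N M W B u H m s ω := by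
  classical
  filter_upwards [h.const_after s, self_mem_nhdsWithin] with v hv hsv
  have e3 := h.survives_iff (W := W) (B := B) (u := u) hsv (by omega)
  have e4 : surplus N M W B u v ω = surplus N M W B u s ω := by rw [surplus, hv.1, hv.2, surplus]
  have e5 : (∀ x ≤ v, 0 ≤ surplus N M W B u x ω) ↔ ∀ x ≤ s, 0 ≤ surplus N M W B u x ω := by
    rw [e3, e4]
    exact ⟨fun h => h.1, fun h => ⟨h, h s le_rfl⟩⟩
  rw [h.survivalSum_eq, h.survivalSum_eq]
  simp only [e5, hv.1, hv.2]

/-- The next point after `x` of the grid with mesh `1 / (k + 1)`. -/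
noncomputable def upperGrid (k : ℕ) (n : ℕ) : ℝ≥0 := (n + 1) / (k + 1)

/-- The grid point lies between x and x + 1/(k+1); approaching from the right is what
right-continuous paths require. -/
lemma tendsto_upperGrid (x : ℝ≥0) :
    Tendsto (fun k : ℕ => upperGrid k ⌊(k + 1) * x⌋₊) atTop (𝓝[≥] x) := by
  have hle : ∀ k : ℕ, x ≤ upperGrid k ⌊(k + 1) * x⌋₊ := fun k => by
    rw [upperGrid, le_div_iff₀ (by positivity), mul_comm]
    exact (Nat.lt_floor_add_one _).le
  refine tendsto_nhdsWithin_iff.mpr ⟨?_, Eventually.of_forall hle⟩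
  have h1 : Tendsto (fun k : ℕ => x + 1 / ((k : ℝ≥0) + 1)) atTop (𝓝 (x + 0)) := by
    refine tendsto_const_nhds.add ?_
    rw [← NNReal.tendsto_coe]
    simpa using tendsto_one_div_add_atTop_nhds_zero_nat (𝕜 := ℝ)
  rw [add_zero] at h1
  refine tendsto_of_tendsto_of_tendsto_of_le_of_le tendsto_const_nhds h1 hle fun k => ?_
  change ((⌊(k + 1) * x⌋₊ : ℝ≥0) + 1) / (k + 1) ≤ x + 1 / ((k : ℝ≥0) + 1)
  rw [add_div]
  gcongr
  rw [div_le_iff₀ (by positivity), mul_comm]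
  exact Nat.floor_le (zero_le)

lemma measurable_comp_index {κ : Ω → ℕ} (hκ : Measurable κ) {X : ℕ → Ω → ℂ}
    (hX : ∀ n, Measurable (X n)) : Measurable fun ω => X (κ ω) ω := by
  have : Measurable (Function.uncurry X) := measurable_from_prod_countable_right hX
  exact this.comp (hκ.prodMk measurable_id)

/-- Freezing an independent integer-valued index. -/
lemma integral_comp_index_of_indep [IsProbabilityMeasure P] {κ : Ω → ℕ} (hκ : Measurable κ)
    {X : ℕ → Ω → ℂ} (hX : ∀ n, Measurable (X n)) (hind : ∀ n, IndepFun κ (X n) P) {Z : Ω → ℝ}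
    (hZ : Integrable Z P) (hbd : ∀ n, ∀ᵐ ω ∂P, ‖X n ω‖ ≤ Z ω) :
    ∫ ω, X (κ ω) ω ∂P = ∫ ω, (∫ ω', X (κ ω) ω' ∂P) ∂P := by
  have hmeas : Measurable fun ω => X (κ ω) ω := measurable_comp_index hκ hX
  have hint : Integrable (fun ω => X (κ ω) ω) P := by
    refine Integrable.mono' hZ hmeas.aestronglyMeasurable ?_
    filter_upwards [ae_all_iff.mpr hbd] with ω hω using hω _
  have hint' : Integrable (fun ω => ∫ ω', X (κ ω) ω' ∂P) P := by
    refine Integrable.mono' (integrable_const (∫ ω, Z ω ∂P))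
      ((measurable_from_top (f := fun n => ∫ ω', X n ω' ∂P)).comp hκ).aestronglyMeasurable
      (Eventually.of_forall fun ω => norm_integral_le_of_norm_le hZ (hbd _))
  -- Both integrals are summed over the values of κ; on {κ = n} the index is constant and
  -- independence factors the integral.
  have hU : ⋃ n, κ ⁻¹' {n} = Set.univ := by
    ext ω; simp
  have hm : ∀ n, MeasurableSet (κ ⁻¹' {n}) := fun n => hκ (measurableSet_singleton n)
  have hdisj : Pairwise (Function.onFun Disjoint fun n => κ ⁻¹' {n}) := fun a b hab =>
    Disjoint.preimage _ (by simpa using hab)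
  have s1 := hasSum_integral_iUnion hm hdisj (hint.integrableOn (s := ⋃ n, κ ⁻¹' {n}))
  have s2 := hasSum_integral_iUnion hm hdisj (hint'.integrableOn (s := ⋃ n, κ ⁻¹' {n}))
  rw [hU, setIntegral_univ] at s1 s2
  have hterm : ∀ n, ∫ ω in κ ⁻¹' {n}, X (κ ω) ω ∂P =
      ∫ ω in κ ⁻¹' {n}, (∫ ω', X (κ ω) ω' ∂P) ∂P := fun n => by
    have e1 : ∫ ω in κ ⁻¹' {n}, X (κ ω) ω ∂P = ∫ ω in κ ⁻¹' {n}, X n ω ∂P :=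
      setIntegral_congr_fun (hm n) fun ω hω => by
        rw [show κ ω = n from hω]
    have e2 : ∫ ω in κ ⁻¹' {n}, (∫ ω', X (κ ω) ω' ∂P) ∂P =
        ∫ _ in κ ⁻¹' {n}, (∫ ω', X n ω' ∂P) ∂P :=
      setIntegral_congr_fun (hm n) fun ω hω => by
        rw [show κ ω = n from hω]
    rw [e1, e2, setIntegral_const, ← integral_indicator (hm n)]
    have h1 : (κ ⁻¹' {n}).indicator (X n) = fun ω => eqInd ℂ κ n ω * X n ω := by
      ext ω
      by_cases h : κ ω = n <;> simp [eqInd, h]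
    have h2 : IndepFun (eqInd ℂ κ n) (X n) P :=
      (hind n).comp (φ := fun k => if k = n then (1 : ℂ) else 0) measurable_from_top
        measurable_id
    have h3 : eqInd ℂ κ n = (κ ⁻¹' {n}).indicator fun _ => 1 := by
      ext ω
      by_cases h : κ ω = n <;> simp [eqInd, h]
    have h4 : AEStronglyMeasurable (eqInd ℂ κ n) P := by
      rw [h3]
      exact (measurable_const.indicator (hm n)).aestronglyMeasurable
    rw [h1, h2.integral_fun_mul_eq_mul_integral h4 (hX n).aestronglyMeasurable, h3,
      integral_indicator_const _ (hm n), Complex.real_smul, Complex.real_smul, mul_one]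
  simp only [hterm] at s1
  exact s1.unique s2

end Horizon

/-! ### A Gamma integral for the exponential horizon. -/

section Exponential

lemma integral_exp_mul_pow_expMeasure {r ν : ℝ} (hr : 0 < r) (hν : 0 ≤ ν) (m : ℕ) :
    ∫ x, ((Real.exp (-(ν * x)) * x ^ m / m.factorial : ℝ) : ℂ) ∂(expMeasure r) =
      r / (ν + r) ^ (m + 1) := by
  have hR : 0 < ν + r := by positivity
  rw [integral_complex_ofReal, expMeasure, gammaMeasure]
  have hg : gammaPDF 1 r = fun x => ENNReal.ofReal (gammaPDFReal 1 r x) := rfl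
  rw [hg, integral_withDensity_eq_integral_toReal_smul
    (measurable_gammaPDFReal 1 r).ennreal_ofReal (by simp)]
  simp only [ENNReal.toReal_ofReal (gammaPDFReal_nonneg one_pos hr _)]
  have h1 : ∀ x, gammaPDFReal 1 r x • (Real.exp (-(ν * x)) * x ^ m / m.factorial) =
      (Set.Ici (0 : ℝ)).indicator (fun x => r / m.factorial *
        (x ^ ((m + 1 : ℝ) - 1) * Real.exp (-((ν + r) * x)))) x := by
    intro x
    by_cases hx : 0 ≤ x
    · rw [Set.indicator_of_mem (show x ∈ Set.Ici (0 : ℝ) from hx), gammaPDFReal, if_pos hx,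
        add_sub_cancel_right, Real.rpow_natCast, add_mul, neg_add, Real.exp_add]
      simp
      ring
    · rw [Set.indicator_of_notMem (by simpa using hx), gammaPDFReal, if_neg hx, zero_smul]
  simp only [h1]
  rw [integral_indicator measurableSet_Ici, integral_Ici_eq_integral_Ioi, integral_const_mul,
    Real.integral_rpow_mul_exp_neg_mul_Ioi (by positivity) hR, Real.Gamma_nat_eq_factorial]
  have h2 : (1 / (ν + r)) ^ ((m : ℝ) + 1) = 1 / (ν + r) ^ (m + 1) := by
    rw [show (m : ℝ) + 1 = ((m + 1 : ℕ) : ℝ) by push_cast; ring, Real.rpow_natCast, one_div_pow]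
  rw [h2]
  have h3 : (m.factorial : ℝ) ≠ 0 := by exact_mod_cast m.factorial_ne_zero
  have : r / m.factorial * (1 / (ν + r) ^ (m + 1) * m.factorial) = r / (ν + r) ^ (m + 1) := by
    field_simp
  rw [this]
  push_cast
  ring

end Exponential

/-! ### Expectations at the exponential horizon. -/

section HorizonExpectation

variable {Ω : Type*} {mΩ : MeasurableSpace Ω} {P : Measure Ω}
  {lam mud t : ℝ} {lawW lawB : Measure ℝ}
  {N M : ℝ≥0 → Ω → ℕ} {W B : ℕ → Ω → ℝ} {T : Ω → ℝ≥0} {u : ℝ}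

/-- With m jumps in total at most m terms of each sequence are used. The bound does not depend on s,
so it dominates at random times as well. -/
lemma RegularPath.norm_survivalSum_le {ω : Ω} (h : RegularPath N M ω) {f : ℝ → ℂ} {C : ℝ}
    (hC0 : 0 ≤ C) (hC : ∀ x, ‖f x‖ ≤ C * (1 + |x|)) (m : ℕ) (s : ℝ≥0) :
    ‖survivalSum N M W B u (fun i j ω => f (level W B u i j ω)) m s ω‖ ≤
      C * (1 + envelope W B u m ω) := by
  classical
  rw [h.survivalSum_eq]
  split_ifs with hc
  · refine (hC _).trans ?_
    have := abs_level_le (W := W) (B := B) (u := u) (i := N s ω) (j := M s ω) (m := m)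
      (by omega) (by omega) ω
    gcongr
  · rw [norm_zero]
    have := envelope_nonneg (W := W) (B := B) (u := u) m ω
    positivity

lemma IsPoolModel.ae_regularPath (h : IsPoolModel P lam mud t lawW lawB N M W B T) :
    ∀ᵐ ω ∂P, RegularPath N M ω :=
  MiningPool.ae_regularPath h.poisson_N h.poisson_M

lemma measurable_gridIndex (T : Ω → ℝ≥0) (k : ℕ) :
    Measurable[MeasurableSpace.comap T inferInstance] fun ω => ⌊((k : ℝ≥0) + 1) * T ω⌋₊ :=
  Nat.measurable_floor.comp ((comap_measurable T).const_mul _)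

lemma IsPoolModel.ae_tendsto_survivalSum (h : IsPoolModel P lam mud t lawW lawB N M W B T)
    (H : ℕ → ℕ → Ω → ℂ) (m : ℕ) :
    ∀ᵐ ω ∂P, Tendsto (fun k : ℕ => survivalSum N M W B u H m
      (upperGrid k ⌊((k : ℝ≥0) + 1) * T ω⌋₊) ω) atTop (𝓝 (survivalSum N M W B u H m (T ω) ω)) := by
  filter_upwards [h.ae_regularPath] with ω hω
  exact tendsto_const_nhds.congr' (((tendsto_upperGrid (T ω)).eventually
    (hω.eventually_survivalSum_eq H m (T ω))).mono fun _ hk => hk.symm)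

lemma IsPoolModel.integrable_survivalSum_horizon [IsProbabilityMeasure P]
    (h : IsPoolModel P lam mud t lawW lawB N M W B T)
    (hW : Integrable (fun w : ℝ => w) lawW) (hB : Integrable (fun b : ℝ => b) lawB) {f : ℝ → ℂ}
    (hf : LinearGrowth f) (m : ℕ) :
    Integrable (fun ω => survivalSum N M W B u (fun i j ω => f (level W B u i j ω)) m (T ω) ω)
      P := by
  obtain ⟨C, hC0, hC⟩ := hf.2
  have hX : ∀ s, Measurable (survivalSum N M W B u (fun i j ω => f (level W B u i j ω)) m s) :=
    fun s => (measurable_survivalSum (fun i j =>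
      hf.1.comp (measurable_level_pastAndJumps s i j)) m).mono (h.pastAndJumps_le s) le_rfl
  refine Integrable.mono' (((integrable_const 1).add (h.integrable_envelope (u := u) hW hB m)).const_mul C)
    (aestronglyMeasurable_of_tendsto_ae atTop (fun k => ?_) (h.ae_tendsto_survivalSum _ m)) ?_
  · exact (measurable_comp_index ((measurable_gridIndex T k).mono
      h.measurable_T.comap_le le_rfl) (X := fun n => survivalSum N M W B u
        (fun i j ω => f (level W B u i j ω)) m (upperGrid k n))
      fun n => hX _).aestronglyMeasurable
  · filter_upwards [h.ae_regularPath] with ω hω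
    exact hω.norm_survivalSum_le hC0 hC m _

/-- The expectation at the exponential horizon, split according to the number of events. -/
theorem IsPoolModel.integral_survivalSum_horizon [IsProbabilityMeasure P]
    [IsProbabilityMeasure lawW] [IsProbabilityMeasure lawB]
    (h : IsPoolModel P lam mud t lawW lawB N M W B T)
    (hlam : 0 ≤ lam) (hmud : 0 ≤ mud) (ht : 0 < t)
    (hW : Integrable (fun w : ℝ => w) lawW) (hB : Integrable (fun b : ℝ => b) lawB)
    (hu : 0 ≤ u) {f : ℝ → ℂ} (hf : LinearGrowth f) (m : ℕ) :
    ∫ ω, survivalSum N M W B u (fun i j ω => f (level W B u i j ω)) m (T ω) ω ∂P =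
      (1 / t : ℝ) / ((lam + mud + 1 / t : ℝ) : ℂ) ^ (m + 1) *
        ((stepOp lam mud lawW lawB)^[m] f) u := by
  obtain ⟨C, hC0, hC⟩ := hf.2
  set F := survivalSum N M W B u (fun i j ω => f (level W B u i j ω)) m with hF
  have hXs : ∀ s, Measurable[pastAndJumps N M W B s] (F s) := fun s =>
    measurable_survivalSum (fun i j => hf.1.comp (measurable_level_pastAndJumps s i j)) m
  have hX : ∀ s, Measurable (F s) := fun s => (hXs s).mono (h.pastAndJumps_le s) le_rfl
  have hZ : Integrable (fun ω => C * (1 + envelope W B u m ω)) P :=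
    ((integrable_const 1).add (h.integrable_envelope (u := u) hW hB m)).const_mul C
  have hbd : ∀ᵐ ω ∂P, ∀ s, ‖F s ω‖ ≤ C * (1 + envelope W B u m ω) := by
    filter_upwards [h.ae_regularPath] with ω hω s using hω.norm_survivalSum_le hC0 hC m s
  have hκ : ∀ k : ℕ, Measurable fun ω => ⌊((k : ℝ≥0) + 1) * T ω⌋₊ := fun k =>
    (measurable_gridIndex T k).mono h.measurable_T.comap_le le_rfl
  -- For a grid time the index is integer-valued and can be frozen by a countable sum, so no joint
  -- measurability in time and ω is needed.
  have hfreeze : ∀ k : ℕ, ∫ ω, F (upperGrid k ⌊((k : ℝ≥0) + 1) * T ω⌋₊) ω ∂P =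
      ∫ ω, (∫ ω', F (upperGrid k ⌊((k : ℝ≥0) + 1) * T ω⌋₊) ω' ∂P) ∂P := fun k =>
    integral_comp_index_of_indep (hκ k) (X := fun n => F (upperGrid k n)) (fun n => hX _)
      (fun n => (IndepFun_iff_Indep _ _ _).mpr (indep_mono (h.indep_horizon (upperGrid k n))
        (measurable_gridIndex T k).comap_le (hXs _).comap_le)) hZ
      (fun n => hbd.mono fun ω hω => hω _)
  have lim1 : Tendsto (fun k : ℕ => ∫ ω, F (upperGrid k ⌊((k : ℝ≥0) + 1) * T ω⌋₊) ω ∂P) atTop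
      (𝓝 (∫ ω, F (T ω) ω ∂P)) := by
    refine tendsto_integral_of_dominated_convergence _ (fun k => ?_) hZ
      (fun k => hbd.mono fun ω hω => hω _) (h.ae_tendsto_survivalSum _ m)
    exact (measurable_comp_index (hκ k) (X := fun n => F (upperGrid k n))
      fun n => hX _).aestronglyMeasurable
  have hE : ∀ s, ∫ ω, F s ω ∂P = Real.exp (-((lam + mud) * s)) * (s : ℝ) ^ m / m.factorial *
      ((stepOp lam mud lawW lawB)^[m] f) u := fun s =>
    h.expSurvival_eq hlam hmud hW hB hu m hf s
  -- The closed form makes the frozen expectation continuous in time, so it too passes to the limit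
  -- along the grid.
  have hcont : Continuous fun s : ℝ≥0 => ∫ ω, F s ω ∂P := by
    simp only [hE]
    fun_prop
  have lim2 : Tendsto (fun k : ℕ => ∫ ω, (∫ ω', F (upperGrid k ⌊((k : ℝ≥0) + 1) * T ω⌋₊) ω' ∂P) ∂P)
      atTop (𝓝 (∫ ω, (∫ ω', F (T ω) ω' ∂P) ∂P)) := by
    refine tendsto_integral_of_dominated_convergence
      (fun _ => ∫ ω', C * (1 + envelope W B u m ω') ∂P) (fun k => ?_) (integrable_const _)
      (fun k => Eventually.of_forall fun ω =>
        norm_integral_le_of_norm_le hZ (hbd.mono fun ω' hω => hω _))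
      (Eventually.of_forall fun ω => ?_)
    · exact ((measurable_from_top (f := fun n => ∫ ω', F (upperGrid k n) ω' ∂P)).comp
        (hκ k)).aestronglyMeasurable
    · exact (hcont.tendsto (T ω)).comp
        ((tendsto_upperGrid (T ω)).mono_right nhdsWithin_le_nhds)
  simp only [hfreeze] at lim1
  rw [tendsto_nhds_unique lim1 lim2]
  simp only [hE]
  rw [integral_mul_const]
  congr 1
  have hm := h.law_T.integral_comp
    (f := fun x : ℝ => ((Real.exp (-((lam + mud) * x)) * x ^ m / m.factorial : ℝ) : ℂ))
    (by fun_prop)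
  rw [integral_exp_mul_pow_expMeasure (by positivity) (by positivity)] at hm
  rw [Complex.ofReal_add (lam + mud), ← hm]
  simp

end HorizonExpectation

/-! ### Contraction and the telescoped fixed-point equation. -/

section StepOperatorIteration

variable {lam mud : ℝ} {lawW lawB : Measure ℝ}

/-- Killing discards all values below 0, so equations need only hold on [0,∞). -/
lemma stepOp_congr {f g : ℝ → ℂ} (hfg : ∀ x, 0 ≤ x → f x = g x) :
    stepOp lam mud lawW lawB f = stepOp lam mud lawW lawB g := by
  have : (Set.Ici 0).indicator f = (Set.Ici 0).indicator g :=
    Set.indicator_congr fun x hx => hfg x hx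
  funext x
  rw [stepOp, stepOp, this]

lemma iterate_stepOp_congr {f g : ℝ → ℂ} (hfg : ∀ x, 0 ≤ x → f x = g x) (m : ℕ) {x : ℝ}
    (hx : 0 ≤ x) :
    ((stepOp lam mud lawW lawB)^[m] f) x = ((stepOp lam mud lawW lawB)^[m] g) x := by
  cases m with
  | zero => exact hfg x hx
  | succ m => rw [Function.iterate_succ_apply, Function.iterate_succ_apply, stepOp_congr hfg]

lemma stepOp_linear [IsProbabilityMeasure lawW] [IsProbabilityMeasure lawB]
    (hW : Integrable (fun w : ℝ => w) lawW) (hB : Integrable (fun b : ℝ => b) lawB)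
    {f g : ℝ → ℂ} (hf : LinearGrowth f) (hg : LinearGrowth g) (a b : ℂ) :
    stepOp lam mud lawW lawB (fun x => a * f x + b * g x) =
      fun x => a * stepOp lam mud lawW lawB f x + b * stepOp lam mud lawW lawB g x := by
  have hind : ∀ y, (Set.Ici 0).indicator (fun x => a * f x + b * g x) y =
      a * (Set.Ici 0).indicator f y + b * (Set.Ici 0).indicator g y := fun y => by
    by_cases hy : y ∈ Set.Ici (0 : ℝ)
    · simp only [Set.indicator_of_mem hy]
    · simp only [Set.indicator_of_notMem hy, mul_zero, add_zero]
  funext x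
  simp only [stepOp, hind]
  rw [MeasureTheory.integral_add ((hf.indicator.integrable_add hB x).const_mul a)
      ((hg.indicator.integrable_add hB x).const_mul b),
    MeasureTheory.integral_add ((hf.indicator.integrable_sub hW x).const_mul a)
      ((hg.indicator.integrable_sub hW x).const_mul b), integral_const_mul, integral_const_mul,
    integral_const_mul, integral_const_mul]
  ring

lemma LinearGrowth.iterate_stepOp [IsProbabilityMeasure lawW] [IsProbabilityMeasure lawB]
    (hW : Integrable (fun w : ℝ => w) lawW) (hB : Integrable (fun b : ℝ => b) lawB)
    {f : ℝ → ℂ} (hf : LinearGrowth f) (m : ℕ) :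
    LinearGrowth ((MiningPool.stepOp lam mud lawW lawB)^[m] f) := by
  induction m with
  | zero => exact hf
  | succ m ih => rw [Function.iterate_succ_apply']; exact ih.stepOp hW hB

lemma iterate_stepOp_linear [IsProbabilityMeasure lawW] [IsProbabilityMeasure lawB]
    (hW : Integrable (fun w : ℝ => w) lawW) (hB : Integrable (fun b : ℝ => b) lawB)
    {f g : ℝ → ℂ} (hf : LinearGrowth f) (hg : LinearGrowth g) (a b : ℂ) (m : ℕ) :
    (stepOp lam mud lawW lawB)^[m] (fun x => a * f x + b * g x) =
      fun x => a * ((stepOp lam mud lawW lawB)^[m] f) x +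
        b * ((stepOp lam mud lawW lawB)^[m] g) x := by
  induction m with
  | zero => rfl
  | succ m ih =>
    simp only [Function.iterate_succ_apply']
    rw [ih, stepOp_linear hW hB (hf.iterate_stepOp hW hB m) (hg.iterate_stepOp hW hB m)]

/-- On functions of linear growth, the norm of `stepOp` is arbitrarily close to `lam + mud`. -/
lemma norm_stepOp_le [IsProbabilityMeasure lawW] [IsProbabilityMeasure lawB]
    (hlam : 0 ≤ lam) (hmud : 0 ≤ mud)
    (hB : Integrable (fun b : ℝ => b) lawB) (hW0 : ∀ᵐ w ∂lawW, 0 < w) (hB0 : ∀ᵐ b ∂lawB, 0 < b)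
    {δ a₀ : ℝ} (ha₀ : 0 ≤ a₀) (hδ : 0 ≤ δ) (hδa : lam * ∫ b, b ∂lawB ≤ δ * a₀)
    {f : ℝ → ℂ} {C : ℝ} (hC0 : 0 ≤ C) (hC : ∀ x, 0 ≤ x → ‖f x‖ ≤ C * (x + a₀)) {x : ℝ}
    (hx : 0 ≤ x) :
    ‖stepOp lam mud lawW lawB f x‖ ≤ C * (lam + mud + δ) * (x + a₀) := by
  have h1 : ‖∫ b, (Set.Ici 0).indicator f (x + b) ∂lawB‖ ≤ ∫ b, C * (x + a₀ + b) ∂lawB := by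
    refine norm_integral_le_of_norm_le (((integrable_const _).add hB).const_mul C) ?_
    filter_upwards [hB0] with b hb
    rw [Set.indicator_of_mem (show x + b ∈ Set.Ici (0 : ℝ) by rw [Set.mem_Ici]; positivity)]
    refine (hC _ (by positivity)).trans (le_of_eq (by ring))
  have h2 : ‖∫ w, (Set.Ici 0).indicator f (x - w) ∂lawW‖ ≤ ∫ _, C * (x + a₀) ∂lawW := by
    refine norm_integral_le_of_norm_le (integrable_const _) ?_
    filter_upwards [hW0] with w hw
    by_cases hxw : x - w ∈ Set.Ici (0 : ℝ)
    · rw [Set.indicator_of_mem hxw]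
      refine (hC _ hxw).trans ?_
      gcongr
      linarith
    · rw [Set.indicator_of_notMem hxw, norm_zero]
      positivity
  rw [integral_const_mul, MeasureTheory.integral_add (integrable_const _) hB] at h1
  simp only [integral_const, probReal_univ, one_smul] at h1 h2
  rw [stepOp]
  refine (norm_add_le _ _).trans ?_
  rw [norm_mul, norm_mul, Complex.norm_real, Complex.norm_real, Real.norm_of_nonneg hlam,
    Real.norm_of_nonneg hmud]
  have h3 := mul_le_mul_of_nonneg_left h1 hlam
  have h4 := mul_le_mul_of_nonneg_left h2 hmud
  -- A payment only lowers x and costs nothing; the mean reward is absorbed by δ a₀.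
  have h5 := mul_le_mul_of_nonneg_left hδa hC0
  have h6 : 0 ≤ C * (δ * x) := by positivity
  linarith

lemma norm_iterate_stepOp_le [IsProbabilityMeasure lawW] [IsProbabilityMeasure lawB]
    (hlam : 0 ≤ lam) (hmud : 0 ≤ mud)
    (hB : Integrable (fun b : ℝ => b) lawB) (hW0 : ∀ᵐ w ∂lawW, 0 < w) (hB0 : ∀ᵐ b ∂lawB, 0 < b)
    {δ a₀ : ℝ} (ha₀ : 0 ≤ a₀) (hδ : 0 ≤ δ) (hδa : lam * ∫ b, b ∂lawB ≤ δ * a₀)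
    {f : ℝ → ℂ} {C : ℝ} (hC0 : 0 ≤ C) (hC : ∀ x, 0 ≤ x → ‖f x‖ ≤ C * (x + a₀)) (m : ℕ) :
    ∀ x, 0 ≤ x →
      ‖((stepOp lam mud lawW lawB)^[m] f) x‖ ≤ C * (lam + mud + δ) ^ m * (x + a₀) := by
  induction m with
  | zero => simpa using hC
  | succ m ih =>
    intro x hx
    rw [Function.iterate_succ_apply', pow_succ, ← mul_assoc]
    exact norm_stepOp_le hlam hmud hB hW0 hB0 ha₀ hδ hδa (by positivity) ih hx

/-- The discounted iterates of `stepOp` decay geometrically. -/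
lemma exists_norm_iterate_stepOp_div_le [IsProbabilityMeasure lawW] [IsProbabilityMeasure lawB]
    (hlam : 0 ≤ lam) (hmud : 0 ≤ mud)
    (hB : Integrable (fun b : ℝ => b) lawB) (hW0 : ∀ᵐ w ∂lawW, 0 < w) (hB0 : ∀ᵐ b ∂lawB, 0 < b)
    {q : ℝ} (hq : 0 < q) {f : ℝ → ℂ} (hf : LinearGrowth f) {x : ℝ} (hx : 0 ≤ x) :
    ∃ K ρ : ℝ, 0 ≤ ρ ∧ ρ < 1 ∧ ∀ m, ‖((stepOp lam mud lawW lawB)^[m] f) x /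
      ((lam + mud + q : ℝ) : ℂ) ^ m‖ ≤ K * ρ ^ m := by
  obtain ⟨C, hC0, hC⟩ := hf.2
  have hb : 0 ≤ ∫ b, b ∂lawB := integral_nonneg_of_ae (hB0.mono fun b hb => hb.le)
  -- With δ = q/2 this gives λ E[B] ≤ δ a₀, and the summand 1 gives 1 + x ≤ x + a₀. The choice q/2
  -- keeps the ratio below 1.
  set a₀ := 1 + lam * (∫ b, b ∂lawB) / (q / 2) with ha₀
  have ha1 : 0 ≤ lam * (∫ b, b ∂lawB) / (q / 2) := by positivity
  have hc : 0 < lam + mud + q := by positivity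
  refine ⟨C * (x + a₀), (lam + mud + q / 2) / (lam + mud + q), by positivity, ?_, fun m => ?_⟩
  · rw [div_lt_one hc]; linarith
  · have h1 := norm_iterate_stepOp_le (δ := q / 2) (a₀ := a₀) (f := f) hlam hmud hB hW0 hB0
      (by linarith) (by linarith) (by rw [ha₀]; field_simp; linarith) hC0 (fun y hy => by
        refine (hC y).trans ?_
        rw [abs_of_nonneg hy]
        exact mul_le_mul_of_nonneg_left (by linarith) hC0) m x hx
    rw [norm_div, norm_pow, Complex.norm_real, Real.norm_of_nonneg hc.le, div_pow,
      div_le_iff₀ (by positivity)]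
    refine h1.trans (le_of_eq ?_)
    field_simp

/-- Solving `c V = q id + stepOp V` by iteration. -/
lemma tendsto_sum_iterate_stepOp [IsProbabilityMeasure lawW] [IsProbabilityMeasure lawB]
    (hlam : 0 ≤ lam) (hmud : 0 ≤ mud)
    (hW : Integrable (fun w : ℝ => w) lawW) (hB : Integrable (fun b : ℝ => b) lawB)
    (hW0 : ∀ᵐ w ∂lawW, 0 < w) (hB0 : ∀ᵐ b ∂lawB, 0 < b)
    {q : ℝ} (hq : 0 < q) {f V : ℝ → ℂ} (hf : LinearGrowth f) (hV : LinearGrowth V)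
    (hstep : ∀ x, 0 ≤ x → ((lam + mud + q : ℝ) : ℂ) * V x =
      q * f x + stepOp lam mud lawW lawB V x) {x : ℝ} (hx : 0 ≤ x) :
    Tendsto (fun k => ∑ m ∈ Finset.range k, q / ((lam + mud + q : ℝ) : ℂ) ^ (m + 1) *
      ((stepOp lam mud lawW lawB)^[m] f) x) atTop (𝓝 (V x)) := by
  set c := lam + mud + q with hc
  have hc0 : (c : ℂ) ≠ 0 := by exact_mod_cast (by positivity : c ≠ 0)
  set L := stepOp lam mud lawW lawB with hL
  have hterm : ∀ m, (q : ℂ) / (c : ℂ) ^ (m + 1) * (L^[m] f) x =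
      (L^[m] V) x / (c : ℂ) ^ m - (L^[m + 1] V) x / (c : ℂ) ^ (m + 1) := fun m => by
    -- The operator power is applied to both sides of the equation; the coefficients 1 and 0 put
    -- each side in the form a f + b g used by `iterate_stepOp_linear`.
    have h1 := iterate_stepOp_congr (lam := lam) (mud := mud) (lawW := lawW) (lawB := lawB)
      (f := fun x => (q : ℂ) * f x + 1 * L V x) (g := fun x => (c : ℂ) * V x + 0 * V x)
      (fun x hx => by simp [hstep x hx]) m hx
    rw [iterate_stepOp_linear hW hB hf (hV.stepOp hW hB),
      iterate_stepOp_linear hW hB hV hV, ← hL, ← Function.iterate_succ_apply] at h1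
    simp only [zero_mul, add_zero, one_mul] at h1
    rw [div_mul_eq_mul_div, eq_sub_of_add_eq h1]
    field_simp
    ring
  simp only [hterm]
  obtain ⟨K, ρ, hρ0, hρ1, hK⟩ :=
    exists_norm_iterate_stepOp_div_le (lawW := lawW) hlam hmud hB hW0 hB0 hq hV hx
  have h0 : Tendsto (fun m => (L^[m] V) x / (c : ℂ) ^ m) atTop (𝓝 0) := by
    refine squeeze_zero_norm hK ?_
    simpa using (tendsto_pow_atTop_nhds_zero_of_lt_one hρ0 hρ1).const_mul K
  have hs : ∀ k, ∑ m ∈ Finset.range k, ((L^[m] V) x / (c : ℂ) ^ m -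
      (L^[m + 1] V) x / (c : ℂ) ^ (m + 1)) = V x - (L^[k] V) x / (c : ℂ) ^ k := fun k => by
    rw [Finset.sum_range_sub']
    simp
  simp only [hs]
  simpa using h0.const_sub (V x)

end StepOperatorIteration

/-! ### Integrability and identification of the expectation. -/

section SurvivingSurplus

lemma integrable_of_ae_hasSum {E F : Type*} [MeasurableSpace E] {ν : Measure E}
    [NormedAddCommGroup F] [CompleteSpace F] {g : ℕ → E → F} {f : E → F}
    (hg : ∀ m, Integrable (g m) ν) (hsum : Summable fun m => ∫ x, ‖g m x‖ ∂ν)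
    (hf : ∀ᵐ x ∂ν, HasSum (fun m => g m x) (f x)) : Integrable f ν := by
  refine ⟨aestronglyMeasurable_of_tendsto_ae atTop
    (f := fun k x => ∑ m ∈ Finset.range k, g m x)
    (fun k => (integrable_finsetSum _ fun m _ => hg m).aestronglyMeasurable)
    (hf.mono fun x hx => hx.tendsto_sum_nat), ?_⟩
  rw [hasFiniteIntegral_iff_enorm]
  have h1 : ∫⁻ x, ‖f x‖ₑ ∂ν ≤ ∫⁻ x, ∑' m, ‖g m x‖ₑ ∂ν :=
    lintegral_mono_ae (hf.mono fun x hx => by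
      rw [← hx.tsum_eq]
      exact enorm_tsum_le_tsum_enorm)
  refine h1.trans_lt ?_
  rw [lintegral_tsum fun m => (hg m).aestronglyMeasurable.enorm]
  simp only [← ofReal_integral_norm_eq_lintegral_enorm (hg _)]
  exact hsum.tsum_ofReal_lt_top

variable {Ω : Type*} {mΩ : MeasurableSpace Ω} {P : Measure Ω}
  {lam mud t : ℝ} {lawW lawB : Measure ℝ}
  {N M : ℝ≥0 → Ω → ℕ} {W B : ℕ → Ω → ℝ} {T : Ω → ℝ≥0} {u : ℝ}

/-- A path that is nonnegative up to s keeps its level on some [s, s'), so the infimum is at least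
s' > s; this yields the strict inequality. -/
lemma RegularPath.lt_ruinTime_iff {ω : Ω} (h : RegularPath N M ω) (s : ℝ≥0) :
    (s : ℝ≥0∞) < ruinTime (surplus N M W B u) ω ↔ ∀ v ≤ s, 0 ≤ surplus N M W B u v ω := by
  refine ⟨fun hs v hv => ?_, fun hs => ?_⟩
  · by_contra! hneg
    have h1 : ruinTime (surplus N M W B u) ω ≤ v := iInf₂_le v hneg
    exact absurd (hs.trans_le h1) (not_lt.mpr (by exact_mod_cast hv))
  · obtain ⟨s', hs', hsub⟩ := mem_nhdsGE_iff_exists_Ico_subset.mp (h.const_after s)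
    refine lt_of_lt_of_le (b := (s' : ℝ≥0∞)) (by exact_mod_cast hs') (le_iInf₂ fun v hv => ?_)
    by_contra! hlt
    have hvs' : v < s' := by exact_mod_cast hlt
    refine absurd hv (not_lt.mpr ?_)
    rcases le_total v s with hvs | hsv
    · exact hs v hvs
    · have h1 := hsub ⟨hsv, hvs'⟩
      have h2 := hs s le_rfl
      rw [surplus] at h2 ⊢
      rwa [h1.1, h1.2]

lemma RegularPath.hasSum_survivalSum {ω : Ω} (h : RegularPath N M ω) :
    HasSum (fun m => survivalSum N M W B u (fun i j ω => (level W B u i j ω : ℂ)) m (T ω) ω)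
      (survivingSurplus N M W B T u ω : ℂ) := by
  classical
  have key : (survivingSurplus N M W B T u ω : ℂ) =
      survivalSum N M W B u (fun i j ω => (level W B u i j ω : ℂ))
        (N (T ω) ω + M (T ω) ω) (T ω) ω := by
    rw [h.survivalSum_eq, survivingSurplus]
    have hmem := h.lt_ruinTime_iff (W := W) (B := B) (u := u) (T ω)
    by_cases hs : ∀ v ≤ T ω, 0 ≤ surplus N M W B u v ω
    · rw [if_pos ⟨hs, rfl⟩, Set.indicator_of_mem (by exact hmem.mpr hs)]
      rfl
    · rw [if_neg fun hc => hs hc.1, Set.indicator_of_notMem (by exact fun hc => hs (hmem.mp hc)),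
        Complex.ofReal_zero]
  rw [key]
  refine hasSum_single _ fun m hm => ?_
  rw [h.survivalSum_eq, if_neg fun hc => hm hc.2.symm]

/-- At most one summand is nonzero, so the norm is again a survival sum, now for |x|, and its
expectation has the same closed form. -/
lemma RegularPath.norm_survivalSum {ω : Ω} (h : RegularPath N M ω) (m : ℕ) (s : ℝ≥0) :
    ((‖survivalSum N M W B u (fun i j ω => (level W B u i j ω : ℂ)) m s ω‖ : ℝ) : ℂ) =
      survivalSum N M W B u (fun i j ω => ((|level W B u i j ω| : ℝ) : ℂ)) m s ω := by
  classical
  rw [h.survivalSum_eq, h.survivalSum_eq]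
  split_ifs
  · rw [Complex.norm_real, Real.norm_eq_abs]
  · simp

lemma linearGrowth_ofReal : LinearGrowth fun x : ℝ => (x : ℂ) :=
  ⟨by fun_prop, 1, zero_le_one, fun x => by rw [Complex.norm_real, Real.norm_eq_abs]; linarith⟩

lemma linearGrowth_abs : LinearGrowth fun x : ℝ => ((|x| : ℝ) : ℂ) :=
  ⟨by fun_prop, 1, zero_le_one, fun x => by
    rw [Complex.norm_real, Real.norm_eq_abs, abs_abs]; linarith⟩

lemma IsPoolModel.summable_integral_norm_survivalSum [IsProbabilityMeasure P]
    [IsProbabilityMeasure lawW] [IsProbabilityMeasure lawB]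
    (h : IsPoolModel P lam mud t lawW lawB N M W B T)
    (hlam : 0 ≤ lam) (hmud : 0 ≤ mud) (ht : 0 < t)
    (hW : Integrable (fun w : ℝ => w) lawW) (hB : Integrable (fun b : ℝ => b) lawB)
    (hW0 : ∀ᵐ w ∂lawW, 0 < w) (hB0 : ∀ᵐ b ∂lawB, 0 < b) (hu : 0 ≤ u) :
    Summable fun m => ∫ ω, ‖survivalSum N M W B u
      (fun i j ω => (level W B u i j ω : ℂ)) m (T ω) ω‖ ∂P := by
  obtain ⟨K, ρ, hρ0, hρ1, hK⟩ := exists_norm_iterate_stepOp_div_le (lawW := lawW) hlam hmud hB hW0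
    hB0 (one_div_pos.mpr ht) linearGrowth_abs hu
  set c := lam + mud + 1 / t with hc
  have hc0 : 0 < c := by positivity
  refine Summable.of_norm_bounded (g := fun m => 1 / t / c * (K * ρ ^ m))
    (((summable_geometric_of_lt_one hρ0 hρ1).mul_left K).mul_left _) fun m => ?_
  have h1 : ((∫ ω, ‖survivalSum N M W B u
      (fun i j ω => (level W B u i j ω : ℂ)) m (T ω) ω‖ ∂P : ℝ) : ℂ) =
      ((1 / t / c : ℝ) : ℂ) *
        (((stepOp lam mud lawW lawB)^[m] fun x : ℝ => ((|x| : ℝ) : ℂ)) u / (c : ℂ) ^ m) := by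
    rw [← integral_complex_ofReal, integral_congr_ae
      (h.ae_regularPath.mono fun ω hω => hω.norm_survivalSum m (T ω)),
      h.integral_survivalSum_horizon hlam hmud ht hW hB hu linearGrowth_abs m]
    have : (c : ℂ) ≠ 0 := by exact_mod_cast hc0.ne'
    rw [← hc, Complex.ofReal_div _ c, pow_succ, div_mul_div_comm, div_mul_eq_mul_div,
      mul_comm (c : ℂ)]
  rw [← Complex.norm_real, h1, norm_mul, Complex.norm_real,
    Real.norm_of_nonneg (by positivity)]
  exact mul_le_mul_of_nonneg_left (hK m) (by positivity)

theorem IsPoolModel.integrable_survivingSurplus [IsProbabilityMeasure P]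
    [IsProbabilityMeasure lawW] [IsProbabilityMeasure lawB]
    (h : IsPoolModel P lam mud t lawW lawB N M W B T)
    (hlam : 0 ≤ lam) (hmud : 0 ≤ mud) (ht : 0 < t)
    (hW : Integrable (fun w : ℝ => w) lawW) (hB : Integrable (fun b : ℝ => b) lawB)
    (hW0 : ∀ᵐ w ∂lawW, 0 < w) (hB0 : ∀ᵐ b ∂lawB, 0 < b) (hu : 0 ≤ u) :
    Integrable (survivingSurplus N M W B T u) P := by
  have h1 : Integrable (fun ω => (survivingSurplus N M W B T u ω : ℂ)) P :=
    integrable_of_ae_hasSum (fun m => h.integrable_survivalSum_horizon hW hB linearGrowth_ofReal m)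
      (h.summable_integral_norm_survivalSum hlam hmud ht hW hB hW0 hB0 hu)
      (h.ae_regularPath.mono fun ω hω => hω.hasSum_survivalSum)
  simpa using h1.re

/-- Verification: a solution of linear growth of the renewal-type equation is the expected
surviving surplus. -/
theorem IsPoolModel.Vhat_eq [IsProbabilityMeasure P]
    [IsProbabilityMeasure lawW] [IsProbabilityMeasure lawB]
    (h : IsPoolModel P lam mud t lawW lawB N M W B T)
    (hlam : 0 ≤ lam) (hmud : 0 ≤ mud) (ht : 0 < t)
    (hW : Integrable (fun w : ℝ => w) lawW) (hB : Integrable (fun b : ℝ => b) lawB)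
    (hW0 : ∀ᵐ w ∂lawW, 0 < w) (hB0 : ∀ᵐ b ∂lawB, 0 < b) (hu : 0 ≤ u) {V : ℝ → ℂ}
    (hV : LinearGrowth V) (hstep : ∀ x : ℝ, 0 ≤ x → ((lam + mud + 1 / t : ℝ) : ℂ) * V x =
      (1 / t : ℝ) * x + stepOp lam mud lawW lawB V x) :
    (Vhat P N M W B T u : ℂ) = V u := by
  have h1 := hasSum_integral_of_summable_integral_norm
    (fun m => h.integrable_survivalSum_horizon (u := u) hW hB linearGrowth_ofReal m)
    (h.summable_integral_norm_survivalSum hlam hmud ht hW hB hW0 hB0 hu)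
  rw [integral_congr_ae (h.ae_regularPath.mono fun ω hω => hω.hasSum_survivalSum.tsum_eq),
    integral_complex_ofReal] at h1
  -- The partial sums of the series over the number of jumps have two limits: the expectation and
  -- the value of the solution V.
  have h2 := tendsto_sum_iterate_stepOp hlam hmud hW hB hW0 hB0 (one_div_pos.mpr ht)
    linearGrowth_ofReal hV hstep hu
  simp only [h.integral_survivalSum_horizon hlam hmud ht hW hB hu linearGrowth_ofReal] at h1
  exact tendsto_nhds_unique h1.tendsto_sum_nat h2

end SurvivingSurplus

/-! ### The candidate restricted to nonnegative capital. -/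

section Explicit

variable {n : ℕ} {A α β : Fin n → ℝ} {lam mud t : ℝ} {r : Fin n → ℂ}

/-- The cut at 0 is needed: on the negative axis the functions e^{-r_k x} grow exponentially. -/
lemma linearGrowth_indicator_explicitValue (hr : ∀ k, 0 < (r k).re) :
    LinearGrowth ((Set.Ici 0).indicator (explicitValue lam mud t A α β r)) := by
  refine ⟨continuous_explicitValue.measurable.indicator measurableSet_Ici,
    (∑ k, ‖coeffC lam mud t A α β r k‖ + ‖(t * (drift lam mud A α β : ℂ) : ℂ)‖) + 1,
    by positivity, fun x => ?_⟩
  set K := ∑ k, ‖coeffC lam mud t A α β r k‖ + ‖(t * (drift lam mud A α β : ℂ) : ℂ)‖ with hK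
  have hK0 : 0 ≤ K := by positivity
  by_cases hx : 0 ≤ x
  · rw [Set.indicator_of_mem (show x ∈ Set.Ici (0 : ℝ) from hx), abs_of_nonneg hx]
    refine (norm_explicitValue_le hr hx).trans ?_
    have : 0 ≤ K * x := by positivity
    linarith
  · rw [Set.indicator_of_notMem (by simpa using hx), norm_zero]
    positivity

lemma indicator_explicitValue_step (hα : IsCombExp A α) (hβ : IsCombExp A β) (ht : 0 < t)
    (hr : Function.Injective r) (hroot : ∀ k, r k ∈ lundbergRoots lam mud t A α β) {x : ℝ}
    (hx : 0 ≤ x) :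
    ((lam + mud + 1 / t : ℝ) : ℂ) * (Set.Ici 0).indicator (explicitValue lam mud t A α β r) x =
      (1 / t : ℝ) * x + stepOp lam mud (combExpMeasure A α) (combExpMeasure A β)
        ((Set.Ici 0).indicator (explicitValue lam mud t A α β r)) x := by
  rw [stepOp_congr (g := explicitValue lam mud t A α β r) fun y hy =>
    Set.indicator_of_mem (show y ∈ Set.Ici (0 : ℝ) from hy) _, stepOp,
    Set.indicator_of_mem (show x ∈ Set.Ici (0 : ℝ) from hx)]
  have := explicitValue_step (lam := lam) (mud := mud) hα hβ ht hr hroot hx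
  push_cast
  exact this

end Explicit

end MiningPool

/-! ### The theorem, assembled from the root count, integrability and verification. -/

theorem theorem4p2 {Ω : Type*} [MeasurableSpace Ω] (P : Measure Ω) [IsProbabilityMeasure P]
    {n : ℕ} (A α β : Fin n → ℝ) (a lam mud t : ℝ)
    (ha : 0 < a) (hlam : 0 < lam) (hmud : 0 < mud) (ht : 0 < t)
    (hW : MiningPool.IsCombExp A α) (hβ : ∀ i, β i = α i / a)
    (N M : ℝ≥0 → Ω → ℕ) (W B : ℕ → Ω → ℝ) (T : Ω → ℝ≥0)
    (hmodel : MiningPool.IsPoolModel P lam mud t (MiningPool.combExpMeasure A α)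
      (MiningPool.combExpMeasure A β) N M W B T) :
    -- counted with multiplicity, there are exactly `n` solutions with positive real part
    ((MiningPool.lundbergRoots lam mud t A α β).Finite ∧
      ∑ᶠ r ∈ MiningPool.lundbergRoots lam mud t A α β,
        analyticOrderNatAt (MiningPool.lundberg lam mud t A α β) r = n) ∧
    -- the expectation defining `V̂(u,t)` exists
    (∀ u : ℝ, 0 ≤ u → Integrable (MiningPool.survivingSurplus N M W B T u) P) ∧
    -- if `r 0, ..., r (n - 1)` are these solutions, pairwise distinct, the formula holds
    (∀ r : Fin n → ℂ, Function.Injective r →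
      Set.range r = MiningPool.lundbergRoots lam mud t A α β →
      ∀ u : ℝ, 0 ≤ u →
        (MiningPool.Vhat P N M W B T u : ℂ) =
          ∑ k, MiningPool.coeffC lam mud t A α β r k * Complex.exp (-r k * u) + u +
            t * ((∑ i, A i * (lam / β i - mud / α i) : ℝ) : ℂ)) := by
  have hB : MiningPool.IsCombExp A β := hW.scale ha hβ
  have := hW.isProbabilityMeasure
  have := hB.isProbabilityMeasure
  have hWi : Integrable (fun w : ℝ => w) (MiningPool.combExpMeasure A α) := by
    simpa using hW.integrable_id.re
  have hBi : Integrable (fun b : ℝ => b) (MiningPool.combExpMeasure A β) := by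
    simpa using hB.integrable_id.re
  refine ⟨MiningPool.lundbergRoots_count hW hB hlam hmud ht, fun u hu =>
    hmodel.integrable_survivingSurplus hlam.le hmud.le ht hWi hBi
      MiningPool.combExpMeasure_ae_pos MiningPool.combExpMeasure_ae_pos hu,
    fun r hr hrange u hu => ?_⟩
  have hroot : ∀ k, r k ∈ MiningPool.lundbergRoots lam mud t A α β := fun k =>
    hrange ▸ Set.mem_range_self k
  rw [hmodel.Vhat_eq hlam.le hmud.le ht hWi hBi
    MiningPool.combExpMeasure_ae_pos MiningPool.combExpMeasure_ae_pos hu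
    (MiningPool.linearGrowth_indicator_explicitValue fun k => (hroot k).1)
    fun x hx => MiningPool.indicator_explicitValue_step hW hB ht hr hroot hx,
    Set.indicator_of_mem (show u ∈ Set.Ici (0 : ℝ) from hu)]
  rfl
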